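/- Let $\Omega\subset\mathbb R^n$, $n\in\{2,3\}$, be a bounded domain (nonempty, open, connected). Write $\|f\|^2=\int_\Omega|f|^2$, $f_\Omega=\frac1{|\Omega|}\int_\Omega f$, $d_\Omega(x)=\operatorname{dist}(x,\partial\Omega)$, let $H_0^1(\Omega)$ be the closure of $C_c^\infty(\Omega)$ in $H^1(\Omega)$, and $|v|_1=\|\nabla v\|$. Derivatives are understood in the sense of distributions. Call $u,v\in L_2(\Omega)$ conjugate harmonic if, for $n=2$, $u,v$ are scalar and $\nabla u=(\partial_2v,-\partial_1v)$; for $n=3$, $u$ is scalar, $v$ is $\mathbb R^3$-valued, $\operatorname{rot}v=\nabla u$ and $\operatorname{div}v=0$. We say that $\Omega$ supports one of the following inequalities if it holds with some finite positive constant, and the domain constant is the infimum of the admissible positive constants ($+\infty$ if there is none). * Hardy (constant $H_\Omega$): $\|v/d_\Omega\|^2\le H\|\nabla v\|^2$ for all $v\in H_0^1(\Omega)^n$. * Friedrichs–Velte ($\Gamma_\Omega$): $\|u\|^2\le\Gamma\|v\|^2$ for all square integrable conjugate harmonic $u,v$ with $u_\Omega=0$. * Babuška–Aziz for $\operatorname{div}$: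 for each $u\in L_2(\Omega)$ with $u_\Omega=0$ there is $v\in H_0^1(\Omega)^n$ with $\operatorname{div}v=u$ and $|v|_1^2\le C\|u\|^2$. * Improved Poincaré ($P_\Omega$): for each $u\in L_{1,\mathrm{loc}}(\Omega)$ with $d_\Omega\nabla u\in L_2(\Omega)$ one has $u\in L_2(\Omega)$ and $\|u-u_\Omega\|^2\le P\|d_\Omega\nabla u\|^2$. For $n=3$ also: * Friedrichs–Velte for the rotation ($\tilde\Gamma_\Omega$): $\|v\|^2\le\tilde\Gamma\|u\|^2$ for all square integrable conjugate harmonic $u,v$ such that $v$ is in the orthogonal complement of the kernel of $\operatorname{rot}$ in $L_2(\Omega)^3$. * Babuška–Aziz for $\operatorname{rot}$: $|v|_1^2\le\tilde C\|\operatorname{rot}v\|^2$ for all $v$ in the orthogonal complement (with respect to the inner product of $|\cdot|_1$) of the kernel of $\operatorname{rot}$ in $H_0^1(\Omega)^3$. * Improved Poincaré for $\operatorname{rot}$ ($\tilde P_\Omega$): $\|v\|^2\le\tilde P\|d_\Omega\operatorname{rot}v\|^2$ for all $v$ in the orthogonal complement of the kernel of $\operatorname{rot}$ in $L_2(\Omega)^3$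 with $d_\Omega\operatorname{rot}v\in L_2(\Omega)^3$. **Theorem.** Suppose that $\Omega$ supports the Hardy inequality. Then the following are equivalent: $\Omega$ supports the Friedrichs–Velte inequality; $\Omega$ supports the Babuška–Aziz inequality for $\operatorname{div}$; $\Omega$ supports the improved Poincaré inequality. Moreover $$\tfrac14\Gamma_\Omega\le P_\Omega\le H_\Omega(1+\Gamma_\Omega).$$ If $n=3$, the following are also equivalent: $\Omega$ supports the Friedrichs–Velte inequality for the rotation; $\Omega$ supports the Babuška–Aziz inequality for $\operatorname{rot}$; $\Omega$ supports the improved Poincaré inequality for $\operatorname{rot}$. Moreover $$\tfrac14\tilde\Gamma_\Omega\le\tilde P_\Omega\le H_\Omega(1+\tilde\Gamma_\Omega).$$ (The inequalities between constants hold in $[0,\infty]$.) -/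

import Mathlib

open MeasureTheory
open scoped ENNReal NNReal ContDiff

noncomputable section

/-- Euclidean space `ℝⁿ`. -/
abbrev Vec (n : ℕ) : Type := EuclideanSpace ℝ (Fin n)

/-- A bounded domain: a nonempty connected bounded open set. -/
structure IsBoundedDomain {n : ℕ} (Ω : Set (Vec n)) : Prop where
  isOpen : IsOpen Ω
  isConnected : IsConnected Ω
  isBounded : Bornology.IsBounded Ω

/-- The boundary distance `d_Ω(x) = dist(x, ∂Ω)`. -/
def bdryDist {n : ℕ} (Ω : Set (Vec n)) (x : Vec n) : ℝ := Metric.infDist x (frontier Ω)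

/-- Membership in `L₂(Ω)` (scalar or vector valued). -/
def MemL2 {n : ℕ} {F : Type} [NormedAddCommGroup F] (Ω : Set (Vec n)) (f : Vec n → F) : Prop :=
  MemLp f 2 (volume.restrict Ω)

/-- `‖f‖² = ∫_Ω |f|²`, with values in `[0, ∞]`. -/
def sqNorm {n : ℕ} {F : Type} [NormedAddCommGroup F] (Ω : Set (Vec n)) (f : Vec n → F) : ℝ≥0∞ :=
  ∫⁻ x in Ω, ‖f x‖ₑ ^ 2

/-- The class `C_c^∞(Ω)` (scalar or vector valued). -/
def IsTestFun {n : ℕ} {F : Type} [NormedAddCommGroup F] [NormedSpace ℝ F]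
    (Ω : Set (Vec n)) (φ : Vec n → F) : Prop :=
  ContDiff ℝ ∞ φ ∧ HasCompactSupport φ ∧ tsupport φ ⊆ Ω

/-- `g` is the distributional gradient of `u` in `Ω`. -/
def HasWeakGradient {n : ℕ} (Ω : Set (Vec n)) (u : Vec n → ℝ) (g : Vec n → Vec n) : Prop :=
  LocallyIntegrableOn u Ω volume ∧ LocallyIntegrableOn g Ω volume ∧
    ∀ φ : Vec n → ℝ, IsTestFun Ω φ →
      ∫ x in Ω, u x • gradient φ x = -∫ x in Ω, φ x • g x

/-- `u ∈ H₀¹(Ω)` with gradient `g`: `u` and its distributional gradient `g` are square integrable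
and `u` is a limit of test functions in the norm `(‖·‖² + ‖∇·‖²)^{1/2}`. -/
def HasH10Gradient {n : ℕ} (Ω : Set (Vec n)) (u : Vec n → ℝ) (g : Vec n → Vec n) : Prop :=
  MemL2 Ω u ∧ MemL2 Ω g ∧ HasWeakGradient Ω u g ∧
    ∀ ε : ℝ≥0∞, 0 < ε → ∃ φ : Vec n → ℝ, IsTestFun Ω φ ∧
      sqNorm Ω (fun x => u x - φ x) + sqNorm Ω (fun x => g x - gradient φ x) < ε

/-- `v ∈ H₀¹(Ω)ⁿ`, where `G j` is the gradient of the component `v_j`, so `G j x i = ∂ᵢ v_j (x)`. -/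
def HasH10Jacobian {n : ℕ} (Ω : Set (Vec n)) (v : Vec n → Vec n)
    (G : Fin n → Vec n → Vec n) : Prop :=
  ∀ j, HasH10Gradient Ω (fun x => v x j) (G j)

/-- The square `|v|₁² = ‖∇v‖²` of the seminorm, in terms of the gradients of the components. -/
def sqSeminorm {n : ℕ} (Ω : Set (Vec n)) (G : Fin n → Vec n → Vec n) : ℝ≥0∞ :=
  ∑ j, sqNorm Ω (G j)

/-- Divergence from the derivatives `J j i = ∂ᵢ v_j` at a point. -/
def divOf {n : ℕ} (J : Fin n → Vec n) : ℝ := ∑ j, J j j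

/-- Rotation from the derivatives `J j i = ∂ᵢ v_j` at a point. -/
def rotOf (J : Fin 3 → Vec 3) : Vec 3 :=
  !₂[J 2 1 - J 1 2, J 0 2 - J 2 0, J 1 0 - J 0 1]

/-- Classical divergence of a smooth vector field. -/
def divField {n : ℕ} (ψ : Vec n → Vec n) (x : Vec n) : ℝ :=
  divOf fun j => gradient (fun y => ψ y j) x

/-- Classical rotation of a smooth vector field. -/
def rotField (ψ : Vec 3 → Vec 3) (x : Vec 3) : Vec 3 :=
  rotOf fun j => gradient (fun y => ψ y j) x

/-- `∇^⊥ φ = (∂₂φ, -∂₁φ)` from `∇φ`. -/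
def perp (g : Vec 2) : Vec 2 := !₂[g 1, -g 0]

/-- `r` is the distributional rotation of `v` in `Ω`. -/
def HasWeakRot (Ω : Set (Vec 3)) (v r : Vec 3 → Vec 3) : Prop :=
  LocallyIntegrableOn v Ω volume ∧ LocallyIntegrableOn r Ω volume ∧
    ∀ ψ : Vec 3 → Vec 3, IsTestFun Ω ψ →
      ∫ x in Ω, inner ℝ (v x) (rotField ψ x) = ∫ x in Ω, inner ℝ (r x) (ψ x)

/-- `v` lies in the orthogonal complement of the kernel of `rot` in `L₂(Ω)³`. -/
def OrthKerRotL2 (Ω : Set (Vec 3)) (v : Vec 3 → Vec 3) : Prop :=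
  MemL2 Ω v ∧ ∀ k : Vec 3 → Vec 3, MemL2 Ω k → HasWeakRot Ω k (fun _ => 0) →
    ∫ x in Ω, inner ℝ (v x) (k x) = 0

/-- `v ∈ H₀¹(Ω)³`, with gradients `G`, lies in the orthogonal complement of the kernel of `rot`
in `H₀¹(Ω)³`, with respect to the inner product of `|·|₁`. -/
def OrthKerRotH10 (Ω : Set (Vec 3)) (v : Vec 3 → Vec 3) (G : Fin 3 → Vec 3 → Vec 3) : Prop :=
  HasH10Jacobian Ω v G ∧ ∀ (k : Vec 3 → Vec 3) (K : Fin 3 → Vec 3 → Vec 3),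
    HasH10Jacobian Ω k K → (∀ᵐ x ∂volume.restrict Ω, rotOf (fun j => K j x) = 0) →
      ∑ j, ∫ x in Ω, inner ℝ (G j x) (K j x) = 0

/-- Square integrable conjugate harmonic functions on a planar domain: the Cauchy-Riemann equations
`∇u = ∇^⊥ v` in the sense of distributions. -/
def IsConjHarmonic2 (Ω : Set (Vec 2)) (u v : Vec 2 → ℝ) : Prop :=
  MemL2 Ω u ∧ MemL2 Ω v ∧
    ∀ φ : Vec 2 → ℝ, IsTestFun Ω φ →
      ∫ x in Ω, u x • gradient φ x = ∫ x in Ω, v x • perp (gradient φ x)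

/-- Square integrable conjugate harmonic functions on a spatial domain: the Moisil-Teodorescu
equations `rot v = ∇u`, `div v = 0` in the sense of distributions. -/
def IsConjHarmonic3 (Ω : Set (Vec 3)) (u : Vec 3 → ℝ) (v : Vec 3 → Vec 3) : Prop :=
  MemL2 Ω u ∧ MemL2 Ω v ∧
    (∀ ψ : Vec 3 → Vec 3, IsTestFun Ω ψ →
      ∫ x in Ω, inner ℝ (v x) (rotField ψ x) = -∫ x in Ω, u x * divField ψ x) ∧
    (∀ φ : Vec 3 → ℝ, IsTestFun Ω φ → ∫ x in Ω, inner ℝ (v x) (gradient φ x) = 0)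

/-- Friedrichs-Velte inequality with constant `Γ`, planar case. -/
def FriedrichsVelte2 (Ω : Set (Vec 2)) (Γ : ℝ≥0) : Prop :=
  ∀ u v : Vec 2 → ℝ, IsConjHarmonic2 Ω u v → ⨍ x in Ω, u x = 0 →
    sqNorm Ω u ≤ Γ * sqNorm Ω v

/-- Friedrichs-Velte inequality with constant `Γ`, spatial case. -/
def FriedrichsVelte3 (Ω : Set (Vec 3)) (Γ : ℝ≥0) : Prop :=
  ∀ (u : Vec 3 → ℝ) (v : Vec 3 → Vec 3), IsConjHarmonic3 Ω u v → ⨍ x in Ω, u x = 0 →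
    sqNorm Ω u ≤ Γ * sqNorm Ω v

/-- Friedrichs-Velte inequality for the rotation with constant `Γ`. -/
def FriedrichsVelteRot (Ω : Set (Vec 3)) (Γ : ℝ≥0) : Prop :=
  ∀ (u : Vec 3 → ℝ) (v : Vec 3 → Vec 3), IsConjHarmonic3 Ω u v → OrthKerRotL2 Ω v →
    sqNorm Ω v ≤ Γ * sqNorm Ω u

/-- Babuška-Aziz inequality for the divergence with constant `C`. -/
def BabuskaAzizDiv {n : ℕ} (Ω : Set (Vec n)) (C : ℝ≥0) : Prop :=
  ∀ u : Vec n → ℝ, MemL2 Ω u → ⨍ x in Ω, u x = 0 →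
    ∃ (v : Vec n → Vec n) (G : Fin n → Vec n → Vec n), HasH10Jacobian Ω v G ∧
      (∀ᵐ x ∂volume.restrict Ω, divOf (fun j => G j x) = u x) ∧
      sqSeminorm Ω G ≤ C * sqNorm Ω u

/-- Babuška-Aziz inequality for the rotation with constant `C`. -/
def BabuskaAzizRot (Ω : Set (Vec 3)) (C : ℝ≥0) : Prop :=
  ∀ (v : Vec 3 → Vec 3) (G : Fin 3 → Vec 3 → Vec 3), OrthKerRotH10 Ω v G →
    sqSeminorm Ω G ≤ C * sqNorm Ω (fun x => rotOf (fun j => G j x))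

/-- Improved Poincaré inequality with constant `P`, for all `u ∈ L_{1,loc}(Ω)` with
`d_Ω ∇u ∈ L₂(Ω)`; such `u` then belong to `L₂(Ω)`, so that their mean value exists. -/
def ImprovedPoincare {n : ℕ} (Ω : Set (Vec n)) (P : ℝ≥0) : Prop :=
  ∀ (u : Vec n → ℝ) (g : Vec n → Vec n), HasWeakGradient Ω u g →
    MemL2 Ω (fun x => bdryDist Ω x • g x) →
      MemL2 Ω u ∧
      sqNorm Ω (fun x => u x - ⨍ y in Ω, u y) ≤ P * sqNorm Ω (fun x => bdryDist Ω x • g x)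

/-- Improved Poincaré inequality for the rotation with constant `P`. -/
def ImprovedPoincareRot (Ω : Set (Vec 3)) (P : ℝ≥0) : Prop :=
  ∀ v r : Vec 3 → Vec 3, OrthKerRotL2 Ω v → HasWeakRot Ω v r →
    MemL2 Ω (fun x => bdryDist Ω x • r x) →
      sqNorm Ω v ≤ P * sqNorm Ω (fun x => bdryDist Ω x • r x)

/-- Hardy inequality with constant `H`. -/
def Hardy {n : ℕ} (Ω : Set (Vec n)) (H : ℝ≥0) : Prop :=
  ∀ (v : Vec n → Vec n) (G : Fin n → Vec n → Vec n), HasH10Jacobian Ω v G →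
    sqNorm Ω (fun x => (bdryDist Ω x)⁻¹ • v x) ≤ H * sqSeminorm Ω G

/-- A domain supports an inequality if it holds with some positive finite constant. -/
def Supports {n : ℕ} (ineq : Set (Vec n) → ℝ≥0 → Prop) (Ω : Set (Vec n)) : Prop :=
  ∃ C : ℝ≥0, 0 < C ∧ ineq Ω C

/-- The best constant in an inequality on `Ω`; it is `∞` if `Ω` does not support it. -/
def bestConst {n : ℕ} (ineq : Set (Vec n) → ℝ≥0 → Prop) (Ω : Set (Vec n)) : ℝ≥0∞ :=
  ⨅ (C : ℝ≥0) (_ : 0 < C ∧ ineq Ω C), (C : ℝ≥0∞)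

end

/-! ### Calculus of test functions -/

section Calculus

variable {n : ℕ}

/-! Everything rests on `‖∇ψ‖² = ‖div ψ‖² + ‖rot ψ‖²` in `H₀¹`, obtained by integrating by parts
twice on test fields and passing to limits (`norm_sq_of_mem_jacClosure`). It makes `(div, rot)` an
isometry into a product of `L₂` spaces. The orthogonal complement of its range consists of the pairs
with `⟨u, div ψ⟩ + ⟨v, rot ψ⟩ = 0` for all test fields, which are the conjugate pairs, apart from
the condition `div v = 0` in space.

The Friedrichs–Velte inequality is thus an angle condition on that complement. With `D = div`, `S =
rot` and `g = D* x`, the splitting `(x, 0) = (D g, S g) + (x - D g, -S g)` is orthogonal, and `‖x -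
D g‖² ≤ Γ ‖S g‖²` yields `‖x‖² ≤ (1 + Γ) ‖D* x‖²`. Hence `D` has a right inverse of square norm at
most `1 + Γ` (`exists_preimage_of_complement_bound`). Exchanging `div` and `rot` gives the second
half of the theorem. Conversely, testing conjugacy with controlled preimages recovers
Friedrichs–Velte.

The improved Poincaré inequality follows from a right inverse and Hardy: if `div k = u - u_Ω`, then
`‖u - u_Ω‖² = ⟨u, div k⟩ = -⟨d ∇u, k / d⟩ ≤ ‖d ∇u‖ √H ‖∇k‖`. Functions not known to be in `L₂` are
treated by smooth truncation. Hardy also ensures that limits of Jacobians of test fields are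
Jacobians of genuine `H₀¹` fields.

For the way back one needs `‖d ∇u‖² ≤ 4 ‖v‖²`, or `‖d ∇u‖² ≤ 4 ‖u‖²` for the rotation. These are
Caccioppoli estimates with a cutoff `χ` close to `d` and `|∇χ| ≤ 1`. They are proved for a
mollification `w` of `u`; in the first, the test field is `χ² ∇w`, whose rotation contains no second
derivatives of `w`. A duality argument carries the bounds to the weak gradient of `u`, so no
interior regularity theory is used. -/

theorem gradient_coord (f : Vec n → ℝ) (x : Vec n) (i : Fin n) :
    gradient f x i = fderiv ℝ f x (EuclideanSpace.single i 1) := by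
  rw [← inner_gradient_left, EuclideanSpace.inner_single_right]
  simp

theorem contDiff_gradient {f : Vec n → ℝ} (hf : ContDiff ℝ ∞ f) : ContDiff ℝ ∞ (gradient f) := by
  have h : ContDiff ℝ ∞ (fderiv ℝ f) := hf.fderiv_right (by simp)
  exact (InnerProductSpace.toDual ℝ (Vec n)).symm.toContinuousLinearEquiv.contDiff.comp h

theorem tsupport_gradient_subset (f : Vec n → ℝ) : tsupport (gradient f) ⊆ tsupport f := by
  refine closure_minimal (fun x hx => ?_) (isClosed_tsupport f)
  by_contra h
  apply hx
  have h0 : fderiv ℝ f x = 0 := by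
    by_contra h1
    exact h (support_fderiv_subset ℝ h1)
  simp [gradient, h0]

theorem gradient_add' {f g : Vec n → ℝ} {x : Vec n} (hf : DifferentiableAt ℝ f x)
    (hg : DifferentiableAt ℝ g x) :
    gradient (fun y => f y + g y) x = gradient f x + gradient g x := by
  ext i
  simp only [PiLp.add_apply, gradient_coord]
  rw [fderiv_fun_add hf hg]; rfl

theorem gradient_const_mul' {f : Vec n → ℝ} {x : Vec n} (c : ℝ) (hf : DifferentiableAt ℝ f x) :
    gradient (fun y => c * f y) x = c • gradient f x := by
  ext i
  simp only [PiLp.smul_apply, gradient_coord]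
  rw [fderiv_const_mul hf]; rfl

theorem gradient_mul' {f g : Vec n → ℝ} {x : Vec n} (hf : DifferentiableAt ℝ f x)
    (hg : DifferentiableAt ℝ g x) :
    gradient (fun y => f y * g y) x = f x • gradient g x + g x • gradient f x := by
  ext i
  simp only [PiLp.add_apply, PiLp.smul_apply, gradient_coord]
  rw [fderiv_fun_mul hf hg]; rfl

theorem gradient_comp_add (f : Vec n → ℝ) (y x : Vec n) :
    gradient (fun z => f (z + y)) x = gradient f (x + y) := by
  simp only [gradient, fderiv_comp_add_right]

theorem gradient_scalar_comp {f : Vec n → ℝ} {T : ℝ → ℝ} {x : Vec n}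
    (hT : DifferentiableAt ℝ T (f x)) (hf : DifferentiableAt ℝ f x) :
    gradient (fun y => T (f y)) x = deriv T (f x) • gradient f x := by
  ext i
  simp only [PiLp.smul_apply, gradient_coord]
  have := (hT.hasDerivAt.comp_hasFDerivAt x hf.hasFDerivAt).fderiv
  rw [show (fun y => T (f y)) = T ∘ f from rfl, this]; rfl

/-- The Jacobian of a vector field, as the family of gradients of its components. -/
noncomputable def jac (ψ : Vec n → Vec n) (x : Vec n) : Fin n → Vec n :=
  fun j => gradient (fun y => ψ y j) x

variable {Ω : Set (Vec n)}

section
variable {F : Type} [NormedAddCommGroup F] [NormedSpace ℝ F]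

theorem IsTestFun.continuous {φ : Vec n → F} (h : IsTestFun Ω φ) : Continuous φ := h.1.continuous

theorem IsTestFun.differentiable {φ : Vec n → F} (h : IsTestFun Ω φ) : Differentiable ℝ φ :=
  h.1.differentiable (by simp)

theorem IsTestFun.eq_zero {φ : Vec n → F} (h : IsTestFun Ω φ) {x : Vec n} (hx : x ∉ Ω) :
    φ x = 0 := image_eq_zero_of_notMem_tsupport fun h' => hx (h.2.2 h')

theorem IsTestFun.of_tsupport_subset {G : Type} [NormedAddCommGroup G] [NormedSpace ℝ G]
    {φ : Vec n → F} (h : IsTestFun Ω φ) {ψ : Vec n → G}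
    (hψ : ContDiff ℝ ∞ ψ) (hs : tsupport ψ ⊆ tsupport φ) : IsTestFun Ω ψ :=
  ⟨hψ, h.2.1.of_isClosed_subset (isClosed_tsupport _) hs, hs.trans h.2.2⟩

theorem IsTestFun.of_support_subset {G : Type} [NormedAddCommGroup G] [NormedSpace ℝ G]
    {φ : Vec n → F} (h : IsTestFun Ω φ) {ψ : Vec n → G}
    (hψ : ContDiff ℝ ∞ ψ) (hs : ∀ x, φ x = 0 → ψ x = 0) : IsTestFun Ω ψ :=
  h.of_tsupport_subset hψ (closure_mono fun x hx h0 => hx (hs x h0))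

theorem IsTestFun.zero : IsTestFun Ω (fun _ : Vec n => (0 : F)) :=
  ⟨contDiff_const, HasCompactSupport.zero, by
    rw [show (fun _ : Vec n => (0 : F)) = 0 from rfl, tsupport_zero]; simp⟩

theorem IsTestFun.add {φ ψ : Vec n → F} (hφ : IsTestFun Ω φ) (hψ : IsTestFun Ω ψ) :
    IsTestFun Ω (fun x => φ x + ψ x) :=
  ⟨hφ.1.add hψ.1, hφ.2.1.add hψ.2.1,
    (tsupport_add φ ψ).trans (Set.union_subset hφ.2.2 hψ.2.2)⟩

theorem IsTestFun.const_smul {φ : Vec n → F} (c : ℝ) (hφ : IsTestFun Ω φ) :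
    IsTestFun Ω (fun x => c • φ x) :=
  hφ.of_support_subset (hφ.1.const_smul c) (fun x hx => by simp [hx])

theorem IsTestFun.memLp {φ : Vec n → F} (h : IsTestFun Ω φ) (p : ℝ≥0∞) :
    MemLp φ p (volume.restrict Ω) :=
  (h.continuous.memLp_of_hasCompactSupport h.2.1).restrict Ω

theorem IsTestFun.setIntegral_eq {φ : Vec n → F} (h : IsTestFun Ω φ) :
    ∫ x in Ω, φ x = ∫ x, φ x :=
  setIntegral_eq_integral_of_forall_compl_eq_zero fun _ hx => h.eq_zero hx

end

theorem IsTestFun.coord {ψ : Vec n → Vec n} (h : IsTestFun Ω ψ) (j : Fin n) :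
    IsTestFun Ω (fun x => ψ x j) :=
  h.of_support_subset (contDiff_euclidean.1 h.1 j) (fun x hx => by simp [hx])

theorem IsTestFun.grad {φ : Vec n → ℝ} (h : IsTestFun Ω φ) : IsTestFun Ω (gradient φ) :=
  h.of_tsupport_subset (contDiff_gradient h.1) (tsupport_gradient_subset φ)

theorem IsTestFun.smul_single {φ : Vec n → ℝ} (h : IsTestFun Ω φ) (j : Fin n) :
    IsTestFun Ω (fun x => φ x • EuclideanSpace.single j (1 : ℝ)) :=
  h.of_support_subset (h.1.smul contDiff_const) (fun x hx => by simp [hx])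

theorem IsTestFun.of_coord {φ : Fin n → Vec n → ℝ} (h : ∀ j, IsTestFun Ω (φ j)) :
    IsTestFun Ω (fun x => WithLp.toLp 2 (fun j => φ j x) : Vec n → Vec n) := by
  have hc : ContDiff ℝ ∞ (fun x => WithLp.toLp 2 (fun j => φ j x) : Vec n → Vec n) :=
    contDiff_euclidean.2 fun j => (h j).1
  have hs : tsupport (fun x => WithLp.toLp 2 (fun j => φ j x) : Vec n → Vec n)
      ⊆ ⋃ j, tsupport (φ j) := by
    refine closure_minimal (fun x hx => ?_)
      (isClosed_iUnion_of_finite fun j => isClosed_tsupport _)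
    by_contra hcon
    simp only [Set.mem_iUnion, not_exists] at hcon
    apply hx
    ext j
    simpa using image_eq_zero_of_notMem_tsupport (hcon j)
  exact ⟨hc, (isCompact_iUnion fun j => (h j).2.1).of_isClosed_subset (isClosed_tsupport _) hs,
    hs.trans (Set.iUnion_subset fun j => (h j).2.2)⟩

theorem IsTestFun.linear_jac {F : Type} [NormedAddCommGroup F] [NormedSpace ℝ F]
    (L : (Fin n → Vec n) →ₗ[ℝ] F) {ψ : Vec n → Vec n} (h : IsTestFun Ω ψ) :
    IsTestFun Ω (fun x => L (jac ψ x)) := by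
  have hc : ContDiff ℝ ∞ (jac ψ) :=
    contDiff_pi.2 fun j => contDiff_gradient (h.coord j).1
  refine h.of_tsupport_subset ((LinearMap.toContinuousLinearMap L).contDiff.comp hc) ?_
  refine closure_minimal (fun x hx => ?_) (isClosed_tsupport _)
  by_contra hcon
  apply hx
  have : jac ψ x = 0 := by
    ext1 j
    refine image_eq_zero_of_notMem_tsupport (f := gradient (fun y => ψ y j)) fun h' => hcon ?_
    have hsub : Function.support (fun y => ψ y j) ⊆ Function.support ψ :=
      fun y hy h0 => hy (by simp [h0])
    exact closure_mono hsub (tsupport_gradient_subset (fun y => ψ y j) h')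
  simp [this]

/-- The divergence as a linear map on Jacobians. -/
noncomputable def divLin (n : ℕ) : (Fin n → Vec n) →ₗ[ℝ] ℝ where
  toFun := divOf
  map_add' J K := by simp [divOf, Finset.sum_add_distrib]
  map_smul' c J := by simp [divOf, Finset.mul_sum]

theorem divField_eq (ψ : Vec n → Vec n) (x : Vec n) : divField ψ x = divLin n (jac ψ x) := rfl

theorem jac_add {φ ψ : Vec n → Vec n} {x : Vec n} (hφ : DifferentiableAt ℝ φ x)
    (hψ : DifferentiableAt ℝ ψ x) : jac (fun y => φ y + ψ y) x = jac φ x + jac ψ x := by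
  ext1 j
  exact gradient_add' (differentiableAt_euclidean.1 hφ j) (differentiableAt_euclidean.1 hψ j)

theorem jac_const_smul {ψ : Vec n → Vec n} {x : Vec n} (c : ℝ)
    (hψ : DifferentiableAt ℝ ψ x) : jac (fun y => c • ψ y) x = c • jac ψ x := by
  ext1 j
  exact gradient_const_mul' c (differentiableAt_euclidean.1 hψ j)

theorem jac_comp_add (ψ : Vec n → Vec n) (y x : Vec n) :
    jac (fun z => ψ (z + y)) x = jac ψ (x + y) := by
  ext1 j
  exact gradient_comp_add (fun z => ψ z j) y x

/-- Integration by parts against a compactly supported function. -/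
theorem integral_mul_gradient {f φ : Vec n → ℝ} (hf : ContDiff ℝ ∞ f) (hφ : ContDiff ℝ ∞ φ)
    (hc : HasCompactSupport φ) (i : Fin n) :
    ∫ x, f x * gradient φ x i = -∫ x, gradient f x i * φ x := by
  simp only [gradient_coord]
  have cf : Continuous (fun x => fderiv ℝ f x (EuclideanSpace.single i 1)) :=
    (hf.continuous_fderiv (by simp)).clm_apply continuous_const
  have cφ : Continuous (fun x => fderiv ℝ φ x (EuclideanSpace.single i 1)) :=
    (hφ.continuous_fderiv (by simp)).clm_apply continuous_const
  have hc' : HasCompactSupport (fun x => fderiv ℝ φ x (EuclideanSpace.single i 1)) :=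
    hc.fderiv_apply ℝ _
  exact integral_mul_fderiv_eq_neg_fderiv_mul_of_integrable
    ((cf.mul hφ.continuous).integrable_of_hasCompactSupport hc.mul_left)
    ((hf.continuous.mul cφ).integrable_of_hasCompactSupport hc'.mul_left)
    ((hf.continuous.mul hφ.continuous).integrable_of_hasCompactSupport hc.mul_left)
    (fun x _ => hf.differentiable (by simp) x) (fun x _ => hφ.differentiable (by simp) x)

/-- Second derivatives commute. -/
theorem gradient_gradient_comm {f : Vec n → ℝ} (hf : ContDiff ℝ ∞ f) (x : Vec n) (i j : Fin n) :
    gradient (fun y => gradient f y i) x j = gradient (fun y => gradient f y j) x i := by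
  simp only [gradient_coord]
  have hd : DifferentiableAt ℝ (fderiv ℝ f) x :=
    (hf.fderiv_right (m := ∞) (by simp)).differentiable (by simp) x
  have h (v : Vec n) : fderiv ℝ (fun y => fderiv ℝ f y v) x = (fderiv ℝ (fderiv ℝ f) x).flip v := by
    rw [fderiv_clm_apply hd (differentiableAt_const v)]
    ext; simp
  rw [h, h]
  exact (hf.contDiffAt.isSymmSndFDerivAt (by simp; exact WithTop.coe_le_coe.2 (le_top : (2 : ℕ∞) ≤ ⊤))) _ _

/-- Two integrations by parts exchange the two derivatives. Summed over `i`, `j` with `ψ = χ`, this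
says that `tr (J²)` and `(div ψ)²` have the same integral. -/
theorem integral_jac_mul_comm {ψ χ : Vec n → Vec n} (hψ : IsTestFun Ω ψ) (hχ : IsTestFun Ω χ)
    (i j : Fin n) :
    ∫ x, jac ψ x j i * jac χ x i j = ∫ x, jac ψ x j j * jac χ x i i := by
  have h1 : ∫ x, jac ψ x j i * jac χ x i j =
      -∫ x, gradient (fun y => jac ψ y j i) x j * χ x i :=
    integral_mul_gradient (contDiff_euclidean.1 (contDiff_gradient (hψ.coord j).1) i)
      (hχ.coord i).1 (hχ.coord i).2.1 j
  have h2 : ∫ x, jac ψ x j j * jac χ x i i =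
      -∫ x, gradient (fun y => jac ψ y j j) x i * χ x i :=
    integral_mul_gradient (contDiff_euclidean.1 (contDiff_gradient (hψ.coord j).1) j)
      (hχ.coord i).1 (hχ.coord i).2.1 i
  rw [h1, h2]
  congr 2
  ext x
  congr 1
  exact gradient_gradient_comm (hψ.coord j).1 x i j

end Calculus

/-! ### Rotation symbols -/

section RotSymbol

variable {n : ℕ} {F : Type} [NormedAddCommGroup F] [InnerProductSpace ℝ F]

/-- A linear map on Jacobians whose square is `|J|² - tr (J²)`; the rotation in dimensions two
and three is of this form. -/
def IsRotSymbol (ρ : (Fin n → Vec n) →ₗ[ℝ] F) : Prop :=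
  ∀ J : Fin n → Vec n, ‖ρ J‖ ^ 2 = ∑ j, ∑ i, J j i ^ 2 - ∑ j, ∑ i, J j i * J i j

/-- The rotation in dimension two. -/
def rotLin₂ : (Fin 2 → Vec 2) →ₗ[ℝ] ℝ where
  toFun J := J 1 0 - J 0 1
  map_add' J K := by simp; ring
  map_smul' c J := by simp; ring

/-- The rotation in dimension three. -/
noncomputable def rotLin₃ : (Fin 3 → Vec 3) →ₗ[ℝ] Vec 3 where
  toFun := rotOf
  map_add' J K := by ext i; fin_cases i <;> simp [rotOf] <;> ring
  map_smul' c J := by ext i; fin_cases i <;> simp [rotOf] <;> ring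

theorem isRotSymbol_rotLin₂ : IsRotSymbol rotLin₂ := by
  intro J
  simp only [rotLin₂, LinearMap.coe_mk, AddHom.coe_mk, Real.norm_eq_abs, sq_abs, Fin.sum_univ_two]
  ring

theorem isRotSymbol_rotLin₃ : IsRotSymbol rotLin₃ := by
  intro J
  simp only [rotLin₃, LinearMap.coe_mk, AddHom.coe_mk, EuclideanSpace.norm_sq_eq,
    Real.norm_eq_abs, sq_abs, Fin.sum_univ_three, rotOf]
  simp
  ring

/-- Since Hessians are symmetric, this yields `rot ∇ = 0`. -/
theorem IsRotSymbol.eq_zero_of_symm {ρ : (Fin n → Vec n) →ₗ[ℝ] F} (hρ : IsRotSymbol ρ)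
    {J : Fin n → Vec n} (hJ : ∀ i j, J j i = J i j) : ρ J = 0 := by
  have h := hρ J
  have h2 : ‖ρ J‖ ^ 2 = 0 := by
    rw [h, sub_eq_zero]
    refine Finset.sum_congr rfl fun j _ => Finset.sum_congr rfl fun i _ => ?_
    rw [← hJ i j]; ring
  simpa using h2

/-- The square of the left side is `|a|² |b|² - (a · b)²`, as for a cross product. -/
theorem IsRotSymbol.norm_tensor_le {ρ : (Fin n → Vec n) →ₗ[ℝ] F} (hρ : IsRotSymbol ρ)
    (a b : Vec n) : ‖ρ (fun j => b j • a)‖ ≤ ‖a‖ * ‖b‖ := by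
  refine le_of_sq_le_sq ?_ (by positivity)
  rw [hρ, mul_pow, EuclideanSpace.norm_sq_eq, EuclideanSpace.norm_sq_eq]
  simp only [PiLp.smul_apply, smul_eq_mul, Real.norm_eq_abs, sq_abs]
  have h1 : ∑ j, ∑ i, (b j * a i) ^ 2 = (∑ i, a i ^ 2) * ∑ j, b j ^ 2 := by
    rw [mul_comm, Finset.sum_mul_sum]
    simp only [mul_pow]
  have h2 : ∑ j, ∑ i, b j * a i * (b i * a j) = (∑ i, a i * b i) * ∑ i, a i * b i := by
    rw [Finset.sum_mul_sum]
    exact Finset.sum_congr rfl fun j _ => Finset.sum_congr rfl fun i _ => by ring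
  rw [h1, h2]
  nlinarith [mul_self_nonneg (∑ i, a i * b i)]

end RotSymbol

/-! ### Square integrable functions -/

section SquareIntegrable

variable {n : ℕ} {Ω : Set (Vec n)} {F : Type} [NormedAddCommGroup F]

/-- The Hilbert space `L₂(Ω)`. -/
abbrev L2 (Ω : Set (Vec n)) (F : Type) [NormedAddCommGroup F] : Type :=
  Lp F 2 (volume.restrict Ω)

theorem enorm_toLp_sq {f : Vec n → F} (hf : MemLp f 2 (volume.restrict Ω)) :
    sqNorm Ω f = ‖MemLp.toLp f hf‖ₑ ^ 2 := by
  rw [Lp.enorm_toLp, sqNorm, eLpNorm_eq_lintegral_rpow_enorm_toReal (by simp) (by simp)]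
  simp only [ENNReal.toReal_ofNat, ENNReal.rpow_ofNat]
  rw [← ENNReal.rpow_natCast, ← ENNReal.rpow_mul]
  norm_num

theorem sqNorm_eq_ofReal {f : Vec n → F} (hf : MemLp f 2 (volume.restrict Ω)) :
    sqNorm Ω f = ENNReal.ofReal (‖MemLp.toLp f hf‖ ^ 2) := by
  rw [enorm_toLp_sq hf, ← ofReal_norm, ENNReal.ofReal_pow (norm_nonneg _)]

theorem sqNorm_lp (f : L2 Ω F) : sqNorm Ω f = ENNReal.ofReal (‖f‖ ^ 2) := by
  rw [sqNorm_eq_ofReal (Lp.memLp f), Lp.toLp_coeFn]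

theorem sqNorm_congr {F' : Type} [NormedAddCommGroup F'] {f : Vec n → F} {g : Vec n → F'}
    (h : ∀ᵐ x ∂volume.restrict Ω, ‖f x‖ = ‖g x‖) : sqNorm Ω f = sqNorm Ω g := by
  refine lintegral_congr_ae ?_
  filter_upwards [h] with x hx
  rw [← ofReal_norm, hx, ofReal_norm]

theorem memL2_of_sqNorm {f : Vec n → F} (hm : AEStronglyMeasurable f (volume.restrict Ω))
    (hf : sqNorm Ω f ≠ ⊤) : MemL2 Ω f := by
  refine ⟨hm, ?_⟩
  rw [eLpNorm_lt_top_iff_lintegral_rpow_enorm_lt_top (by simp) (by simp)]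
  simpa [sqNorm, lt_top_iff_ne_top] using hf

variable [InnerProductSpace ℝ F]

theorem inner_toLp {f g : Vec n → F} (hf : MemLp f 2 (volume.restrict Ω)) (hg : MemLp g 2 (volume.restrict Ω)) :
    inner ℝ (MemLp.toLp f hf) (MemLp.toLp g hg) = ∫ x in Ω, inner ℝ (f x) (g x) := by
  rw [L2.inner_def]
  refine integral_congr_ae ?_
  filter_upwards [hf.coeFn_toLp, hg.coeFn_toLp] with x h1 h2
  rw [h1, h2]

theorem norm_toLp_sq {f : Vec n → F} (hf : MemLp f 2 (volume.restrict Ω)) :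
    ‖MemLp.toLp f hf‖ ^ 2 = ∫ x in Ω, ‖f x‖ ^ 2 := by
  rw [← real_inner_self_eq_norm_sq, inner_toLp]
  simp

end SquareIntegrable

/-! ### The space of gradients of `H₀¹` fields -/

section GradientSpace

variable {n : ℕ} {Ω : Set (Vec n)} {F : Type} [NormedAddCommGroup F] [InnerProductSpace ℝ F]

/-- The space of smooth compactly supported vector fields. -/
def testFields (Ω : Set (Vec n)) : Submodule ℝ (Vec n → Vec n) where
  carrier := {ψ | IsTestFun Ω ψ}
  add_mem' h h' := h.add h'
  zero_mem' := IsTestFun.zero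
  smul_mem' c _ h := h.const_smul c

theorem isTest_coe (ψ : testFields Ω) : IsTestFun Ω ψ.1 := ψ.2

/-- Families of `n` square integrable vector fields, the ambient space of Jacobians. -/
abbrev JacSpace (Ω : Set (Vec n)) : Type := PiLp 2 (fun _ : Fin n => L2 Ω (Vec n))

theorem IsTestFun.jac {ψ : Vec n → Vec n} (h : IsTestFun Ω ψ) (j : Fin n) :
    IsTestFun Ω (fun x => jac ψ x j) := (h.coord j).grad

/-- The Jacobian of a test field as an element of `L₂`. -/
noncomputable def jacMap (Ω : Set (Vec n)) : testFields Ω →ₗ[ℝ] JacSpace Ω where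
  toFun ψ := WithLp.toLp 2 fun j => MemLp.toLp _ (((isTest_coe ψ).jac j).memLp 2)
  map_add' ψ χ := by
    ext1 j
    simp only [PiLp.add_apply]
    rw [← MemLp.toLp_add]
    congr 1
    ext1 x
    exact congrFun (jac_add ((isTest_coe ψ).differentiable x) ((isTest_coe χ).differentiable x)) j
  map_smul' c ψ := by
    ext1 j
    simp only [PiLp.smul_apply, RingHom.id_apply]
    rw [← MemLp.toLp_const_smul]
    congr 1
    ext1 x
    exact congrFun (jac_const_smul c ((isTest_coe ψ).differentiable x)) j

/-- A linear map applied pointwise to a Jacobian. -/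
noncomputable def compJac (Ω : Set (Vec n)) (L : (Fin n → Vec n) →ₗ[ℝ] F) :
    JacSpace Ω →L[ℝ] L2 Ω F :=
  ∑ j, (ContinuousLinearMap.compLpL 2 (volume.restrict Ω)
    (LinearMap.toContinuousLinearMap (L ∘ₗ LinearMap.single ℝ (fun _ => Vec n) j))).comp
      (PiLp.proj 2 (fun _ : Fin n => L2 Ω (Vec n)) j)

theorem coeFn_compJac (L : (Fin n → Vec n) →ₗ[ℝ] F) (g : JacSpace Ω) :
    compJac Ω L g =ᵐ[volume.restrict Ω] fun x => L (fun j => g j x) := by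
  have h1 : ∀ᵐ x ∂volume.restrict Ω, ∀ j, ContinuousLinearMap.compLp
      (LinearMap.toContinuousLinearMap (L ∘ₗ LinearMap.single ℝ (fun _ => Vec n) j)) (g j) x =
      L (Pi.single j (g j x)) :=
    ae_all_iff.2 fun j => ContinuousLinearMap.coeFn_compLp _ _
  have h2 : compJac Ω L g = ∑ j, ContinuousLinearMap.compLp
      (LinearMap.toContinuousLinearMap (L ∘ₗ LinearMap.single ℝ (fun _ => Vec n) j)) (g j) := by
    simp [compJac]
    rfl
  have h3 := Lp.coeFn_finsetSum Finset.univ (fun j => ContinuousLinearMap.compLp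
      (LinearMap.toContinuousLinearMap (L ∘ₗ LinearMap.single ℝ (fun _ => Vec n) j)) (g j))
  rw [h2]
  filter_upwards [h1, h3] with x hx hx'
  rw [hx']
  simp only [Finset.sum_apply, hx]
  rw [← map_sum, Finset.univ_sum_single (fun j => g j x)]

theorem compJac_jacMap (L : (Fin n → Vec n) →ₗ[ℝ] F) (ψ : testFields Ω) :
    compJac Ω L (jacMap Ω ψ) = MemLp.toLp _ (((isTest_coe ψ).linear_jac L).memLp 2) := by
  refine Lp.ext ?_
  have h1 : ∀ᵐ x ∂volume.restrict Ω, ∀ j, jacMap Ω ψ j x = jac ψ.1 x j :=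
    ae_all_iff.2 fun j => (((isTest_coe ψ).jac j).memLp 2).coeFn_toLp
  filter_upwards [h1, coeFn_compJac L (jacMap Ω ψ),
    (((isTest_coe ψ).linear_jac L).memLp 2).coeFn_toLp] with x hx h2 h3
  rw [h2, h3]
  congr 1
  ext1 j
  exact hx j

theorem compJac_toLp (L : (Fin n → Vec n) →ₗ[ℝ] F) {G : Fin n → Vec n → Vec n}
    (hG : ∀ j, MemLp (G j) 2 (volume.restrict Ω)) :
    compJac Ω L (WithLp.toLp 2 fun j => MemLp.toLp (G j) (hG j)) =ᵐ[volume.restrict Ω]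
      fun x => L (fun j => G j x) := by
  have h1 : ∀ᵐ x ∂volume.restrict Ω, ∀ j, MemLp.toLp (G j) (hG j) x = G j x :=
    ae_all_iff.2 fun j => (hG j).coeFn_toLp
  filter_upwards [h1, coeFn_compJac L (WithLp.toLp 2 fun j => MemLp.toLp (G j) (hG j))]
    with x hx h2
  rw [h2]
  congr 1
  ext1 j
  exact hx j

/-- The space of Jacobians of `H₀¹` fields. -/
noncomputable def jacClosure (Ω : Set (Vec n)) : Submodule ℝ (JacSpace Ω) :=
  (LinearMap.range (jacMap Ω)).topologicalClosure

theorem isClosed_jacClosure (Ω : Set (Vec n)) : IsClosed (jacClosure Ω : Set (JacSpace Ω)) :=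
  Submodule.isClosed_topologicalClosure _

instance (Ω : Set (Vec n)) : CompleteSpace (jacClosure Ω) :=
  (isClosed_jacClosure Ω).completeSpace_coe

theorem jacMap_mem (ψ : testFields Ω) : jacMap Ω ψ ∈ jacClosure Ω :=
  Submodule.le_topologicalClosure _ ⟨ψ, rfl⟩

theorem jacClosure_induction {p : JacSpace Ω → Prop} (hp : IsClosed {g | p g})
    (h : ∀ ψ : testFields Ω, p (jacMap Ω ψ)) {g : JacSpace Ω} (hg : g ∈ jacClosure Ω) : p g := by
  have : (jacClosure Ω : Set (JacSpace Ω)) ⊆ {g | p g} := by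
    refine closure_minimal ?_ hp
    rintro _ ⟨ψ, rfl⟩
    exact h ψ
  exact this hg

/-- Pointwise, `(div ψ)² + |ρ J|²` exceeds `|J|²` by `(tr J)² - tr (J²)`, which integrates to zero
for test fields. -/
theorem norm_sq_jacMap {ρ : (Fin n → Vec n) →ₗ[ℝ] F} (hρ : IsRotSymbol ρ) (ψ : testFields Ω) :
    ‖jacMap Ω ψ‖ ^ 2 =
      ‖compJac Ω (divLin n) (jacMap Ω ψ)‖ ^ 2 + ‖compJac Ω ρ (jacMap Ω ψ)‖ ^ 2 := by
  have hψ := (isTest_coe ψ)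
  have hint (i j k l : Fin n) : Integrable (fun x => jac ψ.1 x i j * jac ψ.1 x k l) :=
    ((hψ.jac i).coord j).continuous.mul ((hψ.jac k).coord l).continuous
      |>.integrable_of_hasCompactSupport ((hψ.jac k).coord l).2.1.mul_left
  have hL : ‖jacMap Ω ψ‖ ^ 2 = ∫ x, ∑ j, ∑ i, jac ψ.1 x j i ^ 2 := by
    rw [PiLp.norm_sq_eq_of_L2, integral_finsetSum]
    · refine Finset.sum_congr rfl fun j _ => ?_
      refine (norm_toLp_sq ((hψ.jac j).memLp 2)).trans ?_
      simp only [EuclideanSpace.norm_sq_eq, Real.norm_eq_abs, sq_abs]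
      refine setIntegral_eq_integral_of_forall_compl_eq_zero fun x hx => ?_
      simp [(hψ.jac j).eq_zero hx]
    · intro j _
      refine integrable_finsetSum _ fun i _ => ?_
      simpa only [pow_two] using hint j i j i
  have hD : ‖compJac Ω (divLin n) (jacMap Ω ψ)‖ ^ 2 =
      ∫ x, ∑ j, ∑ i, jac ψ.1 x j j * jac ψ.1 x i i := by
    rw [compJac_jacMap, norm_toLp_sq ((IsTestFun.linear_jac (divLin n) hψ).memLp 2)]
    rw [setIntegral_eq_integral_of_forall_compl_eq_zero]
    · congr 1
      ext1 x
      rw [Real.norm_eq_abs, sq_abs, pow_two, ← Finset.sum_mul_sum]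
      rfl
    · intro x hx
      rw [(IsTestFun.linear_jac (divLin n) hψ).eq_zero hx]; simp
  have hR : ‖compJac Ω ρ (jacMap Ω ψ)‖ ^ 2 =
      ∫ x, ((∑ j, ∑ i, jac ψ.1 x j i ^ 2) - ∑ j, ∑ i, jac ψ.1 x j i * jac ψ.1 x i j) := by
    rw [compJac_jacMap, norm_toLp_sq ((IsTestFun.linear_jac ρ hψ).memLp 2)]
    rw [setIntegral_eq_integral_of_forall_compl_eq_zero]
    · congr 1
      ext1 x
      exact hρ _
    · intro x hx
      rw [(IsTestFun.linear_jac ρ hψ).eq_zero hx]; simp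
  have hsw : ∫ x, ∑ j, ∑ i, jac ψ.1 x j j * jac ψ.1 x i i =
      ∫ x, ∑ j, ∑ i, jac ψ.1 x j i * jac ψ.1 x i j := by
    rw [integral_finsetSum _ fun j _ => integrable_finsetSum _ fun i _ => hint j j i i,
      integral_finsetSum _ fun j _ => integrable_finsetSum _ fun i _ => hint j i i j]
    refine Finset.sum_congr rfl fun j _ => ?_
    rw [integral_finsetSum _ fun i _ => hint j j i i,
      integral_finsetSum _ fun i _ => hint j i i j]
    exact Finset.sum_congr rfl fun i _ => (integral_jac_mul_comm hψ hψ i j).symm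
  rw [hL, hD, hR, hsw, integral_sub]
  · ring
  · refine integrable_finsetSum _ fun j _ => integrable_finsetSum _ fun i _ => ?_
    simpa only [pow_two] using hint j i j i
  · exact integrable_finsetSum _ fun j _ => integrable_finsetSum _ fun i _ => hint _ _ _ _

theorem norm_sq_of_mem_jacClosure {ρ : (Fin n → Vec n) →ₗ[ℝ] F} (hρ : IsRotSymbol ρ)
    {g : JacSpace Ω} (hg : g ∈ jacClosure Ω) :
    ‖g‖ ^ 2 = ‖compJac Ω (divLin n) g‖ ^ 2 + ‖compJac Ω ρ g‖ ^ 2 :=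
  jacClosure_induction (p := fun g => ‖g‖ ^ 2 =
      ‖compJac Ω (divLin n) g‖ ^ 2 + ‖compJac Ω ρ g‖ ^ 2)
    (isClosed_eq (by fun_prop) (by fun_prop)) (norm_sq_jacMap hρ) hg

end GradientSpace

/-! ### Geometry of bounded domains -/

section Domain

variable {n : ℕ} {Ω : Set (Vec n)}

theorem lipschitz_bdryDist (Ω : Set (Vec n)) : LipschitzWith 1 (bdryDist Ω) :=
  Metric.lipschitz_infDist_pt _

theorem continuous_bdryDist (Ω : Set (Vec n)) : Continuous (bdryDist Ω) :=
  (lipschitz_bdryDist Ω).continuous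

namespace IsBoundedDomain

theorem measure_lt_top (h : IsBoundedDomain Ω) : volume Ω < ⊤ := h.isBounded.measure_lt_top

theorem isFiniteMeasure (h : IsBoundedDomain Ω) : IsFiniteMeasure (volume.restrict Ω) :=
  ⟨by simpa using h.measure_lt_top⟩

theorem measure_pos (h : IsBoundedDomain Ω) : 0 < volume Ω :=
  h.isOpen.measure_pos _ h.isConnected.nonempty

variable [Nontrivial (Vec n)]

theorem ne_univ (h : IsBoundedDomain Ω) : Ω ≠ Set.univ := by
  rintro rfl
  exact NormedSpace.unbounded_univ ℝ (Vec n) h.isBounded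

theorem frontier_nonempty (h : IsBoundedDomain Ω) : (frontier Ω).Nonempty := by
  rw [Set.nonempty_iff_ne_empty, Ne, ← isClopen_iff_frontier_eq_empty, isClopen_iff]
  exact not_or.2 ⟨h.isConnected.nonempty.ne_empty, h.ne_univ⟩

theorem bdryDist_pos (h : IsBoundedDomain Ω) {x : Vec n} (hx : x ∈ Ω) : 0 < bdryDist Ω x := by
  refine (isClosed_frontier.notMem_iff_infDist_pos h.frontier_nonempty).1 fun hf => ?_
  exact hf.2 (by rwa [h.isOpen.interior_eq])

theorem bdryDist_le_infDist_compl (h : IsBoundedDomain Ω) {x : Vec n} (hx : x ∈ Ω) :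
    bdryDist Ω x ≤ Metric.infDist x Ωᶜ := by
  obtain ⟨y, hy, hxy⟩ := exists_mem_frontier_infDist_compl_eq_dist hx h.ne_univ
  rw [hxy]
  exact Metric.infDist_le_dist_of_mem hy

theorem exists_bdryDist_le (h : IsBoundedDomain Ω) :
    ∃ B : ℝ, 0 < B ∧ ∀ x ∈ Ω, bdryDist Ω x ≤ B := by
  obtain ⟨y, hy⟩ := h.frontier_nonempty
  obtain ⟨B, hB⟩ := h.isBounded.subset_closedBall y
  refine ⟨max B 1, by positivity, fun x hx => ?_⟩
  exact (Metric.infDist_le_dist_of_mem hy).trans ((Metric.mem_closedBall.1 (hB hx)).trans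
    (le_max_left _ _))

theorem continuousOn_inv_bdryDist (h : IsBoundedDomain Ω) :
    ContinuousOn (fun x => (bdryDist Ω x)⁻¹) Ω :=
  (continuous_bdryDist Ω).continuousOn.inv₀ fun _ hx => (h.bdryDist_pos hx).ne'

end IsBoundedDomain

variable [Nontrivial (Vec n)]

/-- The weight is continuous in `Ω`, and `ψ` vanishes near every point outside `Ω`. -/
theorem IsTestFun.inv_bdryDist_smul_continuous {ψ : Vec n → Vec n} (h : IsBoundedDomain Ω)
    (hψ : IsTestFun Ω ψ) : Continuous (fun x => (bdryDist Ω x)⁻¹ • ψ x) := by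
  rw [continuous_iff_continuousAt]
  intro x
  by_cases hx : x ∈ Ω
  · exact ((h.continuousOn_inv_bdryDist.continuousAt (h.isOpen.mem_nhds hx)).smul
      hψ.continuous.continuousAt)
  · have h0 : (fun y => (bdryDist Ω y)⁻¹ • ψ y) =ᶠ[nhds x] fun _ => 0 := by
      have := notMem_tsupport_iff_eventuallyEq.1 (fun h' => hx (hψ.2.2 h'))
      filter_upwards [this] with y hy
      simp [hy]
    exact continuousAt_const.congr h0.symm

theorem IsTestFun.inv_bdryDist_smul_memLp {ψ : Vec n → Vec n} (h : IsBoundedDomain Ω)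
    (hψ : IsTestFun Ω ψ) :
    MemLp (fun x => (bdryDist Ω x)⁻¹ • ψ x) 2 (volume.restrict Ω) := by
  refine ((hψ.inv_bdryDist_smul_continuous h).memLp_of_hasCompactSupport ?_).restrict Ω
  exact hψ.2.1.smul_left (f := fun x => (bdryDist Ω x)⁻¹)

end Domain

/-! ### Weak gradients -/

section WeakGradient

variable {n : ℕ} {Ω : Set (Vec n)}

theorem IsTestFun.integrableOn_smul {F : Type} [NormedAddCommGroup F] [NormedSpace ℝ F]
    {φ : Vec n → ℝ} (hφ : IsTestFun Ω φ) {g : Vec n → F} (hg : LocallyIntegrableOn g Ω volume) :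
    IntegrableOn (fun x => φ x • g x) Ω := by
  have h1 : IntegrableOn (fun x => φ x • g x) (tsupport φ) :=
    (hg.integrableOn_compact_subset hφ.2.2 hφ.2.1).continuousOn_smul
      hφ.continuous.continuousOn hφ.2.1
  have h2 : Function.support (fun x => φ x • g x) ⊆ tsupport φ := by
    intro x hx
    refine subset_tsupport φ fun h0 => hx ?_
    simp [h0]
  exact ((integrableOn_iff_integrable_of_support_subset h2).1 h1).integrableOn

theorem LocallyIntegrableOn.coord {g : Vec n → Vec n} (hg : LocallyIntegrableOn g Ω volume)
    (i : Fin n) : LocallyIntegrableOn (fun x => g x i) Ω volume := fun x hx =>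
  (hg x hx).imp fun _ hs => ⟨hs.1, (EuclideanSpace.proj i : Vec n →L[ℝ] ℝ).integrable_comp hs.2⟩

theorem MemLp.locallyIntegrableOn {F : Type} [NormedAddCommGroup F] (h : IsBoundedDomain Ω)
    {f : Vec n → F} (hf : MemLp f 2 (volume.restrict Ω)) : LocallyIntegrableOn f Ω volume := by
  have := h.isFiniteMeasure
  have h1 : IntegrableOn f Ω := hf.integrable (by norm_num)
  exact h1.locallyIntegrableOn

theorem setIntegral_coord {f : Vec n → Vec n} (hf : IntegrableOn f Ω) (i : Fin n) :
    (∫ x in Ω, f x) i = ∫ x in Ω, f x i :=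
  ((EuclideanSpace.proj i : Vec n →L[ℝ] ℝ).integral_comp_comm hf).symm

/-- Coordinates may be taken under the Bochner integrals because both integrands are integrable,
thanks to the compact support of `φ`. -/
theorem weak_gradient_identity_iff {u : Vec n → ℝ} {g : Vec n → Vec n}
    (hu : LocallyIntegrableOn u Ω volume) (hg : LocallyIntegrableOn g Ω volume)
    {φ : Vec n → ℝ} (hφ : IsTestFun Ω φ) :
    (∫ x in Ω, u x • gradient φ x = -∫ x in Ω, φ x • g x) ↔
      ∀ i, ∫ x in Ω, u x * gradient φ x i = -∫ x in Ω, φ x * g x i := by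
  have h1 : IntegrableOn (fun x => u x • gradient φ x) Ω := by
    refine Integrable.of_eval_piLp fun i => ?_
    simpa [mul_comm, IntegrableOn] using (hφ.grad.coord i).integrableOn_smul hu
  have h2 : IntegrableOn (fun x => φ x • g x) Ω := hφ.integrableOn_smul hg
  constructor
  · intro h i
    have := congrArg (fun v : Vec n => v i) h
    simp only [PiLp.neg_apply] at this
    rwa [setIntegral_coord h1, setIntegral_coord h2] at this
  · intro h
    ext i
    rw [PiLp.neg_apply, setIntegral_coord h1, setIntegral_coord h2]
    exact h i

theorem HasWeakGradient.coord {u : Vec n → ℝ} {g : Vec n → Vec n} (h : HasWeakGradient Ω u g)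
    {φ : Vec n → ℝ} (hφ : IsTestFun Ω φ) (i : Fin n) :
    ∫ x in Ω, u x * gradient φ x i = -∫ x in Ω, φ x * g x i :=
  (weak_gradient_identity_iff h.1 h.2.1 hφ).1 (h.2.2 φ hφ) i

theorem HasWeakGradient.integral_mul_div {u : Vec n → ℝ} {g : Vec n → Vec n}
    (h : HasWeakGradient Ω u g) {ψ : Vec n → Vec n} (hψ : IsTestFun Ω ψ) :
    ∫ x in Ω, u x * divField ψ x = -∫ x in Ω, inner ℝ (g x) (ψ x) := by
  have h1 : ∫ x in Ω, u x * divField ψ x = ∑ j, ∫ x in Ω, u x * gradient (fun y => ψ y j) x j := by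
    rw [← integral_finsetSum]
    · simp only [divField, divOf, Finset.mul_sum]
    · intro j _
      simpa [mul_comm, IntegrableOn] using ((hψ.coord j).grad.coord j).integrableOn_smul h.1
  have h2 : ∫ x in Ω, inner ℝ (g x) (ψ x) = ∑ j, ∫ x in Ω, ψ x j * g x j := by
    rw [← integral_finsetSum]
    · simp [PiLp.inner_apply]
    · intro j _
      exact (hψ.coord j).integrableOn_smul (LocallyIntegrableOn.coord h.2.1 j)
  rw [h1, h2, ← Finset.sum_neg_distrib]
  exact Finset.sum_congr rfl fun j _ => h.coord (hψ.coord j) j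

theorem IsTestFun.hasWeakGradient {f : Vec n → ℝ} (hf : IsTestFun Ω f) :
    HasWeakGradient Ω f (gradient f) := by
  have h1 : LocallyIntegrableOn f Ω volume :=
    hf.continuous.locallyIntegrable.locallyIntegrableOn _
  have h2 : LocallyIntegrableOn (gradient f) Ω volume :=
    hf.grad.continuous.locallyIntegrable.locallyIntegrableOn _
  refine ⟨h1, h2, fun φ hφ => (weak_gradient_identity_iff h1 h2 hφ).2 fun i => ?_⟩
  rw [setIntegral_eq_integral_of_forall_compl_eq_zero fun x hx => by simp [hf.eq_zero hx],
    setIntegral_eq_integral_of_forall_compl_eq_zero fun x hx => by simp [hφ.eq_zero hx],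
    integral_mul_gradient hf.1 hφ.1 hφ.2.1 i]
  simp only [mul_comm]

theorem IsTestFun.hasH10Jacobian {ψ : Vec n → Vec n} (hψ : IsTestFun Ω ψ) :
    HasH10Jacobian Ω ψ (fun j x => _root_.jac ψ x j) := fun j =>
  ⟨(hψ.coord j).memLp 2, (hψ.jac j).memLp 2, (hψ.coord j).hasWeakGradient, fun ε hε =>
    ⟨_, hψ.coord j, by simpa [sqNorm, _root_.jac] using hε⟩⟩

end WeakGradient

/-! ### Fields in `H₀¹` and their Jacobians -/

section H10

variable {n : ℕ} {Ω : Set (Vec n)}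

theorem sqSeminorm_eq {G : Fin n → Vec n → Vec n}
    (hG : ∀ j, MemLp (G j) 2 (volume.restrict Ω)) :
    sqSeminorm Ω G =
      ENNReal.ofReal (‖(WithLp.toLp 2 fun j => MemLp.toLp (G j) (hG j) : JacSpace Ω)‖ ^ 2) := by
  rw [PiLp.norm_sq_eq_of_L2, ENNReal.ofReal_sum_of_nonneg fun _ _ => by positivity]
  exact Finset.sum_congr rfl fun j _ => sqNorm_eq_ofReal (hG j)

theorem sqSeminorm_coe (g : JacSpace Ω) :
    sqSeminorm Ω (fun j => g j) = ENNReal.ofReal (‖g‖ ^ 2) := by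
  rw [PiLp.norm_sq_eq_of_L2, ENNReal.ofReal_sum_of_nonneg fun _ _ => by positivity]
  exact Finset.sum_congr rfl fun j _ => sqNorm_lp (g j)

theorem sqSeminorm_jac (ψ : testFields Ω) :
    sqSeminorm Ω (fun j x => jac ψ.1 x j) = ENNReal.ofReal (‖jacMap Ω ψ‖ ^ 2) :=
  sqSeminorm_eq fun j => ((isTest_coe ψ).jac j).memLp 2

theorem HasH10Jacobian.memLp {v : Vec n → Vec n} {G : Fin n → Vec n → Vec n}
    (h : HasH10Jacobian Ω v G) (j : Fin n) : MemLp (G j) 2 (volume.restrict Ω) := (h j).2.1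

/-- The element of `JacSpace Ω` given by the Jacobian of an `H₀¹` field. -/
noncomputable def HasH10Jacobian.toJac {v : Vec n → Vec n} {G : Fin n → Vec n → Vec n}
    (h : HasH10Jacobian Ω v G) : JacSpace Ω :=
  WithLp.toLp 2 fun j => MemLp.toLp (G j) (h.memLp j)

theorem HasH10Jacobian.toJac_mem {v : Vec n → Vec n} {G : Fin n → Vec n → Vec n}
    (h : HasH10Jacobian Ω v G) : h.toJac ∈ jacClosure Ω := by
  refine Metric.mem_closure_iff.2 fun ε hε => ?_
  -- The components are approximated separately. The share `ε² / (n + 1)` keeps the sum of `n`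
  -- errors strictly below `ε²`, also for `n = 0`.
  have hη : 0 < ε ^ 2 / (n + 1) := by positivity
  have h1 (j : Fin n) : ∃ φ : Vec n → ℝ, ∃ hφ : IsTestFun Ω φ,
      ‖MemLp.toLp (G j) (h.memLp j) - MemLp.toLp _ (hφ.grad.memLp 2)‖ ^ 2 < ε ^ 2 / (n + 1) := by
    obtain ⟨φ, hφ, hlt⟩ := (h j).2.2.2 (ENNReal.ofReal (ε ^ 2 / (n + 1))) (by simpa using hη)
    refine ⟨φ, hφ, ?_⟩
    have h2 := lt_of_le_of_lt le_add_self hlt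
    rw [← MemLp.toLp_sub]
    have h3 := sqNorm_eq_ofReal ((h.memLp j).sub (hφ.grad.memLp 2))
    change sqNorm Ω (fun x => G j x - gradient φ x) = _ at h3
    rw [h3] at h2
    exact (ENNReal.ofReal_lt_ofReal_iff hη).1 h2
  choose φ hφ hlt using h1
  refine ⟨_, ⟨⟨_, IsTestFun.of_coord hφ⟩, rfl⟩, ?_⟩
  rw [dist_eq_norm]
  refine lt_of_pow_lt_pow_left₀ 2 hε.le ?_
  rw [PiLp.norm_sq_eq_of_L2]
  calc ∑ j, _ ≤ ∑ _j : Fin n, ε ^ 2 / (n + 1) :=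
        Finset.sum_le_sum fun j _ => (hlt j).le
    _ = n * (ε ^ 2 / (n + 1)) := by simp
    _ < ε ^ 2 := by
      rw [mul_div_assoc', div_lt_iff₀ (by positivity)]
      nlinarith [sq_nonneg ε, sq_pos_of_pos hε]

/-- A test field as an element of `L₂`. -/
noncomputable def valMap (Ω : Set (Vec n)) : testFields Ω →ₗ[ℝ] L2 Ω (Vec n) where
  toFun ψ := MemLp.toLp ψ.1 ((isTest_coe ψ).memLp 2)
  map_add' _ _ := rfl
  map_smul' _ _ := rfl

theorem Hardy.norm_le [Nontrivial (Vec n)] {H : ℝ≥0} (hH : Hardy Ω H) (h : IsBoundedDomain Ω)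
    (ψ : testFields Ω) :
    ‖MemLp.toLp _ ((isTest_coe ψ).inv_bdryDist_smul_memLp h)‖ ≤ √H * ‖jacMap Ω ψ‖ := by
  have h1 := hH ψ.1 _ ((isTest_coe ψ).hasH10Jacobian)
  rw [sqSeminorm_jac, sqNorm_eq_ofReal ((isTest_coe ψ).inv_bdryDist_smul_memLp h),
    ← ENNReal.ofReal_coe_nnreal, ← ENNReal.ofReal_mul H.coe_nonneg,
    ENNReal.ofReal_le_ofReal_iff (by positivity)] at h1
  refine le_of_sq_le_sq ?_ (by positivity)
  rwa [mul_pow, Real.sq_sqrt H.coe_nonneg]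

/-- The Friedrichs inequality: `d ≤ B` on a bounded domain, so `‖ψ‖ ≤ B ‖ψ / d‖` and Hardy applies.
-/
theorem Hardy.norm_valMap_le [Nontrivial (Vec n)] {H : ℝ≥0} (hH : Hardy Ω H)
    (h : IsBoundedDomain Ω) : ∃ c : ℝ, ∀ ψ : testFields Ω, ‖valMap Ω ψ‖ ≤ c * ‖jacMap Ω ψ‖ := by
  obtain ⟨B, hB, hd⟩ := h.exists_bdryDist_le
  refine ⟨B * √H, fun ψ => ?_⟩
  have h1 : ‖valMap Ω ψ‖ ≤ B * ‖MemLp.toLp _ ((isTest_coe ψ).inv_bdryDist_smul_memLp h)‖ := by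
    refine Lp.norm_le_mul_norm_of_ae_le_mul ?_
    filter_upwards [((isTest_coe ψ).memLp 2).coeFn_toLp,
      ((isTest_coe ψ).inv_bdryDist_smul_memLp h).coeFn_toLp,
      ae_restrict_mem h.isOpen.measurableSet] with x hx1 hx2 hx
    rw [hx2]
    change ‖MemLp.toLp ψ.1 ((isTest_coe ψ).memLp 2) x‖ ≤ _
    rw [hx1, norm_smul, norm_inv, Real.norm_of_nonneg (h.bdryDist_pos hx).le, ← mul_assoc]
    refine le_mul_of_one_le_left (norm_nonneg _) ?_
    rw [← div_eq_mul_inv, one_le_div (h.bdryDist_pos hx)]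
    exact hd x hx
  calc _ ≤ _ := h1
    _ ≤ B * (√H * ‖jacMap Ω ψ‖) := by gcongr; exact hH.norm_le h ψ
    _ = _ := by ring

end H10

/-! ### Limits of Jacobians as Jacobians of `H₀¹` fields -/

section H10Realization

variable {n : ℕ} {Ω : Set (Vec n)}

/-- If `Ω` supports the Hardy inequality, every limit of Jacobians of test fields is the Jacobian
of an `H₀¹` field. -/
theorem Hardy.exists_hasH10Jacobian [Nontrivial (Vec n)] {H : ℝ≥0} (hH : Hardy Ω H)
    (h : IsBoundedDomain Ω) {g : JacSpace Ω} (hg : g ∈ jacClosure Ω) :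
    ∃ v : Vec n → Vec n, HasH10Jacobian Ω v (fun j => g j) := by
  obtain ⟨a, ha, hlim⟩ := mem_closure_iff_seq_limit.1 hg
  choose ψ hψ using ha
  obtain rfl : (fun k => jacMap Ω (ψ k)) = a := funext hψ
  obtain ⟨c, hc⟩ := hH.norm_valMap_le h
  -- By the Friedrichs inequality, convergence of the Jacobians forces convergence of the fields.
  have hcau : CauchySeq (fun k => valMap Ω (ψ k)) := by
    refine Metric.cauchySeq_iff.2 fun ε hε => ?_
    obtain ⟨N, hN⟩ := Metric.cauchySeq_iff.1 hlim.cauchySeq (ε / (|c| + 1)) (by positivity)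
    refine ⟨N, fun k hk l hl => ?_⟩
    have h1 := hN k hk l hl
    rw [dist_eq_norm, ← map_sub] at h1 ⊢
    rw [lt_div_iff₀ (by positivity)] at h1
    have h2 := hc (ψ k - ψ l)
    nlinarith [le_abs_self c, norm_nonneg (jacMap Ω (ψ k - ψ l))]
  obtain ⟨v, hv⟩ := cauchySeq_tendsto_of_complete hcau
  have hlimj (j : Fin n) : Filter.Tendsto (fun k => jacMap Ω (ψ k) j) Filter.atTop (nhds (g j)) :=
    ((PiLp.continuous_apply 2 (fun _ : Fin n => L2 Ω (Vec n)) j).tendsto g).comp hlim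
  have hvj (j : Fin n) : MemLp (fun x => v x j) 2 (volume.restrict Ω) :=
    (EuclideanSpace.proj j : Vec n →L[ℝ] ℝ).comp_memLp' (Lp.memLp v)
  refine ⟨v, fun j => ⟨hvj j, Lp.memLp (g j), ?_, ?_⟩⟩
  · have l1 := MemLp.locallyIntegrableOn h (hvj j)
    have l2 := MemLp.locallyIntegrableOn h (Lp.memLp (g j))
    refine ⟨l1, l2, fun φ hφ => (weak_gradient_identity_iff l1 l2 hφ).2 fun i => ?_⟩
    -- Both sides of the weak gradient identity are inner products with fixed elements of `L₂`, so
    -- the identity passes to the limit.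
    set A : L2 Ω (Vec n) := MemLp.toLp _ (((hφ.grad.coord i).smul_single j).memLp 2)
    set B : L2 Ω (Vec n) := MemLp.toLp _ ((hφ.smul_single i).memLp 2)
    have hA (w : L2 Ω (Vec n)) : inner ℝ A w = ∫ x in Ω, w x j * gradient φ x i := by
      rw [L2.inner_def]
      refine integral_congr_ae ?_
      filter_upwards [(((hφ.grad.coord i).smul_single j).memLp 2).coeFn_toLp] with x hx
      rw [hx, real_inner_smul_left, EuclideanSpace.inner_single_left]
      simp [mul_comm]
    have hB (w : L2 Ω (Vec n)) : inner ℝ B w = ∫ x in Ω, φ x * w x i := by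
      rw [L2.inner_def]
      refine integral_congr_ae ?_
      filter_upwards [((hφ.smul_single i).memLp 2).coeFn_toLp] with x hx
      rw [hx, real_inner_smul_left, EuclideanSpace.inner_single_left]
      simp
    rw [← hA v, ← hB (g j)]
    have t1 : Filter.Tendsto (fun k => inner ℝ A (valMap Ω (ψ k))) Filter.atTop
        (nhds (inner ℝ A v)) := tendsto_const_nhds.inner hv
    have t2 : Filter.Tendsto (fun k => -inner ℝ B (jacMap Ω (ψ k) j)) Filter.atTop
        (nhds (-inner ℝ B (g j))) := (tendsto_const_nhds.inner (hlimj j)).neg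
    refine tendsto_nhds_unique t1 (t2.congr fun k => ?_)
    rw [hA, hB]
    have h3 := ((isTest_coe (ψ k)).coord j).hasWeakGradient.coord hφ i
    rw [neg_eq_iff_eq_neg]
    refine Eq.trans ?_ ((neg_eq_iff_eq_neg.2 h3).symm.trans ?_)
    · refine integral_congr_ae ?_
      filter_upwards [(((isTest_coe (ψ k)).jac j).memLp 2).coeFn_toLp] with x hx
      exact congrArg (fun w : Vec n => φ x * w i) hx
    · congr 1
      refine integral_congr_ae ?_
      filter_upwards [((isTest_coe (ψ k)).memLp 2).coeFn_toLp] with x hx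
      exact congrArg (fun w : Vec n => w j * gradient φ x i) hx.symm
  · intro ε hε
    have t1 : Filter.Tendsto (fun k => ‖v - valMap Ω (ψ k)‖ₑ ^ 2 + ‖g j - jacMap Ω (ψ k) j‖ₑ ^ 2)
        Filter.atTop (nhds (‖v - v‖ₑ ^ 2 + ‖g j - g j‖ₑ ^ 2)) :=
      (ENNReal.Tendsto.pow (tendsto_const_nhds.sub hv).enorm).add
        (ENNReal.Tendsto.pow (tendsto_const_nhds.sub (hlimj j)).enorm)
    simp only [sub_self, enorm_zero, ne_eq, OfNat.ofNat_ne_zero, not_false_eq_true, zero_pow,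
      add_zero] at t1
    obtain ⟨k, hk⟩ := (t1.eventually_lt_const hε).exists
    refine ⟨_, (isTest_coe (ψ k)).coord j, lt_of_le_of_lt (add_le_add ?_ ?_) hk⟩
    · have h1 := enorm_toLp_sq (Lp.memLp (v - valMap Ω (ψ k)))
      rw [Lp.toLp_coeFn] at h1
      rw [← h1]
      refine lintegral_mono_ae ?_
      filter_upwards [Lp.coeFn_sub v (valMap Ω (ψ k)),
        ((isTest_coe (ψ k)).memLp 2).coeFn_toLp] with x hx1 hx2
      have hx2' : valMap Ω (ψ k) x = (ψ k).1 x := hx2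
      rw [hx1, Pi.sub_apply, hx2']
      gcongr
      rw [enorm_le_iff_norm_le]
      exact PiLp.norm_apply_le (v x - (ψ k).1 x) j
    · have h1 := enorm_toLp_sq (Lp.memLp (g j - jacMap Ω (ψ k) j))
      rw [Lp.toLp_coeFn] at h1
      rw [← h1]
      refine le_of_eq (sqNorm_congr ?_)
      filter_upwards [Lp.coeFn_sub (g j) (jacMap Ω (ψ k) j),
        (((isTest_coe (ψ k)).jac j).memLp 2).coeFn_toLp] with x hx1 hx2
      have hx2' : jacMap Ω (ψ k) j x = jac (ψ k).1 x j := hx2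
      rw [hx1, Pi.sub_apply, hx2']
      rfl

end H10Realization

/-! ### Surjectivity estimates in Hilbert spaces -/

section Hilbert

variable {V X Y : Type*} [NormedAddCommGroup V] [InnerProductSpace ℝ V] [CompleteSpace V]
  [NormedAddCommGroup X] [InnerProductSpace ℝ X] [CompleteSpace X]
  [NormedAddCommGroup Y] [InnerProductSpace ℝ Y]

/-- An operator whose adjoint is bounded below is onto, with a bounded right inverse. -/
theorem exists_preimage_of_adjoint_bound (D : V →L[ℝ] X) {C : ℝ} (hC : 0 < C)
    (h : ∀ x, ‖x‖ ^ 2 ≤ C * ‖ContinuousLinearMap.adjoint D x‖ ^ 2) (x₀ : X) :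
    ∃ g, D g = x₀ ∧ ‖g‖ ^ 2 ≤ C * ‖x₀‖ ^ 2 := by
  -- `A = D D*` is bounded below, hence has closed range, and no nonzero vector is orthogonal to
  -- that range. So `A` is onto, and `D* x` with `A x = x₀` is the required preimage.
  set A : X →L[ℝ] X := D.comp (ContinuousLinearMap.adjoint D) with hA
  have hin (x y : X) : inner ℝ (A x) y =
      inner ℝ (ContinuousLinearMap.adjoint D x) (ContinuousLinearMap.adjoint D y) := by
    rw [ContinuousLinearMap.adjoint_inner_right]; rfl
  have hbelow (x : X) : ‖x‖ ≤ C * ‖A x‖ := by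
    have h1 : ‖x‖ ^ 2 ≤ C * (‖A x‖ * ‖x‖) := by
      refine (h x).trans ?_
      gcongr
      rw [← real_inner_self_eq_norm_sq, ← hin]
      exact real_inner_le_norm _ _
    rcases (norm_nonneg x).eq_or_lt with h0 | h0
    · rw [← h0]; positivity
    · nlinarith
  have hanti : AntilipschitzWith C.toNNReal A := by
    refine AddMonoidHomClass.antilipschitz_of_bound A fun x => ?_
    rw [Real.coe_toNNReal _ hC.le]
    exact hbelow x
  have hclosed : IsClosed (Set.range A) := hanti.isClosed_range A.uniformContinuous
  have htop : LinearMap.range A.toLinearMap = ⊤ := by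
    have hcl : IsClosed (LinearMap.range A.toLinearMap : Set X) := by
      rw [LinearMap.coe_range]; exact hclosed
    have := hcl.completeSpace_coe
    rw [← Submodule.orthogonal_eq_bot_iff, Submodule.eq_bot_iff]
    intro y hy
    have h1 : inner ℝ (A y) y = 0 := hy _ ⟨y, rfl⟩
    rw [hin, real_inner_self_eq_norm_sq] at h1
    have h2 := h y
    rw [h1, mul_zero] at h2
    simpa using le_antisymm h2 (by positivity)
  obtain ⟨x, hx⟩ : ∃ x, A x = x₀ := by
    have : x₀ ∈ LinearMap.range A.toLinearMap := htop ▸ Submodule.mem_top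
    exact this
  refine ⟨ContinuousLinearMap.adjoint D x, hx, ?_⟩
  set g := ContinuousLinearMap.adjoint D x
  -- `‖g‖² = ⟨A x, x⟩ = ⟨x₀, x⟩`; the factor `‖x‖` is then absorbed by `‖x‖² ≤ C ‖g‖²`.
  have h1 : ‖g‖ ^ 2 ≤ ‖x₀‖ * ‖x‖ := by
    rw [← real_inner_self_eq_norm_sq, ← hin, hx]
    exact real_inner_le_norm _ _
  have h2 := h x
  rcases (sq_nonneg ‖g‖).eq_or_lt with h0 | h0
  · rw [← h0]; positivity
  · have h3 : (‖g‖ ^ 2) ^ 2 ≤ ‖x₀‖ ^ 2 * ‖x‖ ^ 2 := by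
      rw [← mul_pow]; gcongr
    have h4 : (‖g‖ ^ 2) ^ 2 ≤ ‖x₀‖ ^ 2 * (C * ‖g‖ ^ 2) := h3.trans (by gcongr)
    nlinarith

/-- Let `‖g‖² = ‖D g‖² + ‖S g‖²`. If the complement of the range of `(D, S)` satisfies
`‖u‖² ≤ Γ ‖v‖²`, then `D` is onto and has a right inverse of square norm at most `1 + Γ`. -/
theorem exists_preimage_of_complement_bound (D : V →L[ℝ] X) (S : V →L[ℝ] Y)
    (hiso : ∀ g, ‖g‖ ^ 2 = ‖D g‖ ^ 2 + ‖S g‖ ^ 2) {Γ : ℝ} (hΓ : 0 ≤ Γ)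
    (h : ∀ x g, (∀ k, inner ℝ x (D k) = inner ℝ g k) → ‖x - D g‖ ^ 2 ≤ Γ * ‖S g‖ ^ 2) (x₀ : X) :
    ∃ g, D g = x₀ ∧ ‖g‖ ^ 2 ≤ (1 + Γ) * ‖x₀‖ ^ 2 := by
  refine exists_preimage_of_adjoint_bound D (by positivity) (fun x => ?_) x₀
  -- For this `g` the pair `(x - D g, -S g)` is orthogonal to every `(D k, S k)`. Pythagoras for
  -- `(x, 0) = (D g, S g) + (x - D g, -S g)` is `h6` below.
  set g := ContinuousLinearMap.adjoint D x with hg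
  have hk (k : V) : inner ℝ x (D k) = inner ℝ g k := by
    rw [hg, ContinuousLinearMap.adjoint_inner_left]
  have h1 := h x g hk
  have h2 : ‖x - D g‖ ^ 2 = ‖x‖ ^ 2 - 2 * ‖g‖ ^ 2 + ‖D g‖ ^ 2 := by
    rw [norm_sub_sq_real, hk, real_inner_self_eq_norm_sq]
  have h3 : inner ℝ x (x - D g) = ‖x‖ ^ 2 - ‖g‖ ^ 2 := by
    rw [inner_sub_right, hk, real_inner_self_eq_norm_sq, real_inner_self_eq_norm_sq]
  have h4 : ‖x‖ ^ 2 - ‖g‖ ^ 2 ≤ ‖x‖ * ‖x - D g‖ := h3 ▸ real_inner_le_norm _ _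
  have h5 := hiso g
  set a := ‖x - D g‖
  set b := ‖S g‖
  have h6 : ‖x‖ ^ 2 - ‖g‖ ^ 2 = a ^ 2 + b ^ 2 := by linarith
  have ha : 0 ≤ a := norm_nonneg _
  have hx : 0 ≤ ‖x‖ := norm_nonneg _
  -- `a² ≤ Γ b²`, rewritten so that it combines with `a² + b² ≤ ‖x‖ a` to give `a² + b² ≤ Γ / (1 +
  -- Γ) ‖x‖²`, which is the claim.
  have h7 : (1 + Γ) * a ^ 2 ≤ Γ * (a ^ 2 + b ^ 2) := by linarith
  have h8 : (1 + Γ) * (a ^ 2 + b ^ 2) ≤ Γ * ‖x‖ ^ 2 := by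
    rcases (add_nonneg (sq_nonneg a) (sq_nonneg b)).eq_or_lt with h0 | h0
    · rw [← h0]; nlinarith [mul_nonneg hΓ (sq_nonneg ‖x‖)]
    · have h9 : (a ^ 2 + b ^ 2) ^ 2 ≤ ‖x‖ ^ 2 * a ^ 2 := by
        rw [← mul_pow]
        exact pow_le_pow_left₀ h0.le (h6 ▸ h4) 2
      have h10 : (1 + Γ) * (a ^ 2 + b ^ 2) ^ 2 ≤ ‖x‖ ^ 2 * (Γ * (a ^ 2 + b ^ 2)) := by
        nlinarith [mul_le_mul_of_nonneg_left h9 (by positivity : 0 ≤ 1 + Γ),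
          mul_le_mul_of_nonneg_left h7 (sq_nonneg ‖x‖)]
      nlinarith
  nlinarith

end Hilbert

/-! ### Right inverses of the divergence and of the rotation -/

section RightInverse

variable {n : ℕ} {Ω : Set (Vec n)} {F : Type} [NormedAddCommGroup F] [InnerProductSpace ℝ F]

/-- Polarization of the norm identity. -/
theorem inner_eq_of_mem_jacClosure {ρ : (Fin n → Vec n) →ₗ[ℝ] F} (hρ : IsRotSymbol ρ)
    {g k : JacSpace Ω} (hg : g ∈ jacClosure Ω) (hk : k ∈ jacClosure Ω) :
    inner ℝ g k = inner ℝ (compJac Ω (divLin n) g) (compJac Ω (divLin n) k) +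
      inner ℝ (compJac Ω ρ g) (compJac Ω ρ k) := by
  have h1 := norm_sq_of_mem_jacClosure hρ (add_mem hg hk)
  rw [map_add, map_add, norm_add_sq_real, norm_add_sq_real, norm_add_sq_real] at h1
  linarith [norm_sq_of_mem_jacClosure hρ hg, norm_sq_of_mem_jacClosure hρ hk]

theorem IsTestFun.integral_divField {ψ : Vec n → Vec n} (hψ : IsTestFun Ω ψ) :
    ∫ x, divField ψ x = 0 := by
  simp only [divField, divOf]
  rw [integral_finsetSum]
  · refine Finset.sum_eq_zero fun j _ => ?_
    have := integral_mul_gradient (f := fun _ => 1) contDiff_const (hψ.coord j).1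
      (hψ.coord j).2.1 j
    simpa [gradient_fun_const] using this
  · intro j _
    exact ((hψ.jac j).coord j).continuous.integrable_of_hasCompactSupport ((hψ.jac j).coord j).2.1

/-- The constant function `1` as an element of `L₂`. -/
noncomputable def oneL2 (h : IsBoundedDomain Ω) : L2 Ω ℝ :=
  haveI := h.isFiniteMeasure
  MemLp.toLp (fun _ => (1 : ℝ)) (memLp_const 1)

theorem inner_oneL2 (h : IsBoundedDomain Ω) (u : L2 Ω ℝ) :
    inner ℝ (oneL2 h) u = ∫ x in Ω, u x := by
  have := h.isFiniteMeasure
  rw [L2.inner_def]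
  refine integral_congr_ae ?_
  filter_upwards [(memLp_const (1 : ℝ) : MemLp _ 2 (volume.restrict Ω)).coeFn_toLp] with x hx
  rw [oneL2, hx]
  simp

theorem inner_oneL2_div (h : IsBoundedDomain Ω) {g : JacSpace Ω} (hg : g ∈ jacClosure Ω) :
    inner ℝ (oneL2 h) (compJac Ω (divLin n) g) = 0 := by
  refine jacClosure_induction (p := fun g => inner ℝ (oneL2 h) (compJac Ω (divLin n) g) = 0)
    (isClosed_eq (by fun_prop) continuous_const) (fun ψ => ?_) hg
  have hψ := (isTest_coe ψ).linear_jac (divLin n)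
  rw [inner_oneL2, compJac_jacMap, integral_congr_ae (hψ.memLp 2).coeFn_toLp, hψ.setIntegral_eq]
  exact (isTest_coe ψ).integral_divField

/-- The `L₂` functions with mean value zero. -/
noncomputable def meanZero (h : IsBoundedDomain Ω) : Submodule ℝ (L2 Ω ℝ) :=
  (Submodule.span ℝ {oneL2 h})ᗮ

theorem mem_meanZero (h : IsBoundedDomain Ω) {u : L2 Ω ℝ} :
    u ∈ meanZero h ↔ ∫ x in Ω, u x = 0 := by
  rw [meanZero, Submodule.mem_orthogonal_singleton_iff_inner_right, inner_oneL2]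

/-- A right inverse of the divergence from a bound on the complement of the range. -/
theorem exists_jac_div_eq (h : IsBoundedDomain Ω) {ρ : (Fin n → Vec n) →ₗ[ℝ] F}
    (hρ : IsRotSymbol ρ) {Γ : ℝ} (hΓ : 0 ≤ Γ)
    (hFV : ∀ (u : L2 Ω ℝ) (g : JacSpace Ω), g ∈ jacClosure Ω → ∫ x in Ω, u x = 0 →
      (∀ ψ : testFields Ω, inner ℝ u (compJac Ω (divLin n) (jacMap Ω ψ)) =
        inner ℝ (compJac Ω ρ g) (compJac Ω ρ (jacMap Ω ψ))) → ‖u‖ ^ 2 ≤ Γ * ‖compJac Ω ρ g‖ ^ 2)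
    {u : L2 Ω ℝ} (hu : ∫ x in Ω, u x = 0) :
    ∃ g ∈ jacClosure Ω, compJac Ω (divLin n) g = u ∧ ‖g‖ ^ 2 ≤ (1 + Γ) * ‖u‖ ^ 2 := by
  have : CompleteSpace (meanZero h) := (Submodule.isClosed_orthogonal _).completeSpace_coe
  have hm {g : JacSpace Ω} (hg : g ∈ jacClosure Ω) : compJac Ω (divLin n) g ∈ meanZero h := by
    rw [meanZero, Submodule.mem_orthogonal_singleton_iff_inner_right, inner_oneL2_div h hg]
  -- Without the restriction of the target to mean zero functions, the adjoint would annihilate the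
  -- constants and could not be bounded below.
  let D : jacClosure Ω →L[ℝ] meanZero h :=
    ((compJac Ω (divLin n)).comp (jacClosure Ω).subtypeL).codRestrict _ fun g => hm g.2
  let S : jacClosure Ω →L[ℝ] L2 Ω F := (compJac Ω ρ).comp (jacClosure Ω).subtypeL
  have hc (x : meanZero h) (g : jacClosure Ω) (hk : ∀ k, inner ℝ x (D k) = inner ℝ g k) :
      ‖x - D g‖ ^ 2 ≤ Γ * ‖S g‖ ^ 2 := by
    refine hFV (x - D g : meanZero h) g g.2 ((mem_meanZero h).1 (x - D g : meanZero h).2)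
      fun ψ => ?_
    -- By polarization, `⟨x, D k⟩ = ⟨g, k⟩` becomes `⟨x - D g, D k⟩ = ⟨S g, S k⟩`, which is
    -- conjugacy up to the sign of `g`.
    have h1 : inner ℝ (x : L2 Ω ℝ) (compJac Ω (divLin n) (jacMap Ω ψ)) =
      inner ℝ (g : JacSpace Ω) (jacMap Ω ψ) := hk ⟨_, jacMap_mem ψ⟩
    rw [inner_eq_of_mem_jacClosure hρ g.2 (jacMap_mem ψ)] at h1
    change inner ℝ ((x : L2 Ω ℝ) - compJac Ω (divLin n) g) _ = _
    rw [inner_sub_left]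
    linarith
  obtain ⟨g, hg, hle⟩ := exists_preimage_of_complement_bound D S
    (fun g => norm_sq_of_mem_jacClosure hρ g.2) hΓ hc ⟨u, (mem_meanZero h).2 hu⟩
  exact ⟨g, g.2, congrArg Subtype.val hg, hle⟩

/-- The closure of the rotations of test fields. -/
noncomputable def rotClosure (Ω : Set (Vec n)) (ρ : (Fin n → Vec n) →ₗ[ℝ] F) :
    Submodule ℝ (L2 Ω F) :=
  (LinearMap.range ((compJac Ω ρ).toLinearMap ∘ₗ jacMap Ω)).topologicalClosure

theorem compJac_mem_rotClosure (ρ : (Fin n → Vec n) →ₗ[ℝ] F) {g : JacSpace Ω}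
    (hg : g ∈ jacClosure Ω) : compJac Ω ρ g ∈ rotClosure Ω ρ :=
  jacClosure_induction (p := fun g => compJac Ω ρ g ∈ rotClosure Ω ρ)
    ((Submodule.isClosed_topologicalClosure _).preimage (compJac Ω ρ).continuous)
    (fun ψ => Submodule.le_topologicalClosure _ ⟨ψ, rfl⟩) hg

/-- A right inverse of the rotation from a bound on the complement of the range. -/
theorem exists_jac_rot_eq {ρ : (Fin n → Vec n) →ₗ[ℝ] F} (hρ : IsRotSymbol ρ) [CompleteSpace F]
    {Γ : ℝ} (hΓ : 0 ≤ Γ)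
    (hFV : ∀ (v : L2 Ω F) (g : JacSpace Ω), g ∈ jacClosure Ω → v ∈ rotClosure Ω ρ →
      (∀ ψ : testFields Ω, inner ℝ v (compJac Ω ρ (jacMap Ω ψ)) =
        inner ℝ (compJac Ω (divLin n) g) (compJac Ω (divLin n) (jacMap Ω ψ))) →
          ‖v‖ ^ 2 ≤ Γ * ‖compJac Ω (divLin n) g‖ ^ 2)
    {v : L2 Ω F} (hv : v ∈ rotClosure Ω ρ) :
    ∃ g ∈ jacClosure Ω, compJac Ω ρ g = v ∧ ‖g‖ ^ 2 ≤ (1 + Γ) * ‖v‖ ^ 2 := by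
  have : CompleteSpace (rotClosure Ω ρ) :=
    (Submodule.isClosed_topologicalClosure _).completeSpace_coe
  -- The roles of divergence and rotation are exchanged; restricting the target to the closure of
  -- the rotations removes the kernel of the adjoint.
  let S : jacClosure Ω →L[ℝ] rotClosure Ω ρ :=
    ((compJac Ω ρ).comp (jacClosure Ω).subtypeL).codRestrict _
      fun g => compJac_mem_rotClosure ρ g.2
  let D : jacClosure Ω →L[ℝ] L2 Ω ℝ := (compJac Ω (divLin n)).comp (jacClosure Ω).subtypeL
  have hc (x : rotClosure Ω ρ) (g : jacClosure Ω) (hk : ∀ k, inner ℝ x (S k) = inner ℝ g k) :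
      ‖x - S g‖ ^ 2 ≤ Γ * ‖D g‖ ^ 2 := by
    refine hFV (x - S g : rotClosure Ω ρ) g g.2 (x - S g : rotClosure Ω ρ).2 fun ψ => ?_
    have h1 : inner ℝ (x : L2 Ω F) (compJac Ω ρ (jacMap Ω ψ)) =
      inner ℝ (g : JacSpace Ω) (jacMap Ω ψ) := hk ⟨_, jacMap_mem ψ⟩
    rw [inner_eq_of_mem_jacClosure hρ g.2 (jacMap_mem ψ)] at h1
    change inner ℝ ((x : L2 Ω F) - compJac Ω ρ g) _ = _
    rw [inner_sub_left]
    linarith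
  obtain ⟨g, hg, hle⟩ := exists_preimage_of_complement_bound S D
    (fun g => (norm_sq_of_mem_jacClosure hρ g.2).trans (add_comm _ _)) hΓ hc ⟨v, hv⟩
  exact ⟨g, g.2, congrArg Subtype.val hg, hle⟩

theorem inner_toLp_compJac {w : Vec n → F} (hw : MemLp w 2 (volume.restrict Ω))
    (L : (Fin n → Vec n) →ₗ[ℝ] F) (ψ : testFields Ω) :
    inner ℝ (MemLp.toLp w hw) (compJac Ω L (jacMap Ω ψ)) =
      ∫ x in Ω, inner ℝ (w x) (L (jac ψ.1 x)) := by
  rw [compJac_jacMap, inner_toLp]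

end RightInverse

/-! ### Improved Poincaré inequalities from right inverses -/

section ImprovedPoincare

variable {n : ℕ} [Nontrivial (Vec n)] {Ω : Set (Vec n)}
  {F : Type} [NormedAddCommGroup F] [InnerProductSpace ℝ F]

/-- The test field `ψ` divided by the boundary distance, as an element of `L₂`. -/
noncomputable def weightedVal (h : IsBoundedDomain Ω) (ψ : testFields Ω) : L2 Ω (Vec n) :=
  MemLp.toLp _ ((isTest_coe ψ).inv_bdryDist_smul_memLp h)

/-- Hardy turns a bound by `‖ψ / d‖` into one by `√H ‖∇ψ‖`, and the latter survives passage to the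
closure, where no quotient by `d` has to be formed. -/
theorem Hardy.abs_inner_le {H : ℝ≥0} (hH : Hardy Ω H) (h : IsBoundedDomain Ω)
    (L : (Fin n → Vec n) →ₗ[ℝ] F) (w : L2 Ω F) {M : ℝ} (hM : 0 ≤ M)
    (hw : ∀ ψ : testFields Ω, |inner ℝ w (compJac Ω L (jacMap Ω ψ))| ≤ M * ‖weightedVal h ψ‖)
    {k : JacSpace Ω} (hk : k ∈ jacClosure Ω) :
    |inner ℝ w (compJac Ω L k)| ≤ M * (√H * ‖k‖) := by
  refine jacClosure_induction (p := fun k => |inner ℝ w (compJac Ω L k)| ≤ M * (√H * ‖k‖))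
    (isClosed_le (by fun_prop) (by fun_prop)) (fun ψ => (hw ψ).trans ?_) hk
  gcongr
  exact hH.norm_le h ψ

/-- Meant for a function of norm `a` paired with a preimage of norm `k`; squaring lets one factor
`a²` cancel. -/
theorem sq_le_of_right_inverse {H C M a k : ℝ} (hH : 0 ≤ H) (hC : 0 ≤ C) (h1 : a ^ 2 ≤ M * (√H * k)) (h2 : k ^ 2 ≤ C * a ^ 2) :
    a ^ 2 ≤ H * C * M ^ 2 := by
  have h3 : (a ^ 2) ^ 2 ≤ (M * (√H * k)) ^ 2 := pow_le_pow_left₀ (sq_nonneg a) h1 2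
  have h4 : (M * (√H * k)) ^ 2 = M ^ 2 * H * k ^ 2 := by
    rw [mul_pow, mul_pow, Real.sq_sqrt hH]; ring
  rw [h4] at h3
  have h5 : M ^ 2 * H * k ^ 2 ≤ M ^ 2 * H * (C * a ^ 2) := by gcongr
  rcases (sq_nonneg a).eq_or_lt with h0 | h0
  · rw [← h0]; positivity
  · nlinarith

/-- The weights `d` and `1 / d` cancel because `d > 0` on `Ω`. -/
theorem integral_inner_eq_weighted (h : IsBoundedDomain Ω) {g : Vec n → Vec n}
    (hdg : MemLp (fun x => bdryDist Ω x • g x) 2 (volume.restrict Ω)) (ψ : testFields Ω) :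
    ∫ x in Ω, inner ℝ (g x) (ψ.1 x) = inner ℝ (MemLp.toLp _ hdg) (weightedVal h ψ) := by
  rw [weightedVal, inner_toLp]
  refine setIntegral_congr_fun h.isOpen.measurableSet fun x hx => ?_
  have hd := (h.bdryDist_pos hx).ne'
  simp only [real_inner_smul_left, real_inner_smul_right]
  field_simp

/-- Take `k` with `div k = u - m`. Divergences are orthogonal to constants, so `‖u - m‖² = ⟨u, div
k⟩`; on test fields this pairing is `-⟨d ∇u, ψ / d⟩`, and Hardy bounds it on the closure. That `u`
lies in `L₂` is supplied later by truncation. -/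
theorem Hardy.improvedPoincare_of_memL2 {H : ℝ≥0} (hH : Hardy Ω H) (h : IsBoundedDomain Ω)
    {C : ℝ≥0} (hC : ∀ u : L2 Ω ℝ, ∫ x in Ω, u x = 0 →
      ∃ g ∈ jacClosure Ω, compJac Ω (divLin n) g = u ∧ ‖g‖ ^ 2 ≤ C * ‖u‖ ^ 2)
    {u : Vec n → ℝ} {g : Vec n → Vec n} (hug : HasWeakGradient Ω u g)
    (hdg : MemLp (fun x => bdryDist Ω x • g x) 2 (volume.restrict Ω))
    (hu : MemLp u 2 (volume.restrict Ω)) :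
    sqNorm Ω (fun x => u x - ⨍ y in Ω, u y) ≤
      (H * C : ℝ≥0) * sqNorm Ω (fun x => bdryDist Ω x • g x) := by
  have := h.isFiniteMeasure
  set m := ⨍ y in Ω, u y with hm
  have hu0 : MemLp (fun x => u x - m) 2 (volume.restrict Ω) := hu.sub (memLp_const m)
  have hint : Integrable u (volume.restrict Ω) := hu.integrable (by norm_num)
  have hmean : ∫ x in Ω, MemLp.toLp _ hu0 x = 0 := by
    rw [integral_congr_ae hu0.coeFn_toLp, hm]
    have : NeZero (volume.restrict Ω) := ⟨by simpa using h.measure_pos.ne'⟩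
    exact integral_sub_average _ u
  obtain ⟨k, hk, hDk, hle⟩ := hC _ hmean
  have hone : MemLp.toLp _ hu0 = MemLp.toLp u hu - m • oneL2 h := by
    rw [oneL2, ← MemLp.toLp_const_smul, ← MemLp.toLp_sub]
    congr 1
    ext x
    simp
  have key : ‖MemLp.toLp _ hu0‖ ^ 2 ≤ ‖MemLp.toLp _ hdg‖ * (√H * ‖k‖) := by
    have h1 : ‖MemLp.toLp _ hu0‖ ^ 2 =
        inner ℝ (MemLp.toLp u hu) (compJac Ω (divLin n) k) := by
      rw [← real_inner_self_eq_norm_sq]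
      nth_rw 1 [hone]
      rw [inner_sub_left, real_inner_smul_left, ← hDk, inner_oneL2_div h hk]
      simp
    rw [h1]
    refine (le_abs_self _).trans
      (hH.abs_inner_le h (divLin n) _ (norm_nonneg _) (fun ψ => ?_) hk)
    have h2 := hug.integral_mul_div (isTest_coe ψ)
    rw [integral_inner_eq_weighted h hdg] at h2
    rw [inner_toLp_compJac]
    have h3 : ∫ x in Ω, inner ℝ (u x) (divLin n (jac ψ.1 x)) = ∫ x in Ω, u x * divField ψ.1 x := by
      simp [divField_eq, mul_comm]
    rw [h3, h2, abs_neg]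
    exact abs_real_inner_le_norm _ _
  rw [sqNorm_eq_ofReal hu0, sqNorm_eq_ofReal hdg, ← ENNReal.ofReal_coe_nnreal,
    ← ENNReal.ofReal_mul (NNReal.coe_nonneg _)]
  refine ENNReal.ofReal_le_ofReal ?_
  exact sq_le_of_right_inverse H.coe_nonneg C.coe_nonneg key hle

end ImprovedPoincare

/-! ### Mollification -/

section Mollify

open scoped Convolution

variable {n : ℕ}

/-- Convolution with a normalized bump function. -/
noncomputable def mollify (η : ContDiffBump (0 : Vec n)) (f : Vec n → ℝ) : Vec n → ℝ :=
  η.normed volume ⋆[ContinuousLinearMap.lsmul ℝ ℝ, volume] f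

theorem mollify_apply (η : ContDiffBump (0 : Vec n)) (f : Vec n → ℝ) (x : Vec n) :
    mollify η f x = ∫ t, η.normed volume t * f (x - t) := rfl

theorem contDiff_mollify (η : ContDiffBump (0 : Vec n)) {f : Vec n → ℝ}
    (hf : LocallyIntegrable f) : ContDiff ℝ ∞ (mollify η f) :=
  η.hasCompactSupport_normed.contDiff_convolution_left _ η.contDiff_normed hf

theorem normed_eq_zero_of_notMem_ball (η : ContDiffBump (0 : Vec n)) {y : Vec n}
    (hy : y ∉ Metric.ball 0 η.rOut) : η.normed volume y = 0 := by
  by_contra h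
  exact hy (η.support_normed_eq (μ := volume) ▸ h)

theorem integrable_mollify_prod (η : ContDiffBump (0 : Vec n)) {f h : Vec n → ℝ}
    (hf : Integrable f) (hh : Continuous h) (hc : HasCompactSupport h) :
    Integrable (fun p : Vec n × Vec n => η.normed volume p.2 * f (p.1 - p.2) * h p.1)
      (volume.prod volume) := by
  have h1 := η.integrable_normed (μ := volume) |>.convolution_integrand
    (ContinuousLinearMap.lsmul ℝ ℝ) hf
  obtain ⟨C, hC⟩ := hh.bounded_above_of_compact_support hc
  exact h1.mul_bdd (c := C) (hh.comp continuous_fst).aestronglyMeasurable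
    (Filter.Eventually.of_forall fun p => hC p.1)

theorem integral_shift_mul (f h : Vec n → ℝ) (y : Vec n) :
    ∫ x, f (x - y) * h x = ∫ x, f x * h (x + y) := by
  rw [← integral_add_right_eq_self (fun x => f (x - y) * h x) y]
  simp

/-- Mollification is dual to averaging over translations. -/
theorem integral_mollify_mul (η : ContDiffBump (0 : Vec n)) {f h : Vec n → ℝ}
    (hf : Integrable f) (hh : Continuous h) (hc : HasCompactSupport h) :
    ∫ x, mollify η f x * h x = ∫ y, η.normed volume y * ∫ x, f x * h (x + y) := by
  simp only [mollify_apply, ← integral_mul_const]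
  rw [integral_integral_swap (integrable_mollify_prod η hf hh hc)]
  simp only [mul_assoc, integral_const_mul, integral_shift_mul]

theorem integral_mollify_congr (η : ContDiffBump (0 : Vec n)) {f h f' h' : Vec n → ℝ}
    (hf : Integrable f) (hh : Continuous h) (hc : HasCompactSupport h)
    (hf' : Integrable f') (hh' : Continuous h') (hc' : HasCompactSupport h')
    (he : ∀ y ∈ Metric.ball 0 η.rOut, ∫ x, f x * h (x + y) = ∫ x, f' x * h' (x + y)) :
    ∫ x, mollify η f x * h x = ∫ x, mollify η f' x * h' x := by
  rw [integral_mollify_mul η hf hh hc, integral_mollify_mul η hf' hh' hc']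
  congr 1
  ext y
  by_cases hy : y ∈ Metric.ball 0 η.rOut
  · rw [he y hy]
  · simp [normed_eq_zero_of_notMem_ball η hy]

/-- The mollified integral is an average over small translates of `h`. With `c = 0` this transfers
estimates to mollifications; with `c = ∫ f h` it measures convergence. -/
theorem abs_integral_mollify_sub_le (η : ContDiffBump (0 : Vec n)) {f h : Vec n → ℝ}
    (hf : Integrable f) (hh : Continuous h) (hc : HasCompactSupport h) {c M : ℝ}
    (hb : ∀ y ∈ Metric.ball 0 η.rOut, |(∫ x, f x * h (x + y)) - c| ≤ M) :
    |(∫ x, mollify η f x * h x) - c| ≤ M := by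
  rw [integral_mollify_mul η hf hh hc]
  have hi : Integrable (fun y => η.normed volume y * ∫ x, f x * h (x + y)) := by
    have := (integrable_mollify_prod η hf hh hc).integral_prod_right
    simpa only [mul_assoc, integral_const_mul, integral_shift_mul] using this
  have hη : Integrable (η.normed volume) := η.integrable_normed
  have hone : ∫ y, η.normed volume y = 1 := η.integral_normed
  have h1 : (∫ y, η.normed volume y * ∫ x, f x * h (x + y)) - c =
      ∫ y, η.normed volume y * ((∫ x, f x * h (x + y)) - c) := by
    simp only [mul_sub]
    rw [integral_sub hi (hη.mul_const c), integral_mul_const, hone, one_mul]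
  have h2 : M = ∫ y, η.normed volume y * M := by rw [integral_mul_const, hone, one_mul]
  rw [h1, h2, ← Real.norm_eq_abs]
  refine norm_integral_le_of_norm_le (hη.mul_const M) (Filter.Eventually.of_forall fun y => ?_)
  by_cases hy : y ∈ Metric.ball 0 η.rOut
  · rw [norm_mul, Real.norm_of_nonneg (η.nonneg_normed y), Real.norm_eq_abs]
    exact mul_le_mul_of_nonneg_left (hb y hy) (η.nonneg_normed y)
  · simp [normed_eq_zero_of_notMem_ball η hy]

theorem lipschitz_mollify (η : ContDiffBump (0 : Vec n)) {f : Vec n → ℝ}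
    (hf : LipschitzWith 1 f) : LipschitzWith 1 (mollify η f) := by
  refine LipschitzWith.of_dist_le_mul fun x y => ?_
  have hi (z : Vec n) : Integrable (fun t => η.normed volume t * f (z - t)) :=
    (η.continuous_normed.mul (hf.continuous.comp (continuous_const.sub continuous_id)))
      |>.integrable_of_hasCompactSupport η.hasCompactSupport_normed.mul_right
  have hone : ∫ y, η.normed volume y = 1 := η.integral_normed
  rw [Real.dist_eq, mollify_apply, mollify_apply, ← integral_sub (hi x) (hi y),
    ← Real.norm_eq_abs]
  have h2 : (1 : ℝ≥0) * dist x y = ∫ t, η.normed volume t * dist x y := by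
    rw [integral_mul_const, hone]; simp
  rw [h2]
  refine norm_integral_le_of_norm_le (η.integrable_normed.mul_const _)
    (Filter.Eventually.of_forall fun t => ?_)
  rw [← mul_sub, norm_mul, Real.norm_of_nonneg (η.nonneg_normed t)]
  refine mul_le_mul_of_nonneg_left ?_ (η.nonneg_normed t)
  have := hf.dist_le_mul (x - t) (y - t)
  rw [Real.dist_eq] at this
  simpa using this

theorem norm_gradient_le_of_lipschitz {f : Vec n → ℝ} (hf : LipschitzWith 1 f) (x : Vec n) :
    ‖gradient f x‖ ≤ 1 := by
  have := norm_fderiv_le_of_lipschitz ℝ hf (x₀ := x)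
  simpa [gradient] using this

/-- A bump function supported in the ball of radius `ε`. -/
noncomputable def bumpOfRadius (ε : ℝ) (hε : 0 < ε) : ContDiffBump (0 : Vec n) :=
  ⟨ε / 2, ε, by positivity, by linarith⟩

/-- A smooth compactly supported approximation of the boundary distance. -/
theorem IsBoundedDomain.exists_smooth_bdryDist [Nontrivial (Vec n)] {Ω : Set (Vec n)}
    (h : IsBoundedDomain Ω) {ε : ℝ} (hε : 0 < ε) :
    ∃ χ : Vec n → ℝ, ContDiff ℝ ∞ χ ∧ HasCompactSupport χ ∧ (∀ x, ‖gradient χ x‖ ≤ 1) ∧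
      (∀ x ∈ Ω, bdryDist Ω x - 4 * ε ≤ χ x) ∧
      ∀ x ∈ tsupport χ, ∀ y ∈ Metric.ball (0 : Vec n) ε, x - y ∈ Ω := by
  -- Unlike `bdryDist Ω`, the distance to the complement vanishes outside `Ω`.
  set δ : Vec n → ℝ := fun x => Metric.infDist x Ωᶜ with hδ
  have hδL : LipschitzWith 1 δ := Metric.lipschitz_infDist_pt _
  have hδm {x : Vec n} (hx : 0 < δ x) : x ∈ Ω := by
    by_contra hx'
    exact hx.ne' (Metric.infDist_zero_of_mem hx')
  have hδsub (x y : Vec n) : δ x ≤ δ y + dist x y := Metric.infDist_le_infDist_add_dist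
  -- Mollifying at scale `ε` spreads the support by `ε`, leaving `δ ≥ 2ε` on it, so translates by
  -- less than `ε` stay in `Ω`. It changes values by at most another `ε`, whence the loss `4ε`.
  set m : Vec n → ℝ := fun x => max (δ x - 3 * ε) 0 with hm
  have hmL : LipschitzWith 1 m := by
    have h1 : LipschitzWith 1 (fun x => δ x - 3 * ε) := by
      simpa using hδL.sub (LipschitzWith.const (3 * ε))
    exact h1.max_const 0
  let η : ContDiffBump (0 : Vec n) := bumpOfRadius ε hε
  have hη : η.rOut = ε := rfl
  have hsupp : tsupport (mollify η m) ⊆ {x | 2 * ε ≤ δ x} := by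
    refine closure_minimal (fun x hx => ?_) (isClosed_le continuous_const hδL.continuous)
    by_contra hlt
    simp only [Set.mem_ofPred_eq, not_le] at hlt
    apply hx
    rw [mollify_apply]
    refine integral_eq_zero_of_ae (Filter.Eventually.of_forall fun t => ?_)
    by_cases ht : t ∈ Metric.ball 0 η.rOut
    · have h1 := hδsub (x - t) x
      have h2 : dist (x - t) x < ε := by simpa [hη] using ht
      have h3 : m (x - t) = 0 := max_eq_right (by linarith)
      simp [h3]
    · simp [normed_eq_zero_of_notMem_ball η ht]
  refine ⟨mollify η m, contDiff_mollify η hmL.continuous.locallyIntegrable, ?_,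
    norm_gradient_le_of_lipschitz (lipschitz_mollify η hmL), fun x hx => ?_, fun x hx y hy => ?_⟩
  · refine Metric.isCompact_of_isClosed_isBounded (isClosed_tsupport _) (h.isBounded.subset ?_)
    exact fun x hx => hδm (lt_of_lt_of_le (by positivity) (hsupp hx))
  · have h1 : dist (mollify η m x) (m x) ≤ ε := by
      refine ContDiffBump.dist_normed_convolution_le hmL.continuous.aestronglyMeasurable
        fun y hy => ?_
      have := hmL.dist_le_mul y x
      rw [NNReal.coe_one, one_mul] at this
      exact this.trans (Metric.mem_ball.1 hy).le
    have h2 : δ x - 3 * ε ≤ m x := le_max_left _ _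
    have h3 := h.bdryDist_le_infDist_compl hx
    rw [Real.dist_eq] at h1
    linarith [(abs_le.1 h1).1]
  · have h1 := hδsub x (x - y)
    have h2 : dist x (x - y) < ε := by simpa using hy
    have h3 : 2 * ε ≤ δ x := hsupp hx
    exact hδm (by linarith)

end Mollify

/-! ### Interior gradient estimates for conjugate harmonic functions -/

section Caccioppoli

variable {n : ℕ} {Ω : Set (Vec n)} {F : Type} [NormedAddCommGroup F] [InnerProductSpace ℝ F]

theorem abs_integral_inner_le {α : Type*} [MeasurableSpace α] {μ : Measure α} {f g : α → F}
    (hf : MemLp f 2 μ) (hg : MemLp g 2 μ) :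
    |∫ x, inner ℝ (f x) (g x) ∂μ| ≤ √(∫ x, ‖f x‖ ^ 2 ∂μ) * √(∫ x, ‖g x‖ ^ 2 ∂μ) := by
  have hi {f g : α → F} (hf : MemLp f 2 μ) (hg : MemLp g 2 μ) :
      inner ℝ (hf.toLp f) (hg.toLp g) = ∫ x, inner ℝ (f x) (g x) ∂μ := by
    rw [L2.inner_def]
    refine integral_congr_ae ?_
    filter_upwards [hf.coeFn_toLp, hg.coeFn_toLp] with x h1 h2
    rw [h1, h2]
  have hn {f : α → F} (hf : MemLp f 2 μ) : √(∫ x, ‖f x‖ ^ 2 ∂μ) = ‖hf.toLp f‖ := by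
    rw [Real.sqrt_eq_iff_eq_sq (by positivity) (norm_nonneg _), ← real_inner_self_eq_norm_sq, hi]
    simp
  rw [← hi hf hg, hn hf, hn hg]
  exact abs_real_inner_le_norm _ _

/-- The Cauchy-Schwarz inequality against a translate. -/
theorem abs_setIntegral_inner_shift_le {f k : Vec n → F} (hf : MemLp f 2 (volume.restrict Ω))
    (hk : Continuous k) (hc : HasCompactSupport k) (y : Vec n) :
    |∫ x in Ω, inner ℝ (f x) (k (x + y))| ≤ ‖hf.toLp f‖ * √(∫ x, ‖k x‖ ^ 2) := by
  have hk' : MemLp (fun x => k (x + y)) 2 :=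
    (hk.comp (continuous_add_const y)).memLp_of_hasCompactSupport
      (hc.comp_homeomorph (Homeomorph.addRight y))
  refine (abs_integral_inner_le hf (hk'.restrict Ω)).trans ?_
  rw [← norm_toLp_sq hf, Real.sqrt_sq (norm_nonneg _)]
  gcongr
  rw [← integral_add_right_eq_self (fun x => ‖k x‖ ^ 2) y]
  refine setIntegral_le_integral ?_ (Filter.Eventually.of_forall fun x => by positivity)
  exact hk'.integrable_norm_pow (by norm_num)

theorem IsTestFun.shift {G : Type} [NormedAddCommGroup G] [NormedSpace ℝ G] {A : Vec n → G}
    (hA : ContDiff ℝ ∞ A) (hc : HasCompactSupport A) {y : Vec n}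
    (hy : ∀ x ∈ tsupport A, x - y ∈ Ω) : IsTestFun Ω (fun x => A (x + y)) := by
  refine ⟨hA.comp (contDiff_id.add contDiff_const), hc.comp_homeomorph (Homeomorph.addRight y),
    fun x hx => ?_⟩
  have h1 : x + y ∈ tsupport A :=
    tsupport_comp_subset_preimage (f := fun z => z + y) A (by fun_prop) hx
  simpa using hy _ h1

theorem integral_mul_divField {w : Vec n → ℝ} (hw : ContDiff ℝ ∞ w) {A : Vec n → Vec n}
    (hA : ContDiff ℝ ∞ A) (hc : HasCompactSupport A) :
    ∫ x, w x * divField A x = -∫ x, inner ℝ (gradient w x) (A x) := by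
  have hAt : IsTestFun Set.univ A := ⟨hA, hc, Set.subset_univ _⟩
  simp only [divField, divOf, Finset.mul_sum, PiLp.inner_apply]
  rw [integral_finsetSum, integral_finsetSum, ← Finset.sum_neg_distrib]
  · refine Finset.sum_congr rfl fun j _ => ?_
    rw [integral_mul_gradient hw (hAt.coord j).1 (hAt.coord j).2.1 j]
    simp [mul_comm]
  · intro j _
    have h1 := (contDiff_euclidean.1 (contDiff_gradient hw) j).continuous
    have h2 : Integrable (fun x => A x j * gradient w x j) :=
      ((hAt.coord j).continuous.mul h1).integrable_of_hasCompactSupport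
        (hAt.coord j).2.1.mul_right
    simpa using h2
  · intro j _
    exact (hw.continuous.mul ((hAt.jac j).coord j).continuous).integrable_of_hasCompactSupport
      ((hAt.jac j).coord j).2.1.mul_left

theorem integrable_indicator_of_memLp (h : IsBoundedDomain Ω) {u : Vec n → ℝ}
    (hu : MemLp u 2 (volume.restrict Ω)) : Integrable (Ω.indicator u) := by
  have := h.isFiniteMeasure
  rw [integrable_indicator_iff h.isOpen.measurableSet]
  exact hu.integrable (by norm_num)

theorem integral_indicator_mul (h : IsBoundedDomain Ω) (u k : Vec n → ℝ) :
    ∫ x, Ω.indicator u x * k x = ∫ x in Ω, u x * k x := by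
  rw [← integral_indicator h.isOpen.measurableSet]
  congr 1
  ext x
  by_cases hx : x ∈ Ω <;> simp [hx]

/-- The origin of the factor `4` in the theorem: the cutoff squared contributes a `2` to the
gradient, so `√I ≤ 2M` after absorption. -/
theorem le_four_mul_sq {I M : ℝ} (hI : 0 ≤ I) (h : I ≤ M * √(4 * I)) : I ≤ 4 * M ^ 2 := by
  have h1 : √(4 * I) = 2 * √I := by
    rw [Real.sqrt_mul (by norm_num), show (4 : ℝ) = 2 ^ 2 by norm_num,
      Real.sqrt_sq (by norm_num)]
  have h2 := Real.sq_sqrt hI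
  rw [h1] at h
  nlinarith [sq_nonneg (√I - 2 * M)]

/-- The mollified function satisfies weighted gradient estimates with constant `M`. -/
def InteriorGradientBound (Ω : Set (Vec n)) (u : Vec n → ℝ) (M : ℝ) : Prop :=
  ∀ (η : ContDiffBump (0 : Vec n)) (χ : Vec n → ℝ), ContDiff ℝ ∞ χ → HasCompactSupport χ →
    (∀ x, ‖gradient χ x‖ ≤ 1) →
    (∀ x ∈ tsupport χ, ∀ y ∈ Metric.ball (0 : Vec n) η.rOut, x - y ∈ Ω) →
    ∫ x, ‖χ x • gradient (mollify η (Ω.indicator u)) x‖ ^ 2 ≤ 4 * M ^ 2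

theorem tsupport_smul_subset_of_eq_zero {G : Type} [NormedAddCommGroup G] {χ : Vec n → ℝ}
    {A : Vec n → G} (hA : ∀ x, χ x = 0 → A x = 0) : tsupport A ⊆ tsupport χ :=
  closure_mono fun x hx h0 => hx (hA x h0)

theorem integrable_sq_norm_of_hasCompactSupport {G : Type} [NormedAddCommGroup G]
    {k : Vec n → G} (hk : Continuous k)
    (hc : HasCompactSupport k) : Integrable (fun x => ‖k x‖ ^ 2) :=
  (hk.memLp_of_hasCompactSupport (p := 2) hc).integrable_norm_pow (by norm_num)

/-- Gradient bound by the `L₂` norm of the conjugate function. -/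
theorem interiorGradientBound_conj (h : IsBoundedDomain Ω) {ρ : (Fin n → Vec n) →ₗ[ℝ] F}
    (hρ : IsRotSymbol ρ) {u : Vec n → ℝ} {v : Vec n → F} (hu : MemLp u 2 (volume.restrict Ω))
    (hv : MemLp v 2 (volume.restrict Ω))
    (huv : ∀ ψ : Vec n → Vec n, IsTestFun Ω ψ →
      ∫ x in Ω, inner ℝ (v x) (ρ (jac ψ x)) = -∫ x in Ω, u x * divField ψ x) :
    InteriorGradientBound Ω u ‖hv.toLp v‖ := by
  intro η χ hχ hχc hχ1 hχΩ
  have hui := integrable_indicator_of_memLp h hu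
  set w := mollify η (Ω.indicator u)
  have hw : ContDiff ℝ ∞ w := contDiff_mollify η hui.locallyIntegrable
  have hgw := contDiff_gradient hw
  -- The Caccioppoli test field. Pairing `w` with its divergence gives `-∫ χ² |∇w|²`, while `ρ`
  -- kills the Hessian of `w` and leaves only `2χ ρ(∇χ ⊗ ∇w)`.
  set A : Vec n → Vec n := fun x => χ x ^ 2 • gradient w x with hAdef
  have hA : ContDiff ℝ ∞ A := (hχ.pow 2).smul hgw
  have hAs : tsupport A ⊆ tsupport χ :=
    tsupport_smul_subset_of_eq_zero fun x hx => by simp [hAdef, hx]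
  have hAc : HasCompactSupport A := hχc.of_isClosed_subset (isClosed_tsupport _) hAs
  have hAt : IsTestFun Set.univ A := ⟨hA, hAc, Set.subset_univ _⟩
  have hBc : HasCompactSupport (fun x => χ x • gradient w x) := hχc.smul_right
  set I := ∫ x, ‖χ x • gradient w x‖ ^ 2
  have hI0 : 0 ≤ I := integral_nonneg fun x => by positivity
  have hI : ∫ x, w x * divField A x = -I := by
    rw [integral_mul_divField hw hA hAc]
    congr 2
    ext x
    rw [hAdef, real_inner_smul_right, real_inner_self_eq_norm_sq, norm_smul, mul_pow,
      Real.norm_eq_abs, sq_abs]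
  have hρA (x : Vec n) : ‖ρ (jac A x)‖ ≤ 2 * ‖χ x • gradient w x‖ := by
    have hd : Differentiable ℝ χ := hχ.differentiable (by simp)
    have h1 : jac A x = χ x ^ 2 • (fun j => gradient (fun y => gradient w y j) x) +
        (2 * χ x) • (fun j => gradient w x j • gradient χ x) := by
      ext1 j
      have h2 : gradient (fun y => χ y ^ 2) x = (2 * χ x) • gradient χ x := by
        have := gradient_mul' (hd x) (hd x)
        simp only [← pow_two] at this
        rw [this, ← add_smul, two_mul]
      have h3 := gradient_mul' (f := fun y => χ y ^ 2) (g := fun y => gradient w y j) (x := x)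
        ((hd x).pow 2) ((contDiff_euclidean.1 hgw j).differentiable (by simp) x)
      rw [h2] at h3
      refine h3.trans ?_
      simp only [Pi.add_apply, Pi.smul_apply, smul_smul]
      rw [mul_comm (gradient w x j)]
    rw [h1, map_add, map_smul, map_smul, hρ.eq_zero_of_symm
      (fun i j => gradient_gradient_comm hw x j i), smul_zero, zero_add, norm_smul]
    have h4 := hρ.norm_tensor_le (gradient χ x) (gradient w x)
    have h5 : ‖gradient χ x‖ * ‖gradient w x‖ ≤ ‖gradient w x‖ :=
      mul_le_of_le_one_left (norm_nonneg _) (hχ1 x)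
    rw [norm_mul, Real.norm_two, norm_smul, mul_assoc]
    gcongr
    exact h4.trans h5
  have hρt := hAt.linear_jac ρ
  have hdt := hAt.linear_jac (divLin n)
  -- Conjugacy is applied to each translate of `A`, a test field in `Ω` because the support of `χ`
  -- stays away from the boundary. Averaging over translates gives the bound for `w`.
  have key : |(∫ x, w x * divField A x) - 0| ≤ ‖hv.toLp v‖ * √(∫ x, ‖ρ (jac A x)‖ ^ 2) := by
    refine abs_integral_mollify_sub_le η hui hdt.continuous hdt.2.1 fun y hy => ?_
    have hsh : IsTestFun Ω (fun x => A (x + y)) :=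
      IsTestFun.shift hA hAc fun x hx => hχΩ x (hAs hx) y hy
    have h1 := huv _ hsh
    simp only [divField_eq, jac_comp_add] at h1
    rw [sub_zero, integral_indicator_mul h u (fun x => divLin n (jac A (x + y))),
      ← abs_neg, ← h1]
    exact abs_setIntegral_inner_shift_le hv hρt.continuous hρt.2.1 y
  rw [hI, sub_zero, abs_neg, abs_of_nonneg hI0] at key
  refine le_four_mul_sq hI0 (key.trans ?_)
  gcongr
  rw [← integral_const_mul]
  refine integral_mono (integrable_sq_norm_of_hasCompactSupport hρt.continuous hρt.2.1)
    ((integrable_sq_norm_of_hasCompactSupport (hχ.continuous.smul hgw.continuous) hBc).const_mul 4)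
    fun x => ?_
  calc ‖ρ (jac A x)‖ ^ 2 ≤ (2 * ‖χ x • gradient w x‖) ^ 2 := by
        gcongr; exact hρA x
    _ = _ := by ring

/-- Gradient bound for a harmonic function by its own `L₂` norm. -/
theorem interiorGradientBound_harmonic (h : IsBoundedDomain Ω) {u : Vec n → ℝ}
    (hu : MemLp u 2 (volume.restrict Ω))
    (huh : ∀ φ : Vec n → ℝ, IsTestFun Ω φ → ∫ x in Ω, u x * divField (gradient φ) x = 0) :
    InteriorGradientBound Ω u ‖hu.toLp u‖ := by
  intro η χ hχ hχc hχ1 hχΩ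
  have hui := integrable_indicator_of_memLp h hu
  set w := mollify η (Ω.indicator u)
  have hw : ContDiff ℝ ∞ w := contDiff_mollify η hui.locallyIntegrable
  have hgw := contDiff_gradient hw
  have hgχ := contDiff_gradient hχ
  have hd : Differentiable ℝ χ := hχ.differentiable (by simp)
  -- The Caccioppoli test function for a harmonic function: `∇w · ∇φ = χ² |∇w|² + w k` with `|k| ≤ 2
  -- |χ ∇w|`.
  set φ : Vec n → ℝ := fun x => χ x ^ 2 * w x with hφdef
  have hφ : ContDiff ℝ ∞ φ := (hχ.pow 2).mul hw
  have hφs : tsupport φ ⊆ tsupport χ :=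
    tsupport_smul_subset_of_eq_zero fun x hx => by simp [hφdef, hx]
  have hφc : HasCompactSupport φ := hχc.of_isClosed_subset (isClosed_tsupport _) hφs
  have hφt : IsTestFun Set.univ φ := ⟨hφ, hφc, Set.subset_univ _⟩
  have hBc : HasCompactSupport (fun x => χ x • gradient w x) := hχc.smul_right
  set I := ∫ x, ‖χ x • gradient w x‖ ^ 2
  have hI0 : 0 ≤ I := integral_nonneg fun x => by positivity
  set k : Vec n → ℝ := fun x => 2 * inner ℝ (χ x • gradient w x) (gradient χ x) with hkdef
  have hkcont : Continuous k :=
    continuous_const.mul ((hχ.continuous.smul hgw.continuous).inner hgχ.continuous)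
  have hkc : HasCompactSupport k :=
    hχc.of_isClosed_subset (isClosed_tsupport _)
      (tsupport_smul_subset_of_eq_zero fun x hx => by simp [hkdef, hx])
  have hgφ (x : Vec n) : inner ℝ (gradient w x) (gradient φ x) =
      ‖χ x • gradient w x‖ ^ 2 + w x * k x := by
    have h2 : gradient (fun y => χ y ^ 2) x = (2 * χ x) • gradient χ x := by
      have := gradient_mul' (hd x) (hd x)
      simp only [← pow_two] at this
      rw [this, ← add_smul, two_mul]
    have h3 := gradient_mul' (f := fun y => χ y ^ 2) (g := w) (x := x)
      ((hd x).pow 2) (hw.differentiable (by simp) x)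
    rw [h2] at h3
    rw [hφdef, h3, inner_add_right, real_inner_smul_right, real_inner_self_eq_norm_sq, norm_smul,
      mul_pow, Real.norm_eq_abs, sq_abs, smul_smul, real_inner_smul_right, hkdef]
    simp only [real_inner_smul_left]
    ring
  have hdt := hφt.grad.linear_jac (divLin n)
  -- Weak harmonicity of `u`, tested with all small translates of `φ`, passes to `w` as an error
  -- bound of zero.
  have h0 : ∫ x, w x * divField (gradient φ) x = 0 := by
    have : |(∫ x, w x * divField (gradient φ) x) - 0| ≤ 0 := by
      refine abs_integral_mollify_sub_le η hui hdt.continuous hdt.2.1 fun y hy => ?_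
      have hsh : IsTestFun Ω (fun x => φ (x + y)) :=
        IsTestFun.shift hφ hφc fun x hx => hχΩ x (hφs hx) y hy
      have h1 := huh _ hsh
      have h2 : gradient (fun x => φ (x + y)) = fun x => gradient φ (x + y) :=
        funext fun x => gradient_comp_add φ y x
      simp only [divField_eq, h2, jac_comp_add] at h1
      rw [sub_zero, integral_indicator_mul h u (fun x => divLin n (jac (gradient φ) (x + y))), h1,
        abs_zero]
    simpa using this
  have hwk : Integrable (fun x => w x * k x) :=
    (hw.continuous.mul hkcont).integrable_of_hasCompactSupport hkc.mul_left
  have hI : ∫ x, w x * k x = -I := by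
    rw [integral_mul_divField hw hφt.grad.1 hφt.grad.2.1] at h0
    simp only [hgφ] at h0
    have h1 : Integrable (fun x => ‖χ x • gradient w x‖ ^ 2) :=
      integrable_sq_norm_of_hasCompactSupport (hχ.continuous.smul hgw.continuous) hBc
    rw [integral_add h1 hwk] at h0
    linarith
  have key : |(∫ x, w x * k x) - 0| ≤ ‖hu.toLp u‖ * √(∫ x, ‖k x‖ ^ 2) := by
    refine abs_integral_mollify_sub_le η hui hkcont hkc fun y _ => ?_
    rw [sub_zero, integral_indicator_mul h u (fun x => k (x + y))]
    simpa [mul_comm] using abs_setIntegral_inner_shift_le hu hkcont hkc y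
  rw [hI, sub_zero, abs_neg, abs_of_nonneg hI0] at key
  refine le_four_mul_sq hI0 (key.trans ?_)
  gcongr
  rw [← integral_const_mul]
  refine integral_mono (integrable_sq_norm_of_hasCompactSupport hkcont hkc)
    ((integrable_sq_norm_of_hasCompactSupport (hχ.continuous.smul hgw.continuous) hBc).const_mul 4)
    fun x => ?_
  have h1 : ‖k x‖ ≤ 2 * ‖χ x • gradient w x‖ := by
    rw [hkdef, norm_mul, Real.norm_two]
    gcongr
    exact (norm_inner_le_norm _ _).trans (mul_le_of_le_one_right (norm_nonneg _) (hχ1 x))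
  calc ‖k x‖ ^ 2 ≤ (2 * ‖χ x • gradient w x‖) ^ 2 := by gcongr
    _ = _ := by ring

end Caccioppoli

/-! ### Weak gradients with a weight -/

section WeightedGradient

variable {n : ℕ} [Nontrivial (Vec n)] {Ω : Set (Vec n)}

theorem norm_weightedVal (h : IsBoundedDomain Ω) (ψ : testFields Ω) :
    ‖weightedVal h ψ‖ = √(∫ x, ‖(bdryDist Ω x)⁻¹ • ψ.1 x‖ ^ 2) := by
  rw [eq_comm, Real.sqrt_eq_iff_eq_sq (integral_nonneg fun x => by positivity) (norm_nonneg _),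
    weightedVal, norm_toLp_sq, setIntegral_eq_integral_of_forall_compl_eq_zero]
  intro x hx
  simp [(isTest_coe ψ).eq_zero hx]

/-- Here `t` measures two defects: the cutoff only satisfies `χ ≥ (1 - t) d` on the support of `ψ`,
and mollification changes the integral by up to `t`. Both disappear as `t → 0`. -/
theorem InteriorGradientBound.mul_abs_integral_sub_le {u : Vec n → ℝ} {M : ℝ}
    (hb : InteriorGradientBound Ω u M) (h : IsBoundedDomain Ω)
    (hu : MemLp u 2 (volume.restrict Ω)) (hM : 0 ≤ M) (ψ : testFields Ω) {t : ℝ} (ht : 0 < t)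
    (ht1 : t < 1) :
    (1 - t) * (|∫ x in Ω, u x * divField ψ.1 x| - t) ≤ 2 * M * ‖weightedVal h ψ‖ := by
  have hψ := isTest_coe ψ
  have hui := integrable_indicator_of_memLp h hu
  have hdt := hψ.linear_jac (divLin n)
  obtain ⟨c, hc, hcd⟩ := hψ.2.1.exists_forall_le' (continuous_bdryDist Ω).continuousOn
    (a := 0) fun x hx => h.bdryDist_pos (hψ.2.2 hx)
  set N := ∫ x, |Ω.indicator u x| with hN
  have hN0 : 0 ≤ N := integral_nonneg fun x => abs_nonneg _
  obtain ⟨r, hr, hrd⟩ := Metric.uniformContinuous_iff.1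
    (hdt.2.1.uniformContinuous_of_continuous hdt.continuous) (t / (N + 1)) (by positivity)
  -- `ε ≤ r` controls the mollification error. Since `d ≥ c` on the support of `ψ`, `4ε ≤ c t` gives
  -- `d - 4ε ≥ (1 - t) d` there.
  set ε := min r (c * t / 4) with hεdef
  have hε : 0 < ε := by positivity
  obtain ⟨χ, hχ, hχc, hχ1, hχd, hχΩ⟩ := h.exists_smooth_bdryDist hε
  let η : ContDiffBump (0 : Vec n) := bumpOfRadius ε hε
  have hB := hb η χ hχ hχc hχ1 hχΩ
  set w := mollify η (Ω.indicator u)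
  have hw : ContDiff ℝ ∞ w := contDiff_mollify η hui.locallyIntegrable
  have hgw := contDiff_gradient hw
  have h1 : |(∫ x, w x * divField ψ.1 x) - ∫ x in Ω, u x * divField ψ.1 x| ≤ t := by
    refine abs_integral_mollify_sub_le η hui hdt.continuous hdt.2.1 fun y hy => ?_
    have hi1 : Integrable (fun x => Ω.indicator u x * divLin n (jac ψ.1 (x + y))) := by
      obtain ⟨C, hC⟩ := hdt.continuous.bounded_above_of_compact_support hdt.2.1
      exact hui.mul_bdd (c := C) (hdt.continuous.comp (continuous_add_const y)).aestronglyMeasurable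
        (Filter.Eventually.of_forall fun x => hC _)
    have hi2 : Integrable (fun x => Ω.indicator u x * divLin n (jac ψ.1 x)) := by
      obtain ⟨C, hC⟩ := hdt.continuous.bounded_above_of_compact_support hdt.2.1
      exact hui.mul_bdd (c := C) hdt.continuous.aestronglyMeasurable
        (Filter.Eventually.of_forall fun x => hC _)
    rw [← integral_indicator_mul h]
    simp only [divField_eq]
    rw [← integral_sub hi1 hi2, ← Real.norm_eq_abs]
    calc _ ≤ ∫ x, |Ω.indicator u x| * (t / (N + 1)) := by
          refine norm_integral_le_of_norm_le (hui.abs.mul_const _)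
            (Filter.Eventually.of_forall fun x => ?_)
          rw [← mul_sub, norm_mul, Real.norm_eq_abs]
          gcongr
          rw [← dist_eq_norm]
          refine (hrd ?_).le
          have : ‖y‖ < ε := mem_ball_zero_iff.1 hy
          simpa using this.trans_le (min_le_left _ _)
      _ = N * (t / (N + 1)) := integral_mul_const _ _
      _ ≤ t := by
          rw [mul_div_assoc', div_le_iff₀ (by positivity)]
          nlinarith
  have h2 : (1 - t) * |∫ x, w x * divField ψ.1 x| ≤ 2 * M * ‖weightedVal h ψ‖ := by
    rw [integral_mul_divField hw hψ.1 hψ.2.1, abs_neg, norm_weightedVal]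
    have hcont1 : Continuous (fun x => ‖χ x • gradient w x‖) :=
      (hχ.continuous.smul hgw.continuous).norm
    have hcs1 : HasCompactSupport (fun x => ‖χ x • gradient w x‖) :=
      (hχc.smul_right (f := χ) (f' := gradient w)).norm
    have hcont2 : Continuous (fun x => ‖(bdryDist Ω x)⁻¹ • ψ.1 x‖) :=
      (hψ.inv_bdryDist_smul_continuous h).norm
    have hcs2 : HasCompactSupport (fun x => ‖(bdryDist Ω x)⁻¹ • ψ.1 x‖) :=
      (hψ.2.1.smul_left (f := fun x => (bdryDist Ω x)⁻¹)).norm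
    have hcs := abs_integral_inner_le (F := ℝ) (μ := volume)
      (hcont2.memLp_of_hasCompactSupport (p := 2) hcs2)
      (hcont1.memLp_of_hasCompactSupport (p := 2) hcs1)
    simp only [RCLike.inner_apply, conj_trivial, norm_norm] at hcs
    have hpt (x : Vec n) : ‖(1 - t) * inner ℝ (gradient w x) (ψ.1 x)‖ ≤
        ‖χ x • gradient w x‖ * ‖(bdryDist Ω x)⁻¹ • ψ.1 x‖ := by
      by_cases hx : x ∈ tsupport ψ.1
      · have hxΩ := hψ.2.2 hx
        have hd := h.bdryDist_pos hxΩ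
        have h3 := hχd x hxΩ
        have h4 := hcd x hx
        have h5 : 4 * ε ≤ c * t := by
          have := min_le_right r (c * t / 4)
          linarith
        have h6 : (1 - t) * bdryDist Ω x ≤ χ x := by nlinarith
        have h7 : 1 - t ≤ χ x * (bdryDist Ω x)⁻¹ := by
          rwa [← div_eq_mul_inv, le_div_iff₀ hd]
        have h8 : 0 ≤ χ x := le_trans (by nlinarith) h6
        rw [norm_mul, norm_smul, norm_smul, Real.norm_of_nonneg (by linarith : 0 ≤ 1 - t),
          Real.norm_of_nonneg h8, norm_inv, Real.norm_of_nonneg hd.le]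
        calc (1 - t) * ‖inner ℝ (gradient w x) (ψ.1 x)‖
            ≤ (χ x * (bdryDist Ω x)⁻¹) * (‖gradient w x‖ * ‖ψ.1 x‖) := by
              gcongr
              exact norm_inner_le_norm _ _
          _ = _ := by ring
      · simp [image_eq_zero_of_notMem_tsupport hx]
    have hint : Integrable (fun x => ‖χ x • gradient w x‖ * ‖(bdryDist Ω x)⁻¹ • ψ.1 x‖) :=
      (hcont1.mul hcont2).integrable_of_hasCompactSupport hcs1.mul_right
    calc (1 - t) * |∫ x, inner ℝ (gradient w x) (ψ.1 x)|
        = ‖∫ x, (1 - t) * inner ℝ (gradient w x) (ψ.1 x)‖ := by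
          rw [integral_const_mul, norm_mul, Real.norm_of_nonneg (by linarith : 0 ≤ 1 - t),
            Real.norm_eq_abs]
      _ ≤ ∫ x, ‖χ x • gradient w x‖ * ‖(bdryDist Ω x)⁻¹ • ψ.1 x‖ :=
          norm_integral_le_of_norm_le hint (Filter.Eventually.of_forall hpt)
      _ ≤ √(∫ x, ‖(bdryDist Ω x)⁻¹ • ψ.1 x‖ ^ 2) * √(∫ x, ‖χ x • gradient w x‖ ^ 2) :=
          (le_abs_self _).trans hcs
      _ ≤ √(∫ x, ‖(bdryDist Ω x)⁻¹ • ψ.1 x‖ ^ 2) * (2 * M) := by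
          gcongr
          rw [Real.sqrt_le_left (by positivity)]
          linarith
      _ = _ := mul_comm _ _
  have h3 := abs_sub_abs_le_abs_sub (∫ x in Ω, u x * divField ψ.1 x) (∫ x, w x * divField ψ.1 x)
  rw [abs_sub_comm] at h3
  refine le_trans ?_ h2
  exact mul_le_mul_of_nonneg_left (by linarith) (by linarith)

theorem InteriorGradientBound.abs_integral_le {u : Vec n → ℝ} {M : ℝ}
    (hb : InteriorGradientBound Ω u M) (h : IsBoundedDomain Ω)
    (hu : MemLp u 2 (volume.restrict Ω)) (hM : 0 ≤ M) (ψ : testFields Ω) :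
    |∫ x in Ω, u x * divField ψ.1 x| ≤ 2 * M * ‖weightedVal h ψ‖ := by
  set J := |∫ x in Ω, u x * divField ψ.1 x| with hJ
  have hlim : Filter.Tendsto (fun t : ℝ => (1 - t) * (J - t)) (nhdsWithin 0 (Set.Ioi 0))
      (nhds ((1 - 0) * (J - 0))) :=
    ((by fun_prop : Continuous fun t : ℝ => (1 - t) * (J - t)).tendsto 0).mono_left
      nhdsWithin_le_nhds
  simp only [sub_zero, one_mul] at hlim
  refine le_of_tendsto hlim ?_
  filter_upwards [Ioo_mem_nhdsGT (zero_lt_one (α := ℝ))] with t ht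
  exact hb.mul_abs_integral_sub_le h hu hM ψ ht.1 ht.2

/-- Division by the boundary distance as a linear map. -/
noncomputable def weightedMap (h : IsBoundedDomain Ω) : testFields Ω →ₗ[ℝ] L2 Ω (Vec n) where
  toFun := weightedVal h
  map_add' ψ χ := by
    rw [weightedVal, weightedVal, weightedVal, ← MemLp.toLp_add]
    congr 1
    ext1 x
    exact smul_add _ _ _
  map_smul' c ψ := by
    rw [weightedVal, weightedVal, RingHom.id_apply, ← MemLp.toLp_const_smul]
    congr 1
    ext1 x
    exact smul_comm (bdryDist Ω x)⁻¹ c (ψ.1 x)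

/-- The representation theorem for functionals on weighted test fields. -/
theorem exists_weighted_representative (h : IsBoundedDomain Ω) (ℓ : testFields Ω →ₗ[ℝ] ℝ) {M : ℝ}
    (hM : 0 ≤ M) (hℓ : ∀ ψ, |ℓ ψ| ≤ M * ‖weightedVal h ψ‖) :
    ∃ f : L2 Ω (Vec n), ‖f‖ ≤ M ∧ ∀ ψ, ℓ ψ = inner ℝ f (weightedVal h ψ) := by
  -- `ℓ` vanishes on the kernel of the weighted map, so it factors through it by some algebraic
  -- functional `m` on `L₂`. Only the restriction of `m` to the range is bounded; that restriction
  -- is extended by Hahn–Banach and represented by Riesz.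
  have hker : ℓ ∈ (LinearMap.ker (weightedMap h)).dualAnnihilator := by
    rw [Submodule.mem_dualAnnihilator]
    intro ψ hψ
    have h1 : weightedVal h ψ = 0 := hψ
    have h2 := hℓ ψ
    rw [h1, norm_zero, mul_zero] at h2
    exact abs_eq_zero.1 (le_antisymm h2 (abs_nonneg _))
  rw [← LinearMap.range_dualMap_eq_dualAnnihilator_ker] at hker
  obtain ⟨m, hm⟩ := hker
  have hm' (ψ : testFields Ω) : m (weightedVal h ψ) = ℓ ψ := by rw [← hm]; rfl
  let p := LinearMap.range (weightedMap h)
  let m₀ : StrongDual ℝ p := (m.comp p.subtype).mkContinuous M (by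
    rintro ⟨_, ψ, rfl⟩
    change ‖m (weightedVal h ψ)‖ ≤ M * ‖weightedVal h ψ‖
    rw [hm']
    exact hℓ ψ)
  obtain ⟨g, hg, hgn⟩ := exists_extension_norm_eq p m₀
  refine ⟨(InnerProductSpace.toDual ℝ (L2 Ω (Vec n))).symm g, ?_, fun ψ => ?_⟩
  · rw [LinearIsometryEquiv.norm_map, hgn]
    exact LinearMap.mkContinuous_norm_le _ hM _
  · rw [InnerProductSpace.toDual_symm_apply, ← hm']
    exact (hg ⟨_, ψ, rfl⟩).symm

theorem divField_smul_single {n : ℕ} {φ : Vec n → ℝ} (i : Fin n) (x : Vec n) :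
    divField (fun y => φ y • EuclideanSpace.single i (1 : ℝ)) x = gradient φ x i := by
  rw [divField, divOf, Finset.sum_eq_single i]
  · simp
  · intro j _ hj
    simp [hj, gradient_fun_const]
  · simp

/-- The functional `-∫ u div ψ` is represented as `⟨f, ψ / d⟩`, so `f / d` is the weak gradient. -/
theorem exists_hasWeakGradient_of_bound (h : IsBoundedDomain Ω) {u : Vec n → ℝ} {M : ℝ}
    (hu : MemLp u 2 (volume.restrict Ω)) (hM : 0 ≤ M)
    (hb : ∀ ψ : testFields Ω, |∫ x in Ω, u x * divField ψ.1 x| ≤ M * ‖weightedVal h ψ‖) :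
    ∃ g : Vec n → Vec n, HasWeakGradient Ω u g ∧
      MemLp (fun x => bdryDist Ω x • g x) 2 (volume.restrict Ω) ∧
      sqNorm Ω (fun x => bdryDist Ω x • g x) ≤ ENNReal.ofReal (M ^ 2) := by
  let ℓ : testFields Ω →ₗ[ℝ] ℝ :=
    -((innerₗ (L2 Ω ℝ) (hu.toLp u)) ∘ₗ (compJac Ω (divLin n)).toLinearMap ∘ₗ jacMap Ω)
  have hℓ (ψ : testFields Ω) : ℓ ψ = -∫ x in Ω, u x * divField ψ.1 x := by
    change -inner ℝ (hu.toLp u) (compJac Ω (divLin n) (jacMap Ω ψ)) = _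
    rw [inner_toLp_compJac]
    simp [divField_eq, mul_comm]
  obtain ⟨f, hf, hfℓ⟩ := exists_weighted_representative h ℓ hM (fun ψ => by
    rw [hℓ, abs_neg]; exact hb ψ)
  have hfg : (fun x => bdryDist Ω x • (bdryDist Ω x)⁻¹ • f x) =ᵐ[volume.restrict Ω] f := by
    filter_upwards [ae_restrict_mem h.isOpen.measurableSet] with x hx
    rw [smul_smul, mul_inv_cancel₀ (h.bdryDist_pos hx).ne', one_smul]
  have lu := MemLp.locallyIntegrableOn h hu
  have lg : LocallyIntegrableOn (fun x => (bdryDist Ω x)⁻¹ • f x) Ω volume :=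
    (MemLp.locallyIntegrableOn h (Lp.memLp f)).continuousOn_smul h.isOpen.isLocallyClosed
      h.continuousOn_inv_bdryDist
  refine ⟨fun x => (bdryDist Ω x)⁻¹ • f x, ⟨lu, lg, fun φ hφ =>
    (weak_gradient_identity_iff lu lg hφ).2 fun i => ?_⟩, ?_, ?_⟩
  · have h1 := hfℓ ⟨_, hφ.smul_single i⟩
    rw [hℓ, neg_eq_iff_eq_neg] at h1
    simp only [divField_smul_single] at h1
    rw [h1, weightedVal, L2.inner_def]
    congr 1
    refine integral_congr_ae ?_
    filter_upwards [((hφ.smul_single i).inv_bdryDist_smul_memLp h).coeFn_toLp] with x hx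
    rw [hx, real_inner_smul_right, real_inner_smul_right, EuclideanSpace.inner_single_right]
    simp
    ring
  · exact (memLp_congr_ae hfg).2 (Lp.memLp f)
  · rw [sqNorm_congr (hfg.fun_comp norm), sqNorm_lp]
    exact ENNReal.ofReal_le_ofReal (pow_le_pow_left₀ (norm_nonneg _) hf 2)

/-- Interior gradient bounds pass to the weak gradient. -/
theorem InteriorGradientBound.exists_hasWeakGradient {u : Vec n → ℝ} {M : ℝ}
    (hb : InteriorGradientBound Ω u M) (h : IsBoundedDomain Ω)
    (hu : MemLp u 2 (volume.restrict Ω)) (hM : 0 ≤ M) :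
    ∃ g : Vec n → Vec n, HasWeakGradient Ω u g ∧
      MemLp (fun x => bdryDist Ω x • g x) 2 (volume.restrict Ω) ∧
      sqNorm Ω (fun x => bdryDist Ω x • g x) ≤ 4 * ENNReal.ofReal (M ^ 2) := by
  obtain ⟨g, h1, h2, h3⟩ := exists_hasWeakGradient_of_bound h hu (by positivity : 0 ≤ 2 * M)
    (hb.abs_integral_le h hu hM)
  refine ⟨g, h1, h2, h3.trans (le_of_eq ?_)⟩
  rw [mul_pow, ENNReal.ofReal_mul (by norm_num)]
  norm_num

end WeightedGradient

/-! ### The chain rule for weak gradients -/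

section ChainRule

variable {n : ℕ} {Ω : Set (Vec n)}

/-- Translation is continuous in `L₁`. -/
theorem tendsto_integral_abs_translate_sub {f : Vec n → ℝ} (hf : Integrable f) :
    Filter.Tendsto (fun y : Vec n => ∫ x, |f (x - y) - f x|) (nhds 0) (nhds 0) := by
  let g : Vec n → C(Vec n, Vec n) := fun y => ⟨fun x => x - y, by fun_prop⟩
  have hg : Continuous g :=
    (ContinuousMap.curry ⟨fun p : Vec n × Vec n => p.2 - p.1, by fun_prop⟩).continuous
  have hgm (y : Vec n) : MeasurePreserving (g y) := measurePreserving_sub_right volume y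
  have hf1 : MemLp f 1 := memLp_one_iff_integrable.2 hf
  have hc : Continuous (fun y => Lp.compMeasurePreserving (g y) (hgm y) (hf1.toLp f)) :=
    continuous_const.compMeasurePreservingLp hg hgm (by simp)
  have hval (y : Vec n) : ‖Lp.compMeasurePreserving (g y) (hgm y) (hf1.toLp f) - hf1.toLp f‖ =
      ∫ x, |f (x - y) - f x| := by
    rw [L1.norm_eq_integral_norm]
    refine integral_congr_ae ?_
    have h1 := Lp.coeFn_compMeasurePreserving (hf1.toLp f) (hgm y)
    have h2 := (hgm y).quasiMeasurePreserving.ae_eq_comp hf1.coeFn_toLp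
    filter_upwards [Lp.coeFn_sub (Lp.compMeasurePreserving (g y) (hgm y) (hf1.toLp f))
      (hf1.toLp f), h1, h2, hf1.coeFn_toLp] with x hx hx1 hx2 hx3
    rw [hx, Pi.sub_apply, hx1, hx2, hx3, Real.norm_eq_abs]
    rfl
  have ht : Filter.Tendsto
      (fun y => ‖Lp.compMeasurePreserving (g y) (hgm y) (hf1.toLp f) - hf1.toLp f‖) (nhds 0)
      (nhds ‖Lp.compMeasurePreserving (g 0) (hgm 0) (hf1.toLp f) - hf1.toLp f‖) :=
    (hc.sub continuous_const).norm.tendsto 0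
  have h0 : ‖Lp.compMeasurePreserving (g 0) (hgm 0) (hf1.toLp f) - hf1.toLp f‖ = 0 := by
    rw [hval]
    simp
  rw [h0] at ht
  exact ht.congr hval

/-- The functions `θ k` may vary with `k`: a common bound suffices because translation is continuous
in `L₁`. -/
theorem tendsto_integral_mollify_mul_sub {f : Vec n → ℝ} (hf : Integrable f)
    {η : ℕ → ContDiffBump (0 : Vec n)}
    (hη : Filter.Tendsto (fun k => (η k).rOut) Filter.atTop (nhds 0)) {θ : ℕ → Vec n → ℝ} {C : ℝ}
    (hθ : ∀ k, Continuous (θ k)) (hθc : ∀ k, HasCompactSupport (θ k)) (hC : ∀ k x, |θ k x| ≤ C) :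
    Filter.Tendsto (fun k => (∫ x, mollify (η k) f x * θ k x) - ∫ x, f x * θ k x)
      Filter.atTop (nhds 0) := by
  have hC0 : 0 ≤ C := (abs_nonneg _).trans (hC 0 0)
  have hfθ (k : ℕ) : Integrable (fun x => f x * θ k x) :=
    hf.mul_bdd (c := C) (hθ k).aestronglyMeasurable (Filter.Eventually.of_forall (hC k))
  refine Metric.tendsto_atTop.2 fun ε hε => ?_
  obtain ⟨r, hr, hrb⟩ := Metric.tendsto_nhds_nhds.1 (tendsto_integral_abs_translate_sub hf)
    (ε / (C + 1)) (by positivity)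
  obtain ⟨N, hN⟩ := Metric.tendsto_atTop.1 hη r hr
  refine ⟨N, fun k hk => ?_⟩
  rw [dist_zero_right, Real.norm_eq_abs]
  refine lt_of_le_of_lt (abs_integral_mollify_sub_le (η k) hf (hθ k) (hθc k)
    (M := C * (ε / (C + 1))) fun y hy => ?_) ?_
  · have hy' : dist y 0 < r := by
      have h1 := hN k hk
      rw [Real.dist_eq, sub_zero, abs_of_pos (η k).rOut_pos] at h1
      exact (Metric.mem_ball.1 hy).trans h1
    have h2 := (hrb hy').le
    rw [dist_zero_right, Real.norm_eq_abs, abs_of_nonneg (integral_nonneg fun x => abs_nonneg _)]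
      at h2
    have hfy : Integrable (fun x => f (x - y)) := hf.comp_sub_right y
    rw [← integral_shift_mul, ← integral_sub (hfy.mul_bdd (c := C) (hθ k).aestronglyMeasurable
      (Filter.Eventually.of_forall (hC k))) (hfθ k), ← Real.norm_eq_abs]
    calc _ ≤ ∫ x, C * |f (x - y) - f x| := by
          refine norm_integral_le_of_norm_le ((hfy.sub hf).abs.const_mul C)
            (Filter.Eventually.of_forall fun x => ?_)
          rw [← sub_mul, norm_mul, mul_comm]
          exact mul_le_mul_of_nonneg_right (hC k x) (norm_nonneg _)
      _ = C * ∫ x, |f (x - y) - f x| := integral_const_mul _ _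
      _ ≤ _ := by gcongr
  · rw [mul_div_assoc', div_lt_iff₀ (by positivity)]
    nlinarith

theorem integral_indicator_mul_eq_setIntegral {κ : Set (Vec n)} (hκ : κ ⊆ Ω) (f k : Vec n → ℝ)
    (hk : ∀ x ∉ κ, k x = 0) : ∫ x, κ.indicator f x * k x = ∫ x in Ω, f x * k x := by
  rw [setIntegral_eq_integral_of_forall_compl_eq_zero
    fun x hx => by rw [hk x (fun h' => hx (hκ h')), mul_zero]]
  congr 1
  ext x
  by_cases hx : x ∈ κ
  · simp [hx]
  · simp [hx, hk x hx]

/-- The weak gradient identity is inherited by mollifications. -/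
theorem HasWeakGradient.integral_mollify {u : Vec n → ℝ} {g : Vec n → Vec n}
    (hug : HasWeakGradient Ω u g) {K κ : Set (Vec n)} (hκc : IsCompact κ) (hκ : κ ⊆ Ω)
    (η : ContDiffBump (0 : Vec n)) (hη : ∀ x ∈ K, ∀ y ∈ Metric.ball 0 η.rOut, x - y ∈ κ)
    {θ : Vec n → ℝ} (hθ : ContDiff ℝ ∞ θ) (hθc : HasCompactSupport θ) (hθK : tsupport θ ⊆ K)
    (i : Fin n) :
    ∫ x, mollify η (κ.indicator u) x * gradient θ x i =
      -∫ x, mollify η (κ.indicator fun x => g x i) x * θ x := by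
  have hθt : IsTestFun Set.univ θ := ⟨hθ, hθc, Set.subset_univ _⟩
  have hκm : MeasurableSet κ := hκc.isClosed.measurableSet
  have hu : Integrable (κ.indicator u) :=
    (integrable_indicator_iff hκm).2 (hug.1.integrableOn_compact_subset hκ hκc)
  have hg : Integrable (κ.indicator fun x => g x i) :=
    (integrable_indicator_iff hκm).2
      ((LocallyIntegrableOn.coord hug.2.1 i).integrableOn_compact_subset hκ hκc)
  rw [← integral_neg]
  simp only [← mul_neg]
  refine integral_mollify_congr η hu (hθt.grad.coord i).continuous (hθt.grad.coord i).2.1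
    hg hθ.continuous.neg hθc.neg fun y hy => ?_
  have hsh : IsTestFun Ω (fun x => θ (x + y)) :=
    IsTestFun.shift hθ hθc fun x hx => hκ (hη x (hθK hx) y hy)
  have hmem {x : Vec n} (hx : x + y ∈ tsupport θ) : x ∈ κ := by
    simpa using hη _ (hθK hx) y hy
  rw [integral_indicator_mul_eq_setIntegral hκ u (fun x => gradient θ (x + y) i) fun x hx => by
      rw [image_eq_zero_of_notMem_tsupport (f := gradient θ) fun h' =>
        hx (hmem (tsupport_gradient_subset θ h'))]
      rfl,
    integral_indicator_mul_eq_setIntegral hκ _ (fun x => -θ (x + y)) fun x hx => by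
      rw [image_eq_zero_of_notMem_tsupport fun h' => hx (hmem h'), neg_zero]]
  have h1 := hug.coord hsh i
  simp only [gradient_comp_add] at h1
  rw [h1, ← integral_neg]
  congr 1
  ext x
  ring

/-- The chain rule for weak gradients. -/
theorem HasWeakGradient.comp_smooth (h : IsBoundedDomain Ω) {u : Vec n → ℝ} {g : Vec n → Vec n}
    (hug : HasWeakGradient Ω u g) {T : ℝ → ℝ} (hT : ContDiff ℝ ∞ T) {B : ℝ}
    (hTB : ∀ s, |T s| ≤ B) (hT' : ∀ s, |deriv T s| ≤ 1) :
    HasWeakGradient Ω (fun x => T (u x)) (fun x => deriv T (u x) • g x) := by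
  have := h.isFiniteMeasure
  have hTd : ContDiff ℝ ∞ (deriv T) := (contDiff_infty_iff_deriv.1 hT).2
  have hum : AEStronglyMeasurable u (volume.restrict Ω) := hug.1.aestronglyMeasurable
  have l1 : LocallyIntegrableOn (fun x => T (u x)) Ω volume := by
    have : IntegrableOn (fun x => T (u x)) Ω :=
      Integrable.of_bound (hT.continuous.comp_aestronglyMeasurable hum) B
        (Filter.Eventually.of_forall fun x => hTB _)
    exact this.locallyIntegrableOn
  have l2 : LocallyIntegrableOn (fun x => deriv T (u x) • g x) Ω volume := by
    refine (locallyIntegrableOn_iff h.isOpen.isLocallyClosed).2 fun K hK hKc => ?_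
    refine Integrable.bdd_smul (φ := fun x => deriv T (u x))
      (hug.2.1.integrableOn_compact_subset hK hKc) 1 ?_ (Filter.Eventually.of_forall fun x => hT' _)
    exact (hTd.continuous.comp_aestronglyMeasurable hum).mono_measure
      (Measure.restrict_mono hK le_rfl)
  refine ⟨l1, l2, fun φ hφ => (weak_gradient_identity_iff l1 l2 hφ).2 fun i => ?_⟩
  obtain ⟨δ, hδ, hδΩ⟩ := hφ.2.1.exists_cthickening_subset_open h.isOpen hφ.2.2
  set K := tsupport φ
  -- A compact neighbourhood of the support of `φ` inside `Ω`: `u` and `g` are integrable on it, and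
  -- it contains all shifts of the support used in the mollifications.
  set κ := Metric.cthickening δ K with hκdef
  have hκc : IsCompact κ := hφ.2.1.cthickening
  have hκm : MeasurableSet κ := hκc.isClosed.measurableSet
  have hKκ : K ⊆ κ := Metric.self_subset_cthickening K
  have hui : Integrable (κ.indicator u) :=
    (integrable_indicator_iff hκm).2 (hug.1.integrableOn_compact_subset hδΩ hκc)
  have hgi : Integrable (κ.indicator fun x => g x i) :=
    (integrable_indicator_iff hκm).2
      ((LocallyIntegrableOn.coord hug.2.1 i).integrableOn_compact_subset hδΩ hκc)
  let η : ℕ → ContDiffBump (0 : Vec n) := fun k => bumpOfRadius (δ / (k + 1)) (by positivity)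
  have hη : Filter.Tendsto (fun k => (η k).rOut) Filter.atTop (nhds 0) := by
    have := (tendsto_one_div_add_atTop_nhds_zero_nat (𝕜 := ℝ)).const_mul δ
    simpa [η, bumpOfRadius, div_eq_mul_inv] using this
  have hηδ (k : ℕ) : ∀ x ∈ K, ∀ y ∈ Metric.ball 0 (η k).rOut, x - y ∈ κ := by
    intro x hx y hy
    refine Metric.mem_cthickening_of_dist_le _ x _ _ hx ?_
    have h1 : ‖y‖ < δ / (k + 1) := mem_ball_zero_iff.1 hy
    have h2 : δ / (k + 1 : ℝ) ≤ δ := div_le_self hδ.le (by linarith [k.cast_nonneg (α := ℝ)])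
    simpa using (h1.le.trans h2)
  set w : ℕ → Vec n → ℝ := fun k => mollify (η k) (κ.indicator u)
  have hw (k : ℕ) : ContDiff ℝ ∞ (w k) := contDiff_mollify _ hui.locallyIntegrable
  -- The classical chain rule gives `φ ∂ᵢ(T ∘ w k) = θ k ∂ᵢ(w k)`, so the weak gradient of `u` is
  -- tested with `θ k`, which depends on `k`.
  set θ : ℕ → Vec n → ℝ := fun k x => φ x * deriv T (w k x) with hθdef
  have hθ (k : ℕ) : ContDiff ℝ ∞ (θ k) := hφ.1.mul (hTd.comp (hw k))
  have hθt (k : ℕ) : IsTestFun Ω (θ k) :=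
    hφ.of_support_subset (hθ k) fun x hx => by simp [hθdef, hx]
  have hθK (k : ℕ) : tsupport (θ k) ⊆ K :=
    closure_mono fun x hx h0 => hx (by simp [hθdef, h0])
  have hae : ∀ᵐ x, Filter.Tendsto (fun k => w k x) Filter.atTop (nhds (κ.indicator u x)) := by
    -- Lebesgue differentiation needs a bounded ratio of outer to inner radius; for `bumpOfRadius`
    -- it is `2`.
    refine ContDiffBump.ae_convolution_tendsto_right_of_locallyIntegrable (K := 2) hη
      (Filter.Eventually.of_forall fun k => ?_) hui.locallyIntegrable
    simp only [η, bumpOfRadius]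
    linarith
  have hid (k : ℕ) : ∫ x, T (w k x) * gradient φ x i =
      -∫ x, mollify (η k) (κ.indicator fun x => g x i) x * θ k x := by
    rw [← hug.integral_mollify hκc hδΩ (η k) (hηδ k) (hθ k) (hθt k).2.1 (hθK k) i,
      show ∫ x, T (w k x) * gradient φ x i = ∫ x, (T ∘ w k) x * gradient φ x i from rfl,
      integral_mul_gradient (hT.comp (hw k)) hφ.1 hφ.2.1 i,
      integral_mul_gradient (hw k) (hθ k) (hθt k).2.1 i]
    congr 2
    ext x
    have h1 := gradient_scalar_comp (f := w k) (x := x)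
      (hT.differentiable (by simp) (w k x)) ((hw k).differentiable (by simp) x)
    have h2 : gradient (T ∘ w k) x = deriv T (w k x) • gradient (w k) x := h1
    rw [h2, PiLp.smul_apply, smul_eq_mul, hθdef]
    ring
  obtain ⟨C, hC⟩ := hφ.continuous.bounded_above_of_compact_support hφ.2.1
  have hθC (k : ℕ) (x : Vec n) : |θ k x| ≤ C := by
    rw [hθdef]
    simp only [abs_mul]
    calc |φ x| * |deriv T (w k x)| ≤ |φ x| * 1 := by gcongr; exact hT' _
      _ ≤ C := by rw [mul_one]; exact hC x
  have hlim1 : Filter.Tendsto (fun k => ∫ x, T (w k x) * gradient φ x i) Filter.atTop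
      (nhds (∫ x, T (κ.indicator u x) * gradient φ x i)) := by
    have hgφ := (hφ.grad.coord i).continuous.integrable_of_hasCompactSupport (hφ.grad.coord i).2.1
      (μ := volume)
    refine tendsto_integral_of_dominated_convergence (fun x => B * |gradient φ x i|)
      (fun k => ((hT.continuous.comp (hw k).continuous).mul
        (hφ.grad.coord i).continuous).aestronglyMeasurable) (hgφ.abs.const_mul B)
      (fun k => Filter.Eventually.of_forall fun x => ?_) ?_
    · rw [norm_mul]
      exact mul_le_mul_of_nonneg_right (hTB _) (abs_nonneg _)
    · filter_upwards [hae] with x hx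
      exact ((hT.continuous.tendsto _).comp hx).mul_const _
  have hlim2 : Filter.Tendsto (fun k => ∫ x, κ.indicator (fun x => g x i) x * θ k x) Filter.atTop
      (nhds (∫ x, κ.indicator (fun x => g x i) x * (φ x * deriv T (κ.indicator u x)))) := by
    refine tendsto_integral_of_dominated_convergence
      (fun x => |κ.indicator (fun x => g x i) x| * C)
      (fun k => hgi.aestronglyMeasurable.mul (hθ k).continuous.aestronglyMeasurable)
      (hgi.abs.mul_const C) (fun k => Filter.Eventually.of_forall fun x => ?_) ?_
    · rw [norm_mul]
      exact mul_le_mul_of_nonneg_left (hθC k x) (abs_nonneg _)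
    · filter_upwards [hae] with x hx
      exact (((hTd.continuous.tendsto _).comp hx).const_mul _).const_mul _
  have hlim3 := tendsto_integral_mollify_mul_sub hgi hη (fun k => (hθ k).continuous)
    (fun k => (hθt k).2.1) hθC
  have hlim4 := (hlim3.add hlim2).neg
  simp only [sub_add_cancel, zero_add, ← hid] at hlim4
  have heq := tendsto_nhds_unique hlim1 hlim4
  have e1 : ∫ x, T (κ.indicator u x) * gradient φ x i = ∫ x in Ω, T (u x) * gradient φ x i := by
    rw [setIntegral_eq_integral_of_forall_compl_eq_zero
      fun x hx => by rw [(hφ.grad.coord i).eq_zero hx, mul_zero]]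
    congr 1
    ext x
    by_cases hx : x ∈ K
    · rw [Set.indicator_of_mem (hKκ hx)]
    · rw [image_eq_zero_of_notMem_tsupport (f := gradient φ)
        fun h' => hx (tsupport_gradient_subset φ h')]
      simp
  have e2 : ∫ x, κ.indicator (fun x => g x i) x * (φ x * deriv T (κ.indicator u x)) =
      ∫ x in Ω, φ x * (deriv T (u x) • g x) i := by
    rw [setIntegral_eq_integral_of_forall_compl_eq_zero
      fun x hx => by rw [hφ.eq_zero hx, zero_mul]]
    congr 1
    ext x
    by_cases hx : x ∈ K
    · rw [Set.indicator_of_mem (hKκ hx), Set.indicator_of_mem (hKκ hx), PiLp.smul_apply,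
        smul_eq_mul]
      ring
    · rw [image_eq_zero_of_notMem_tsupport hx]
      simp
  rw [← e1, ← e2, heq]

end ChainRule

/-! ### Square integrability by truncation -/

section Truncation

/-- A smooth bounded truncation of the identity at height comparable to `M`. -/
noncomputable def truncation (M : ℝ) (s : ℝ) : ℝ := M * Real.arctan (M⁻¹ * s)

theorem contDiff_truncation (M : ℝ) : ContDiff ℝ ∞ (truncation M) :=
  contDiff_const.mul (Real.contDiff_arctan.comp (contDiff_const.mul contDiff_id))

theorem abs_truncation_le {M : ℝ} (hM : 0 < M) (s : ℝ) : |truncation M s| ≤ M * (Real.pi / 2) := by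
  rw [truncation, abs_mul, abs_of_pos hM]
  gcongr
  exact abs_le.2 ⟨(Real.neg_pi_div_two_lt_arctan _).le, (Real.arctan_lt_pi_div_two _).le⟩

theorem abs_deriv_truncation_le {M : ℝ} (hM : 0 < M) (s : ℝ) : |deriv (truncation M) s| ≤ 1 := by
  have h1 : HasDerivAt (truncation M) (M * (1 / (1 + (M⁻¹ * s) ^ 2) * (M⁻¹ * 1))) s :=
    ((Real.hasDerivAt_arctan _).comp s ((hasDerivAt_id s).const_mul M⁻¹)).const_mul M
  have h2 : M * (1 / (1 + (M⁻¹ * s) ^ 2) * (M⁻¹ * 1)) = 1 / (1 + (M⁻¹ * s) ^ 2) := by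
    field_simp
  rw [h1.deriv, h2, abs_of_nonneg (by positivity), div_le_one (by positivity)]
  linarith [sq_nonneg (M⁻¹ * s)]

/-- The limit is the derivative of `t ↦ arctan (t s)` at `0`, taken along `t = 1 / (k + 1)`. -/
theorem tendsto_truncation (s : ℝ) :
    Filter.Tendsto (fun k : ℕ => truncation (k + 1) s) Filter.atTop (nhds s) := by
  have h1 : HasDerivAt (fun t : ℝ => Real.arctan (t * s)) s 0 := by
    have := (Real.hasDerivAt_arctan ((0 : ℝ) * s)).comp 0 ((hasDerivAt_id (0 : ℝ)).mul_const s)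
    simpa [Function.comp_def] using this
  have h2 := hasDerivAt_iff_tendsto_slope_zero.1 h1
  have h3 : Filter.Tendsto (fun k : ℕ => ((k : ℝ) + 1)⁻¹) Filter.atTop (nhdsWithin 0 {0}ᶜ) := by
    refine tendsto_nhdsWithin_iff.2 ⟨?_, Filter.Eventually.of_forall fun k => ?_⟩
    · simpa using tendsto_one_div_add_atTop_nhds_zero_nat (𝕜 := ℝ)
    · have : (0 : ℝ) < (k : ℝ) + 1 := by positivity
      simpa using this.ne'
  refine (h2.comp h3).congr fun k => ?_
  simp [truncation]

variable {n : ℕ} {Ω : Set (Vec n)}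

theorem sqNorm_real_eq {f : Vec n → ℝ} (hf : MemLp f 2 (volume.restrict Ω)) :
    sqNorm Ω f = ENNReal.ofReal (∫ x in Ω, f x ^ 2) := by
  rw [sqNorm_eq_ofReal hf, norm_toLp_sq]
  simp

theorem continuous_inv_one_add_sq : Continuous (fun s : ℝ => (1 + s ^ 2)⁻¹) :=
  (continuous_const.add (continuous_pow 2)).inv₀ fun s =>
    (by positivity : (0 : ℝ) < 1 + s ^ 2).ne'

/-- The mean values of functions that stay close to their means in `L₂` are controlled by any
function dominating the differences. -/
theorem sq_mul_integral_le {u w : Vec n → ℝ} [IsFiniteMeasure (volume.restrict Ω)]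
    (hum : AEStronglyMeasurable u (volume.restrict Ω)) {c b : ℝ}
    (hw : MemLp (fun x => w x - c) 2 (volume.restrict Ω))
    (hwu : ∀ x, |w x| ≤ |u x|) (hb : ∫ x in Ω, (w x - c) ^ 2 ≤ b) :
    c ^ 2 * ∫ x in Ω, (1 + u x ^ 2)⁻¹ ≤ 2 * b + 2 * volume.real Ω := by
  have hf1 (s : ℝ) : (1 + s ^ 2)⁻¹ ≤ 1 := inv_le_one_of_one_le₀ (by nlinarith [sq_nonneg s])
  have hf0 (s : ℝ) : 0 ≤ (1 + s ^ 2)⁻¹ := by positivity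
  have hfi : Integrable (fun x => (1 + u x ^ 2)⁻¹) (volume.restrict Ω) :=
    Integrable.of_bound (continuous_inv_one_add_sq.comp_aestronglyMeasurable hum) 1
      (Filter.Eventually.of_forall fun x => by
        rw [Real.norm_of_nonneg (hf0 _)]; exact hf1 _)
  have hwi : Integrable (fun x => (w x - c) ^ 2) (volume.restrict Ω) := hw.integrable_sq
  have h1 : ∫ x in Ω, c ^ 2 * (1 + u x ^ 2)⁻¹ ≤ ∫ x in Ω, (2 * (w x - c) ^ 2 + 2) := by
    refine integral_mono (hfi.const_mul _) ((hwi.const_mul 2).add (integrable_const 2)) fun x => ?_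
    have h2 : u x ^ 2 * (1 + u x ^ 2)⁻¹ ≤ 1 := by
      rw [← div_eq_mul_inv, div_le_one (by positivity)]
      linarith
    have h3 : w x ^ 2 ≤ u x ^ 2 := sq_le_sq.2 (hwu x)
    -- Multiplied by `(1 + u²)⁻¹`, the last term becomes at most `2`. So the bound on `c` does not
    -- see how large `w` is, although `u` need not be integrable.
    have h4 : c ^ 2 ≤ 2 * (w x - c) ^ 2 + 2 * u x ^ 2 := by nlinarith [sq_nonneg (2 * w x - c)]
    have h5 := mul_le_mul_of_nonneg_right h4 (hf0 (u x))
    have h6 := mul_le_mul_of_nonneg_left (hf1 (u x)) (sq_nonneg (w x - c))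
    simp only
    nlinarith
  rw [integral_const_mul, integral_add (hwi.const_mul 2) (integrable_const 2),
    integral_const_mul] at h1
  simp only [integral_const, smul_eq_mul, measureReal_restrict_apply_univ] at h1
  linarith

theorem abs_truncation_le_abs {M : ℝ} (hM : 0 < M) (s : ℝ) : |truncation M s| ≤ |s| := by
  have h := (convex_univ (𝕜 := ℝ) (E := ℝ)).norm_image_sub_le_of_norm_deriv_le
    (f := truncation M) (C := 1) (x := 0) (y := s)
    (fun x _ => (contDiff_truncation M).differentiable (by simp) x)
    (fun x _ => abs_deriv_truncation_le hM x) (Set.mem_univ _) (Set.mem_univ _)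
  simpa [truncation] using h

/-- A function with weighted square integrable gradient is square integrable if square integrable
functions satisfy the improved Poincaré inequality. -/
theorem HasWeakGradient.memL2_of_improvedPoincare (h : IsBoundedDomain Ω) {P : ℝ≥0}
    (hP : ∀ (u : Vec n → ℝ) (g : Vec n → Vec n), HasWeakGradient Ω u g →
      MemLp (fun x => bdryDist Ω x • g x) 2 (volume.restrict Ω) →
      MemLp u 2 (volume.restrict Ω) →
      sqNorm Ω (fun x => u x - ⨍ y in Ω, u y) ≤ P * sqNorm Ω (fun x => bdryDist Ω x • g x))
    {u : Vec n → ℝ} {g : Vec n → Vec n} (hug : HasWeakGradient Ω u g)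
    (hdg : MemLp (fun x => bdryDist Ω x • g x) 2 (volume.restrict Ω)) : MemL2 Ω u := by
  have := h.isFiniteMeasure
  have hum : AEStronglyMeasurable u (volume.restrict Ω) := hug.1.aestronglyMeasurable
  set b := P * ‖hdg.toLp _‖ ^ 2 with hb
  have hb0 : 0 ≤ b := by positivity
  let w : ℕ → Vec n → ℝ := fun k x => truncation (k + 1) (u x)
  have hpos (k : ℕ) : (0 : ℝ) < k + 1 := by positivity
  have hwm (k : ℕ) : AEStronglyMeasurable (w k) (volume.restrict Ω) :=
    (contDiff_truncation _).continuous.comp_aestronglyMeasurable hum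
  have hw (k : ℕ) : MemLp (w k) 2 (volume.restrict Ω) :=
    MemLp.of_bound (hwm k) _ (Filter.Eventually.of_forall fun x => abs_truncation_le (hpos k) _)
  let c : ℕ → ℝ := fun k => ⨍ y in Ω, w k y
  have hwc (k : ℕ) : MemLp (fun x => w k x - c k) 2 (volume.restrict Ω) :=
    (hw k).sub (memLp_const _)
  -- Truncation has slope at most `1`, so it does not increase the weighted gradient norm and `b`
  -- serves for all `k`.
  have hkey (k : ℕ) : ∫ x in Ω, (w k x - c k) ^ 2 ≤ b := by
    have hwg := hug.comp_smooth h (contDiff_truncation (k + 1)) (abs_truncation_le (hpos k))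
      (abs_deriv_truncation_le (hpos k))
    have hle : ∀ x, ‖bdryDist Ω x • deriv (truncation (k + 1)) (u x) • g x‖ ≤
        ‖bdryDist Ω x • g x‖ := fun x => by
      rw [smul_comm, norm_smul]
      exact mul_le_of_le_one_left (norm_nonneg _) (abs_deriv_truncation_le (hpos k) _)
    have hmem : MemLp (fun x => bdryDist Ω x • deriv (truncation (k + 1)) (u x) • g x) 2
        (volume.restrict Ω) :=
      hdg.mono ((continuous_bdryDist Ω).aestronglyMeasurable.smul
        hwg.2.1.aestronglyMeasurable) (Filter.Eventually.of_forall hle)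
    have h1 := hP _ _ hwg hmem (hw k)
    have h2 : sqNorm Ω (fun x => bdryDist Ω x • deriv (truncation (k + 1)) (u x) • g x) ≤
        sqNorm Ω (fun x => bdryDist Ω x • g x) := by
      refine lintegral_mono fun x => ?_
      gcongr
      exact enorm_le_iff_norm_le.2 (hle x)
    have h3 := h1.trans (mul_le_mul_right h2 (P : ℝ≥0∞))
    have h4 := sqNorm_real_eq (hwc k)
    change sqNorm Ω (fun x => w k x - c k) ≤ _ at h3
    rw [h4, sqNorm_eq_ofReal hdg, ← ENNReal.ofReal_coe_nnreal, ← ENNReal.ofReal_mul P.coe_nonneg,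
      ENNReal.ofReal_le_ofReal_iff hb0] at h3
    exact h3
  set I := ∫ x in Ω, (1 + u x ^ 2)⁻¹ with hI
  have hI0 : 0 < I := by
    have hfi : Integrable (fun x => (1 + u x ^ 2)⁻¹) (volume.restrict Ω) :=
      Integrable.of_bound (continuous_inv_one_add_sq.comp_aestronglyMeasurable hum) 1
        (Filter.Eventually.of_forall fun x => by
          rw [Real.norm_of_nonneg (by positivity)]
          exact inv_le_one_of_one_le₀ (by nlinarith [sq_nonneg (u x)]))
    rw [hI, integral_pos_iff_support_of_nonneg (fun x => by positivity) hfi]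
    have : Function.support (fun x => (1 + u x ^ 2)⁻¹) = Set.univ :=
      Set.eq_univ_of_forall fun x => (by positivity : (1 + u x ^ 2)⁻¹ ≠ 0)
    rw [this]
    simpa using h.measure_pos
  -- A bound for the squared means uniform in `k`. With `hkey` it bounds `w k` in `L₂`, and Fatou's
  -- lemma concludes.
  set Q := (2 * b + 2 * volume.real Ω) / I
  have hQ (k : ℕ) : c k ^ 2 ≤ Q := by
    rw [le_div_iff₀ hI0]
    exact sq_mul_integral_le hum (hwc k) (fun x => abs_truncation_le_abs (hpos k) _) (hkey k)
  have hZ (k : ℕ) : sqNorm Ω (w k) ≤ ENNReal.ofReal (2 * b + 2 * Q * volume.real Ω) := by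
    rw [sqNorm_real_eq (hw k)]
    refine ENNReal.ofReal_le_ofReal ?_
    have h1 : ∫ x in Ω, w k x ^ 2 ≤ ∫ x in Ω, (2 * (w k x - c k) ^ 2 + 2 * Q) := by
      refine integral_mono (hw k).integrable_sq
        (((hwc k).integrable_sq.const_mul 2).add (integrable_const _)) fun x => ?_
      have := hQ k
      simp only
      nlinarith [sq_nonneg (w k x - 2 * c k)]
    rw [integral_add ((hwc k).integrable_sq.const_mul 2) (integrable_const _),
      integral_const_mul] at h1
    simp only [integral_const, smul_eq_mul, measureReal_restrict_apply_univ] at h1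
    linarith [hkey k]
  refine memL2_of_sqNorm hum (ne_top_of_le_ne_top ENNReal.ofReal_ne_top
    (b := ENNReal.ofReal (2 * b + 2 * Q * volume.real Ω)) ?_)
  calc sqNorm Ω u = ∫⁻ x in Ω, Filter.liminf (fun k => ‖w k x‖ₑ ^ 2) Filter.atTop := by
        refine lintegral_congr fun x => ?_
        exact ((ENNReal.Tendsto.pow (tendsto_truncation (u x)).enorm).liminf_eq).symm
    _ ≤ Filter.liminf (fun k => sqNorm Ω (w k)) Filter.atTop :=
        lintegral_liminf_le' fun k => (hwm k).enorm.pow_const 2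
    _ ≤ _ := Filter.liminf_le_of_frequently_le'
        (Filter.Frequently.of_forall hZ)

end Truncation

/-! ### The equivalences for the divergence -/

section DivEquivalence

variable {n : ℕ} {Ω : Set (Vec n)} {F : Type} [NormedAddCommGroup F] [InnerProductSpace ℝ F]

/-- The distributional equation `∇u = ρ* (∇v)` relating conjugate harmonic functions. -/
def IsConjugate (Ω : Set (Vec n)) (ρ : (Fin n → Vec n) →ₗ[ℝ] F) (u : Vec n → ℝ)
    (v : Vec n → F) : Prop :=
  ∀ ψ : Vec n → Vec n, IsTestFun Ω ψ →
    ∫ x in Ω, inner ℝ (v x) (ρ (jac ψ x)) = -∫ x in Ω, u x * divField ψ x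

/-- `C` is the square of a bound for a right inverse of the divergence on mean zero functions. -/
def DivRightInverse (Ω : Set (Vec n)) (C : ℝ≥0) : Prop :=
  ∀ u : L2 Ω ℝ, ∫ x in Ω, u x = 0 →
    ∃ g ∈ jacClosure Ω, compJac Ω (divLin n) g = u ∧ ‖g‖ ^ 2 ≤ C * ‖u‖ ^ 2

/-- The Friedrichs-Velte inequality for a class of conjugate pairs. -/
def FriedrichsVelteFor (Ω : Set (Vec n)) (CH : (Vec n → ℝ) → (Vec n → F) → Prop)
    (Γ : ℝ≥0) : Prop :=
  ∀ u v, CH u v → ⨍ x in Ω, u x = 0 → sqNorm Ω u ≤ Γ * sqNorm Ω v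

theorem average_eq_zero_iff (h : IsBoundedDomain Ω) (u : Vec n → ℝ) :
    ⨍ x in Ω, u x = 0 ↔ ∫ x in Ω, u x = 0 := by
  have h1 : volume.real Ω ≠ 0 := (ENNReal.toReal_pos h.measure_pos.ne' h.measure_lt_top.ne).ne'
  rw [setAverage_eq, smul_eq_zero]
  simp [h1]

theorem ofReal_sq_le_iff {C : ℝ≥0} {a b : ℝ} :
    ENNReal.ofReal (a ^ 2) ≤ C * ENNReal.ofReal (b ^ 2) ↔ a ^ 2 ≤ C * b ^ 2 := by
  rw [← ENNReal.ofReal_coe_nnreal, ← ENNReal.ofReal_mul C.coe_nonneg,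
    ENNReal.ofReal_le_ofReal_iff (by positivity)]

theorem IsConjugate.inner_jac {ρ : (Fin n → Vec n) →ₗ[ℝ] F} {u : Vec n → ℝ} {v : Vec n → F}
    (huv : IsConjugate Ω ρ u v) (hu : MemLp u 2 (volume.restrict Ω))
    (hv : MemLp v 2 (volume.restrict Ω)) {g : JacSpace Ω} (hg : g ∈ jacClosure Ω) :
    inner ℝ (hv.toLp v) (compJac Ω ρ g) =
      -inner ℝ (hu.toLp u) (compJac Ω (divLin n) g) := by
  refine jacClosure_induction (p := fun g => inner ℝ (hv.toLp v) (compJac Ω ρ g) =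
      -inner ℝ (hu.toLp u) (compJac Ω (divLin n) g))
    (isClosed_eq (by fun_prop) (by fun_prop)) (fun ψ => ?_) hg
  rw [inner_toLp_compJac, inner_toLp_compJac, huv ψ.1 (isTest_coe ψ)]
  simp [divField_eq, mul_comm]

theorem isConjugate_of_inner {ρ : (Fin n → Vec n) →ₗ[ℝ] F} {u : L2 Ω ℝ} {v : L2 Ω F}
    (huv : ∀ ψ : testFields Ω, inner ℝ v (compJac Ω ρ (jacMap Ω ψ)) =
      -inner ℝ u (compJac Ω (divLin n) (jacMap Ω ψ))) : IsConjugate Ω ρ u v := by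
  intro ψ hψ
  have h1 := huv ⟨ψ, hψ⟩
  have h2 := inner_toLp_compJac (Lp.memLp v) ρ ⟨ψ, hψ⟩
  have h3 := inner_toLp_compJac (Lp.memLp u) (divLin n) ⟨ψ, hψ⟩
  rw [Lp.toLp_coeFn] at h2 h3
  rw [h2, h3] at h1
  rw [h1]
  simp [divField_eq, mul_comm]

theorem norm_compJac_rot_le {ρ : (Fin n → Vec n) →ₗ[ℝ] F} (hρ : IsRotSymbol ρ) {g : JacSpace Ω}
    (hg : g ∈ jacClosure Ω) : ‖compJac Ω ρ g‖ ≤ ‖g‖ := by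
  refine le_of_sq_le_sq ?_ (norm_nonneg _)
  rw [norm_sq_of_mem_jacClosure hρ hg]
  linarith [sq_nonneg ‖compJac Ω (divLin n) g‖]

theorem norm_compJac_div_le {ρ : (Fin n → Vec n) →ₗ[ℝ] F} (hρ : IsRotSymbol ρ) {g : JacSpace Ω}
    (hg : g ∈ jacClosure Ω) : ‖compJac Ω (divLin n) g‖ ≤ ‖g‖ := by
  refine le_of_sq_le_sq ?_ (norm_nonneg _)
  rw [norm_sq_of_mem_jacClosure hρ hg]
  linarith [sq_nonneg ‖compJac Ω ρ g‖]

variable {ρ : (Fin n → Vec n) →ₗ[ℝ] F} {CH : (Vec n → ℝ) → (Vec n → F) → Prop}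

/-- The Hilbert space argument only produces pairs whose second member is `ρ g`. Hence `CH` need not
contain all conjugate pairs; in space such a `ρ g` is solenoidal automatically. -/
theorem FriedrichsVelteFor.divRightInverse (h : IsBoundedDomain Ω) (hρ : IsRotSymbol ρ)
    (hCH : ∀ (u : L2 Ω ℝ) (g : JacSpace Ω), g ∈ jacClosure Ω →
      IsConjugate Ω ρ u (compJac Ω ρ g) → CH u (compJac Ω ρ g))
    {Γ : ℝ≥0} (hFV : FriedrichsVelteFor Ω CH Γ) : DivRightInverse Ω (1 + Γ) := by
  intro u hu
  refine exists_jac_div_eq h hρ Γ.coe_nonneg (fun u g hg hu0 huv => ?_) hu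
  -- Conjugacy carries the opposite sign, so the pair is `(u, ρ (-g))`; norms are unaffected.
  have hg' : -g ∈ jacClosure Ω := neg_mem hg
  have hc : IsConjugate Ω ρ u (compJac Ω ρ (-g)) := by
    refine isConjugate_of_inner fun ψ => ?_
    rw [huv, map_neg, inner_neg_left]
  have h1 := hFV _ _ (hCH u (-g) hg' hc) ((average_eq_zero_iff h _).2 hu0)
  rw [sqNorm_lp, sqNorm_lp, ofReal_sq_le_iff, map_neg, norm_neg] at h1
  exact h1

theorem DivRightInverse.babuskaAzizDiv [Nontrivial (Vec n)] (h : IsBoundedDomain Ω) {H C : ℝ≥0}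
    (hH : Hardy Ω H) (hC : DivRightInverse Ω C) : BabuskaAzizDiv Ω C := by
  intro u hu hu0
  have hu' : MemLp u 2 (volume.restrict Ω) := hu
  have hm : ∫ x in Ω, hu'.toLp u x = 0 := by
    rw [integral_congr_ae hu'.coeFn_toLp]
    exact (average_eq_zero_iff h u).1 hu0
  obtain ⟨g, hg, hgu, hle⟩ := hC _ hm
  obtain ⟨v, hv⟩ := hH.exists_hasH10Jacobian h hg
  refine ⟨v, _, hv, ?_, ?_⟩
  · have h1 := coeFn_compJac (divLin n) g
    rw [hgu] at h1
    filter_upwards [h1, hu'.coeFn_toLp] with x hx1 hx2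
    rw [← hx2, hx1]
    rfl
  · rw [sqSeminorm_coe, sqNorm_eq_ofReal hu', ofReal_sq_le_iff]
    exact hle

/-- Testing conjugacy with `w`, `div w = u`, gives `‖u‖² = -⟨v, ρ (∇w)⟩ ≤ ‖v‖ |w|₁ ≤ ‖v‖ √C ‖u‖`. -/
theorem BabuskaAzizDiv.friedrichsVelteFor (hρ : IsRotSymbol ρ)
    (hCH : ∀ u v, CH u v → MemL2 Ω u ∧ MemL2 Ω v ∧ IsConjugate Ω ρ u v)
    {C : ℝ≥0} (hC : BabuskaAzizDiv Ω C) : FriedrichsVelteFor Ω CH C := by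
  intro u v huv hu0
  obtain ⟨hu, hv, hc⟩ := hCH u v huv
  have hu' : MemLp u 2 (volume.restrict Ω) := hu
  have hv' : MemLp v 2 (volume.restrict Ω) := hv
  obtain ⟨w, G, hwG, hdiv, hle⟩ := hC u hu hu0
  have hk := hwG.toJac_mem
  have hD : compJac Ω (divLin n) hwG.toJac = hu'.toLp u := by
    refine Lp.ext ?_
    filter_upwards [compJac_toLp (divLin n) hwG.memLp, hdiv, hu'.coeFn_toLp] with x h1 h2 h3
    rw [h3, ← h2]
    exact h1
  rw [sqSeminorm_eq hwG.memLp, sqNorm_eq_ofReal hu', ofReal_sq_le_iff] at hle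
  rw [sqNorm_eq_ofReal hu', sqNorm_eq_ofReal hv', ofReal_sq_le_iff]
  have h1 := hc.inner_jac hu' hv' hk
  rw [hD, real_inner_self_eq_norm_sq] at h1
  -- The factor `√1` fits `sq_le_of_right_inverse` with its first constant equal to `1`.
  have h2 : ‖hu'.toLp u‖ ^ 2 ≤ ‖hv'.toLp v‖ * (√1 * ‖hwG.toJac‖) := by
    rw [Real.sqrt_one, one_mul]
    calc ‖hu'.toLp u‖ ^ 2 ≤ |inner ℝ (hv'.toLp v) (compJac Ω ρ hwG.toJac)| := by
          rw [h1, abs_neg]; exact le_abs_self _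
      _ ≤ ‖hv'.toLp v‖ * ‖compJac Ω ρ hwG.toJac‖ := abs_real_inner_le_norm _ _
      _ ≤ _ := by gcongr; exact norm_compJac_rot_le hρ hk
  simpa using sq_le_of_right_inverse zero_le_one C.coe_nonneg h2 hle

theorem DivRightInverse.improvedPoincare [Nontrivial (Vec n)] (h : IsBoundedDomain Ω)
    {H C : ℝ≥0} (hH : Hardy Ω H) (hC : DivRightInverse Ω C) : ImprovedPoincare Ω (H * C) := by
  intro u g hug hdg
  have hu : MemL2 Ω u := hug.memL2_of_improvedPoincare h
    (fun u g hug hdg hu => hH.improvedPoincare_of_memL2 h hC hug hdg hu) hdg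
  exact ⟨hu, hH.improvedPoincare_of_memL2 h hC hug hdg hu⟩

/-- `‖u‖² ≤ P ‖d ∇u‖² ≤ 4P ‖v‖²`, the last step being the interior estimate. -/
theorem ImprovedPoincare.friedrichsVelteFor [Nontrivial (Vec n)] (h : IsBoundedDomain Ω)
    (hρ : IsRotSymbol ρ) (hCH : ∀ u v, CH u v → MemL2 Ω u ∧ MemL2 Ω v ∧ IsConjugate Ω ρ u v)
    {P : ℝ≥0} (hP : ImprovedPoincare Ω P) : FriedrichsVelteFor Ω CH (4 * P) := by
  intro u v huv hu0
  obtain ⟨hu, hv, hc⟩ := hCH u v huv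
  have hv' : MemLp v 2 (volume.restrict Ω) := hv
  obtain ⟨g, hug, hdg, hle⟩ :=
    (interiorGradientBound_conj h hρ hu hv' hc).exists_hasWeakGradient h hu (norm_nonneg _)
  have h1 := (hP u g hug hdg).2
  rw [hu0] at h1
  simp only [sub_zero] at h1
  rw [← sqNorm_eq_ofReal hv'] at hle
  refine h1.trans ((mul_le_mul_right hle _).trans (le_of_eq ?_))
  push_cast
  ring

end DivEquivalence

/-! ### Best constants -/

section BestConst

variable {n : ℕ} {Ω : Set (Vec n)}

theorem bestConst_le {I : Set (Vec n) → ℝ≥0 → Prop} {C : ℝ≥0} (hC : 0 < C) (h : I Ω C) :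
    bestConst I Ω ≤ C := iInf₂_le C ⟨hC, h⟩

theorem le_bestConst {I : Set (Vec n) → ℝ≥0 → Prop} {a : ℝ≥0∞}
    (h : ∀ C : ℝ≥0, 0 < C → I Ω C → a ≤ C) : a ≤ bestConst I Ω :=
  le_iInf₂ fun C hC => h C hC.1 hC.2

theorem bestConst_div_four_le {I J : Set (Vec n) → ℝ≥0 → Prop}
    (h : ∀ C, J Ω C → I Ω (4 * C)) : bestConst I Ω / 4 ≤ bestConst J Ω := by
  refine le_bestConst fun C hC hJ => ?_
  refine ENNReal.div_le_of_le_mul ?_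
  have := bestConst_le (by positivity) (h C hJ)
  rwa [mul_comm, ENNReal.coe_mul] at this

/-- Excludes the product `0 · ∞ = 0` on the right of the upper bound when no Friedrichs–Velte
constant exists. A single bump field gives a positive lower bound for every Hardy constant. -/
theorem bestConst_hardy_ne_zero [Nontrivial (Vec n)] (h : IsBoundedDomain Ω)
    (hS : Supports Hardy Ω) : bestConst Hardy Ω ≠ 0 := by
  obtain ⟨x₀, hx₀⟩ := h.isConnected.nonempty
  obtain ⟨r, hr, hrΩ⟩ := Metric.nhds_basis_closedBall.mem_iff.1 (h.isOpen.mem_nhds hx₀)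
  let φ : ContDiffBump x₀ := ⟨r / 2, r, by positivity, by linarith⟩
  have hφ : IsTestFun Ω φ := ⟨φ.contDiff, φ.hasCompactSupport, by
    rw [φ.tsupport_eq]; exact hrΩ⟩
  obtain ⟨e, he⟩ := exists_ne (0 : Vec n)
  have hψ : IsTestFun Ω (fun x => φ x • e) :=
    hφ.of_support_subset (hφ.1.smul contDiff_const) fun x hx => by simp [hx]
  let ψ : testFields Ω := ⟨_, hψ⟩
  have hpos : 0 < ‖weightedVal h ψ‖ := by
    rw [norm_weightedVal, Real.sqrt_pos]
    refine Continuous.integral_pos_of_hasCompactSupport_nonneg_nonzero (x := x₀)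
      ((hψ.inv_bdryDist_smul_continuous h).norm.pow 2) ?_ (fun x => by positivity) ?_
    · refine hψ.2.1.of_isClosed_subset (isClosed_tsupport _) (closure_mono fun x hx h0 => hx ?_)
      have h0' : φ x • e = 0 := h0
      change ‖(bdryDist Ω x)⁻¹ • φ x • e‖ ^ 2 = 0
      simp [h0']
    · have h1 : φ x₀ = 1 := φ.one_of_mem_closedBall (Metric.mem_closedBall_self φ.rIn_pos.le)
      have h2 := (h.bdryDist_pos hx₀).ne'
      change ‖(bdryDist Ω x₀)⁻¹ • φ x₀ • e‖ ^ 2 ≠ 0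
      simp [h1, h2, he]
  have hjac : 0 < ‖jacMap Ω ψ‖ := by
    obtain ⟨H, -, hH⟩ := hS
    have h1 := hH.norm_le h ψ
    by_contra h2
    have h3 : ‖jacMap Ω ψ‖ = 0 := le_antisymm (not_lt.1 h2) (norm_nonneg _)
    rw [h3, mul_zero] at h1
    exact absurd hpos (not_lt.2 h1)
  have hle : ENNReal.ofReal (‖weightedVal h ψ‖ ^ 2 / ‖jacMap Ω ψ‖ ^ 2) ≤ bestConst Hardy Ω := by
    refine le_bestConst fun H _ hH => ?_
    rw [← ENNReal.ofReal_coe_nnreal]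
    refine ENNReal.ofReal_le_ofReal ?_
    rw [div_le_iff₀ (by positivity)]
    have h1 := pow_le_pow_left₀ (norm_nonneg _) (hH.norm_le h ψ) 2
    rwa [mul_pow, Real.sq_sqrt H.coe_nonneg] at h1
  refine (lt_of_lt_of_le ?_ hle).ne'
  rw [ENNReal.ofReal_pos]
  positivity

/-- The infima over `Γ` and `H` are taken one after the other, each isolated by division and
subtraction in `[0, ∞]`. -/
theorem bestConst_le_hardy_mul {I J : Set (Vec n) → ℝ≥0 → Prop} (hS : Supports Hardy Ω)
    (h0 : bestConst Hardy Ω ≠ 0)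
    (h : ∀ H Γ, Hardy Ω H → I Ω Γ → J Ω (H * (1 + Γ))) :
    bestConst J Ω ≤ bestConst Hardy Ω * (1 + bestConst I Ω) := by
  have htop : bestConst Hardy Ω ≠ ⊤ := by
    obtain ⟨H, hH, hH'⟩ := hS
    exact ne_top_of_le_ne_top ENNReal.coe_ne_top (bestConst_le hH hH')
  rw [← ENNReal.div_le_iff' h0 htop, ← tsub_le_iff_left]
  refine le_bestConst fun Γ _ hI => ?_
  rw [tsub_le_iff_left, ENNReal.div_le_iff' h0 htop,
    ← ENNReal.div_le_iff (by simp) (by simp)]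
  refine le_bestConst fun H hH hHardy => ?_
  rw [ENNReal.div_le_iff (by simp) (by simp)]
  have := bestConst_le (by positivity) (h H Γ hHardy hI)
  simpa using this

end BestConst

/-! ### The divergence half of the theorem, uniformly in the dimension -/

section DivSummary

variable {n : ℕ} [Nontrivial (Vec n)] {Ω : Set (Vec n)} {F : Type} [NormedAddCommGroup F]
  [InnerProductSpace ℝ F]

/-- The equivalences and the bounds of the constants, for any class of conjugate pairs between
the complement of the range of `(div, ρ)` and all conjugate pairs. -/
theorem div_equivalences {ρ : (Fin n → Vec n) →ₗ[ℝ] F}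
    {CH : (Vec n → ℝ) → (Vec n → F) → Prop} {FV : Set (Vec n) → ℝ≥0 → Prop}
    (h : IsBoundedDomain Ω) (hS : Supports Hardy Ω) (hρ : IsRotSymbol ρ)
    (hFV : ∀ Γ, FV Ω Γ ↔ FriedrichsVelteFor Ω CH Γ)
    (hCH₁ : ∀ u v, CH u v → MemL2 Ω u ∧ MemL2 Ω v ∧ IsConjugate Ω ρ u v)
    (hCH₂ : ∀ (u : L2 Ω ℝ) (g : JacSpace Ω), g ∈ jacClosure Ω →
      IsConjugate Ω ρ u (compJac Ω ρ g) → CH u (compJac Ω ρ g)) :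
    (Supports FV Ω ↔ Supports BabuskaAzizDiv Ω) ∧
      (Supports FV Ω ↔ Supports ImprovedPoincare Ω) ∧
      bestConst FV Ω / 4 ≤ bestConst ImprovedPoincare Ω ∧
      bestConst ImprovedPoincare Ω ≤ bestConst Hardy Ω * (1 + bestConst FV Ω) := by
  have hinv (Γ : ℝ≥0) (hΓ : FV Ω Γ) : DivRightInverse Ω (1 + Γ) :=
    ((hFV Γ).1 hΓ).divRightInverse h hρ hCH₂
  obtain ⟨H, hH, hHardy⟩ := id hS
  refine ⟨⟨?_, ?_⟩, ⟨?_, ?_⟩, ?_, ?_⟩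
  · rintro ⟨Γ, hΓ, hΓ'⟩
    exact ⟨1 + Γ, by positivity, (hinv Γ hΓ').babuskaAzizDiv h hHardy⟩
  · rintro ⟨C, hC, hC'⟩
    exact ⟨C, hC, (hFV C).2 (hC'.friedrichsVelteFor hρ hCH₁)⟩
  · rintro ⟨Γ, hΓ, hΓ'⟩
    exact ⟨H * (1 + Γ), by positivity, (hinv Γ hΓ').improvedPoincare h hHardy⟩
  · rintro ⟨P, hP, hP'⟩
    exact ⟨4 * P, by positivity, (hFV _).2 (hP'.friedrichsVelteFor h hρ hCH₁)⟩
  · exact bestConst_div_four_le fun P hP => (hFV _).2 (hP.friedrichsVelteFor h hρ hCH₁)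
  · exact bestConst_le_hardy_mul hS (bestConst_hardy_ne_zero h hS) fun H Γ hH hΓ =>
      (hinv Γ hΓ).improvedPoincare h hH

end DivSummary

/-! ### Planar conjugate harmonic functions -/

section Planar

variable {Ω : Set (Vec 2)}

theorem jac_smul_single {n : ℕ} {φ : Vec n → ℝ} (i j : Fin n) (x : Vec n) :
    jac (fun y => φ y • EuclideanSpace.single i (1 : ℝ)) x j =
      if j = i then gradient φ x else 0 := by
  by_cases hj : j = i
  · subst hj
    simp [jac]
  · simp [jac, hj, gradient_fun_const]

theorem integrableOn_memL2_mul_test {n : ℕ} {Ω : Set (Vec n)} (h : IsBoundedDomain Ω)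
    {u φ : Vec n → ℝ} (hu : MemLp u 2 (volume.restrict Ω)) (hφ : IsTestFun Ω φ) :
    Integrable (fun x => u x * φ x) (volume.restrict Ω) := by
  simpa [mul_comm, IntegrableOn] using hφ.integrableOn_smul (MemLp.locallyIntegrableOn h hu)

/-- The two Cauchy–Riemann equations are the conjugacy equation tested with `φ e₀` and `φ e₁`, and
every test field is a sum of such fields. -/
theorem isConjHarmonic2_iff (h : IsBoundedDomain Ω) {u v : Vec 2 → ℝ} :
    IsConjHarmonic2 Ω u v ↔ MemL2 Ω u ∧ MemL2 Ω v ∧ IsConjugate Ω rotLin₂ u v := by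
  refine and_congr_right fun hu => and_congr_right fun hv => ?_
  have hiu {φ : Vec 2 → ℝ} (hφ : IsTestFun Ω φ) := integrableOn_memL2_mul_test h hu hφ
  have hiv {φ : Vec 2 → ℝ} (hφ : IsTestFun Ω φ) := integrableOn_memL2_mul_test h hv hφ
  have hcoord {φ : Vec 2 → ℝ} (hφ : IsTestFun Ω φ) :
      (∫ x in Ω, u x • gradient φ x = ∫ x in Ω, v x • perp (gradient φ x)) ↔
        (∫ x in Ω, u x * gradient φ x 0 = ∫ x in Ω, v x * gradient φ x 1) ∧
        ∫ x in Ω, u x * gradient φ x 1 = -∫ x in Ω, v x * gradient φ x 0 := by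
    have i1 : IntegrableOn (fun x => u x • gradient φ x) Ω :=
      Integrable.of_eval_piLp fun i => by simpa using hiu (hφ.grad.coord i)
    have i2 : IntegrableOn (fun x => v x • perp (gradient φ x)) Ω := by
      refine Integrable.of_eval_piLp fun i => ?_
      fin_cases i
      · simpa [perp] using hiv (hφ.grad.coord 1)
      · simpa [perp] using (hiv (hφ.grad.coord 0)).neg
    have e0 : (∫ x in Ω, v x • perp (gradient φ x)) 0 = ∫ x in Ω, v x * gradient φ x 1 := by
      rw [setIntegral_coord i2]; simp [perp]
    have e1 : (∫ x in Ω, v x • perp (gradient φ x)) 1 = -∫ x in Ω, v x * gradient φ x 0 := by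
      rw [setIntegral_coord i2, ← integral_neg]; simp [perp]
    have f (i : Fin 2) : (∫ x in Ω, u x • gradient φ x) i = ∫ x in Ω, u x * gradient φ x i := by
      rw [setIntegral_coord i1]; simp
    constructor
    · intro he
      rw [← e0, ← e1, ← f, ← f, he]
      exact ⟨rfl, rfl⟩
    · rintro ⟨h0, h1⟩
      ext i
      fin_cases i
      · exact (f 0).trans (h0.trans e0.symm)
      · exact (f 1).trans (h1.trans e1.symm)
  constructor
  · intro hc ψ hψ
    have h0 := ((hcoord (hψ.coord 0)).1 (hc _ (hψ.coord 0))).1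
    have h1 := ((hcoord (hψ.coord 1)).1 (hc _ (hψ.coord 1))).2
    have e1 : ∫ x in Ω, u x * divField ψ x =
        (∫ x in Ω, u x * gradient (fun y => ψ y 0) x 0) +
          ∫ x in Ω, u x * gradient (fun y => ψ y 1) x 1 := by
      rw [← integral_add (hiu ((hψ.coord 0).grad.coord 0)) (hiu ((hψ.coord 1).grad.coord 1))]
      simp [divField, divOf, mul_add]
    have e2 : ∫ x in Ω, inner ℝ (v x) (rotLin₂ (jac ψ x)) =
        (∫ x in Ω, v x * gradient (fun y => ψ y 1) x 0) -
          ∫ x in Ω, v x * gradient (fun y => ψ y 0) x 1 := by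
      rw [← integral_sub (hiv ((hψ.coord 1).grad.coord 0)) (hiv ((hψ.coord 0).grad.coord 1))]
      refine integral_congr_ae (.of_forall fun x => ?_)
      simp [rotLin₂, jac]
      ring
    rw [e1, e2, h0, h1]
    ring
  · intro hc φ hφ
    refine (hcoord hφ).2 ⟨?_, ?_⟩
    · have h0 := hc _ (hφ.smul_single 0)
      simp only [divField_smul_single] at h0
      rw [← neg_eq_iff_eq_neg.2 h0, ← integral_neg]
      simp [rotLin₂, jac_smul_single, mul_comm]
    · have h1 := hc _ (hφ.smul_single 1)
      simp only [divField_smul_single] at h1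
      rw [← neg_eq_iff_eq_neg.2 h1]
      simp [rotLin₂, jac_smul_single, mul_comm]

end Planar

/-! ### Spatial conjugate harmonic functions -/

section Spatial

variable {Ω : Set (Vec 3)}

/-- Both sides equal `-∫ ψⱼ ∂ᵢ∂ₖφ`. -/
theorem integral_jac_mul_gradient_comm {n : ℕ} {Ω : Set (Vec n)} {ψ : Vec n → Vec n}
    {φ : Vec n → ℝ} (hψ : IsTestFun Ω ψ) (hφ : IsTestFun Ω φ) (i j k : Fin n) :
    ∫ x, jac ψ x j i * gradient φ x k = ∫ x, jac ψ x j k * gradient φ x i := by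
  have h1 (i k : Fin n) : ∫ x, jac ψ x j i * gradient φ x k =
      -∫ x, gradient (fun y => gradient φ y k) x i * ψ x j := by
    rw [← integral_mul_gradient (hφ.grad.coord k).1 (hψ.coord j).1 (hψ.coord j).2.1 i]
    simp only [jac, mul_comm]
  rw [h1, h1]
  congr 2
  ext x
  rw [gradient_gradient_comm hφ.1]

/-- The weak form of `div rot = 0`: the six terms cancel in pairs. -/
theorem integral_rot_inner_gradient {ψ : Vec 3 → Vec 3} {φ : Vec 3 → ℝ} (hψ : IsTestFun Ω ψ)
    (hφ : IsTestFun Ω φ) : ∫ x in Ω, inner ℝ (rotLin₃ (jac ψ x)) (gradient φ x) = 0 := by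
  rw [setIntegral_eq_integral_of_forall_compl_eq_zero fun x hx => by simp [hφ.grad.eq_zero hx]]
  have hi (i j k : Fin 3) : Integrable (fun x => jac ψ x j i * gradient φ x k) :=
    (((hψ.jac j).coord i).continuous.mul (hφ.grad.coord k).continuous)
      |>.integrable_of_hasCompactSupport (hφ.grad.coord k).2.1.mul_left
  have h1 (x : Vec 3) : inner ℝ (rotLin₃ (jac ψ x)) (gradient φ x) =
      (jac ψ x 2 1 * gradient φ x 0 - jac ψ x 1 2 * gradient φ x 0) +
      ((jac ψ x 0 2 * gradient φ x 1 - jac ψ x 2 0 * gradient φ x 1) +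
      (jac ψ x 1 0 * gradient φ x 2 - jac ψ x 0 1 * gradient φ x 2)) := by
    rw [PiLp.inner_apply, Fin.sum_univ_three]
    have e : rotLin₃ (jac ψ x) = rotOf (jac ψ x) := rfl
    simp only [e, RCLike.inner_apply, conj_trivial]
    simp [rotOf]
    ring
  simp only [h1]
  have s1 : Integrable fun x => jac ψ x 2 1 * gradient φ x 0 - jac ψ x 1 2 * gradient φ x 0 :=
    (hi 1 2 0).sub (hi 2 1 0)
  have s2 : Integrable fun x => jac ψ x 0 2 * gradient φ x 1 - jac ψ x 2 0 * gradient φ x 1 :=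
    (hi 2 0 1).sub (hi 0 2 1)
  have s3 : Integrable fun x => jac ψ x 1 0 * gradient φ x 2 - jac ψ x 0 1 * gradient φ x 2 :=
    (hi 0 1 2).sub (hi 1 0 2)
  have s4 : Integrable fun x =>
      (jac ψ x 0 2 * gradient φ x 1 - jac ψ x 2 0 * gradient φ x 1) +
      (jac ψ x 1 0 * gradient φ x 2 - jac ψ x 0 1 * gradient φ x 2) := s2.add s3
  rw [integral_add s1 s4, integral_add s2 s3, integral_sub (hi 1 2 0) (hi 2 1 0),
      integral_sub (hi 2 0 1) (hi 0 2 1), integral_sub (hi 0 1 2) (hi 1 0 2),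
      integral_jac_mul_gradient_comm hψ hφ 1 2 0, integral_jac_mul_gradient_comm hψ hφ 2 1 0,
      integral_jac_mul_gradient_comm hψ hφ 2 0 1]
  ring

theorem rotClosure_induction {p : L2 Ω (Vec 3) → Prop} (hp : IsClosed {v | p v})
    (h : ∀ ψ : testFields Ω, p (compJac Ω rotLin₃ (jacMap Ω ψ))) {v : L2 Ω (Vec 3)}
    (hv : v ∈ rotClosure Ω rotLin₃) : p v := by
  have : (rotClosure Ω rotLin₃ : Set (L2 Ω (Vec 3))) ⊆ {v | p v} := by
    refine closure_minimal ?_ hp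
    rintro _ ⟨ψ, rfl⟩
    exact h ψ
  exact this hv

/-- Fields in the closure of the rotations are solenoidal. -/
theorem integral_inner_gradient_of_mem_rotClosure {v : L2 Ω (Vec 3)}
    (hv : v ∈ rotClosure Ω rotLin₃) {φ : Vec 3 → ℝ} (hφ : IsTestFun Ω φ) :
    ∫ x in Ω, inner ℝ (v x) (gradient φ x) = 0 := by
  have h1 : inner ℝ v (MemLp.toLp _ (hφ.grad.memLp 2)) = 0 := by
    refine rotClosure_induction (p := fun v => inner ℝ v (MemLp.toLp _ (hφ.grad.memLp 2)) = 0)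
      (isClosed_eq (by fun_prop) continuous_const) (fun ψ => ?_) hv
    rw [compJac_jacMap, inner_toLp]
    exact integral_rot_inner_gradient (isTest_coe ψ) hφ
  have h2 := inner_toLp (Lp.memLp v) (hφ.grad.memLp 2)
  rw [Lp.toLp_coeFn, h1] at h2
  exact h2.symm

theorem IsConjHarmonic3.isConjugate {u : Vec 3 → ℝ} {v : Vec 3 → Vec 3}
    (h : IsConjHarmonic3 Ω u v) : IsConjugate Ω rotLin₃ u v := h.2.2.1

theorem isConjHarmonic3_of_mem_rotClosure {u : L2 Ω ℝ} {v : L2 Ω (Vec 3)}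
    (hv : v ∈ rotClosure Ω rotLin₃) (hc : IsConjugate Ω rotLin₃ u v) : IsConjHarmonic3 Ω u v :=
  ⟨Lp.memLp u, Lp.memLp v, hc, fun _ hφ => integral_inner_gradient_of_mem_rotClosure hv hφ⟩

theorem rotLin₃_gradient {φ : Vec 3 → ℝ} (hφ : ContDiff ℝ ∞ φ) (x : Vec 3) :
    rotLin₃ (jac (gradient φ) x) = 0 :=
  isRotSymbol_rotLin₃.eq_zero_of_symm fun i j => gradient_gradient_comm hφ x j i

/-- The orthogonal complement of the kernel of the weak rotation is the closure of the rotations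
of test fields. -/
theorem orthKerRotL2_iff (h : IsBoundedDomain Ω) {v : Vec 3 → Vec 3}
    (hv : MemLp v 2 (volume.restrict Ω)) :
    OrthKerRotL2 Ω v ↔ hv.toLp v ∈ rotClosure Ω rotLin₃ := by
  constructor
  · intro ho
    -- The kernel of the weak rotation is the orthogonal complement of the rotations of test fields,
    -- so its own complement is their closure.
    rw [rotClosure, ← Submodule.orthogonal_orthogonal_eq_closure, Submodule.mem_orthogonal']
    intro k hk
    have h1 := inner_toLp hv (Lp.memLp k)
    rw [Lp.toLp_coeFn] at h1
    rw [h1]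
    refine ho.2 k (Lp.memLp k) ⟨MemLp.locallyIntegrableOn h (Lp.memLp k),
      locallyIntegrableOn_zero, fun ψ hψ => ?_⟩
    have h2 : inner ℝ k (compJac Ω rotLin₃ (jacMap Ω ⟨ψ, hψ⟩)) = 0 := by
      rw [real_inner_comm]
      exact hk _ ⟨⟨ψ, hψ⟩, rfl⟩
    have h3 := inner_toLp_compJac (Lp.memLp k) rotLin₃ ⟨ψ, hψ⟩
    rw [Lp.toLp_coeFn, h2] at h3
    have h4 : ∫ x in Ω, inner ℝ (k x) (rotField ψ x) = 0 := h3.symm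
    rw [h4]
    simp
  · intro hm
    refine ⟨hv, fun k hk hrot => ?_⟩
    have hk' : MemLp k 2 (volume.restrict Ω) := hk
    rw [← inner_toLp hv hk', real_inner_comm]
    refine rotClosure_induction (p := fun v => inner ℝ (hk'.toLp k) v = 0)
      (isClosed_eq (by fun_prop) continuous_const) (fun ψ => ?_) hm
    rw [inner_toLp_compJac]
    have := hrot.2.2 ψ.1 (isTest_coe ψ)
    simp only [inner_zero_left, integral_zero] at this
    exact this

/-- `C` is the square of a bound for a right inverse of the rotation. -/
def RotRightInverse (Ω : Set (Vec 3)) (C : ℝ≥0) : Prop :=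
  ∀ v ∈ rotClosure Ω rotLin₃,
    ∃ g ∈ jacClosure Ω, compJac Ω rotLin₃ g = v ∧ ‖g‖ ^ 2 ≤ C * ‖v‖ ^ 2

/-- The pairs to be estimated are `(div (-g), v)` with `v` in the closure of the rotations; such `v`
is solenoidal and orthogonal to the kernel of `rot`. -/
theorem FriedrichsVelteRot.rotRightInverse (h : IsBoundedDomain Ω) {Γ : ℝ≥0}
    (hFV : FriedrichsVelteRot Ω Γ) : RotRightInverse Ω (1 + Γ) := by
  intro v hv
  refine exists_jac_rot_eq isRotSymbol_rotLin₃ Γ.coe_nonneg (fun v g hg hv huv => ?_) hv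
  have hc : IsConjugate Ω rotLin₃ (compJac Ω (divLin 3) (-g)) v := by
    refine isConjugate_of_inner fun ψ => ?_
    rw [huv, map_neg, inner_neg_left, neg_neg]
  have ho : OrthKerRotL2 Ω v := by
    rw [orthKerRotL2_iff h (Lp.memLp v), Lp.toLp_coeFn]
    exact hv
  have h1 := hFV _ _ (isConjHarmonic3_of_mem_rotClosure hv hc) ho
  rw [sqNorm_lp, sqNorm_lp, ofReal_sq_le_iff, map_neg, norm_neg] at h1
  exact h1

theorem HasH10Jacobian.sqNorm_rot {v : Vec 3 → Vec 3} {G : Fin 3 → Vec 3 → Vec 3}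
    (h : HasH10Jacobian Ω v G) : sqNorm Ω (fun x => rotOf (fun j => G j x)) =
      ENNReal.ofReal (‖compJac Ω rotLin₃ h.toJac‖ ^ 2) := by
  rw [← sqNorm_lp]
  refine sqNorm_congr ?_
  filter_upwards [compJac_toLp rotLin₃ h.memLp] with x hx
  exact congrArg norm hx.symm

theorem HasH10Jacobian.inner_toJac {v w : Vec 3 → Vec 3} {G K : Fin 3 → Vec 3 → Vec 3}
    (h : HasH10Jacobian Ω v G) (h' : HasH10Jacobian Ω w K) :
    inner ℝ h.toJac h'.toJac = ∑ j, ∫ x in Ω, inner ℝ (G j x) (K j x) := by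
  rw [PiLp.inner_apply]
  exact Finset.sum_congr rfl fun j _ => inner_toLp (h.memLp j) (h'.memLp j)

theorem HasH10Jacobian.toJac_coe {v : Vec 3 → Vec 3} {g : JacSpace Ω}
    (h : HasH10Jacobian Ω v (fun j => g j)) : h.toJac = g := by
  ext1 j
  exact Lp.toLp_coeFn (g j) (h.memLp j)

/-- Orthogonality to the kernel makes `v` the field of least seminorm with its rotation, so it is no
larger than the preimage `g`. Hardy realizes the difference as an `H₀¹` field, against which
orthogonality can be tested. -/
theorem RotRightInverse.babuskaAzizRot (h : IsBoundedDomain Ω) {H C : ℝ≥0} (hH : Hardy Ω H)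
    (hC : RotRightInverse Ω C) : BabuskaAzizRot Ω C := by
  rintro v G ⟨hv, horth⟩
  have hk := hv.toJac_mem
  obtain ⟨g, hg, hgv, hle⟩ := hC _ (compJac_mem_rotClosure rotLin₃ hk)
  have hd : g - hv.toJac ∈ jacClosure Ω := sub_mem hg hk
  obtain ⟨w, hw⟩ := hH.exists_hasH10Jacobian h hd
  have hrot : ∀ᵐ x ∂volume.restrict Ω, rotOf (fun j => (g - hv.toJac) j x) = 0 := by
    have h1 : compJac Ω rotLin₃ (g - hv.toJac) = 0 := by rw [map_sub, hgv, sub_self]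
    have h2 := coeFn_compJac rotLin₃ (g - hv.toJac)
    rw [h1] at h2
    filter_upwards [h2, Lp.coeFn_zero (Vec 3) 2 (volume.restrict Ω)] with x hx hx0
    rw [hx0] at hx
    exact hx.symm
  have h3 := horth w _ hw hrot
  rw [← hv.inner_toJac hw, hw.toJac_coe, inner_sub_right, real_inner_self_eq_norm_sq] at h3
  have h4 : ‖hv.toJac‖ ^ 2 ≤ ‖g‖ ^ 2 := by
    have h5 := real_inner_le_norm hv.toJac g
    nlinarith [sq_nonneg (‖hv.toJac‖ - ‖g‖)]
  rw [hv.sqNorm_rot, sqSeminorm_eq hv.memLp, ofReal_sq_le_iff]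
  exact h4.trans hle

/-- A rotation keeps its value when the Jacobian is projected off the kernel, so `⟨v, rot b⟩ = -⟨u,
div b⟩ ≤ ‖u‖ √C ‖rot b‖`. This extends to the closure of the rotations, in particular to `v` itself,
which need not be a rotation. -/
theorem BabuskaAzizRot.friedrichsVelteRot (h : IsBoundedDomain Ω) {H C : ℝ≥0} (hH : Hardy Ω H)
    (hC : BabuskaAzizRot Ω C) : FriedrichsVelteRot Ω C := by
  intro u v huv ho
  have hu : MemLp u 2 (volume.restrict Ω) := huv.1
  have hv : MemLp v 2 (volume.restrict Ω) := huv.2.1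
  rw [orthKerRotL2_iff h hv] at ho
  let N : Submodule ℝ (JacSpace Ω) := jacClosure Ω ⊓ LinearMap.ker (compJac Ω rotLin₃).toLinearMap
  have hNc : IsClosed (N : Set (JacSpace Ω)) :=
    (isClosed_jacClosure Ω).inter (compJac Ω rotLin₃).isClosed_ker
  have : CompleteSpace N := hNc.completeSpace_coe
  have key : |inner ℝ (hv.toLp v) (hv.toLp v)| ≤ ‖hu.toLp u‖ * (√C * ‖hv.toLp v‖) := by
    refine rotClosure_induction
      (p := fun y => |inner ℝ (hv.toLp v) y| ≤ ‖hu.toLp u‖ * (√C * ‖y‖))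
      (isClosed_le (by fun_prop) (by fun_prop)) (fun ψ => ?_) ho
    set g := jacMap Ω ψ
    set b := g - N.starProjection g with hb
    have hPN : N.starProjection g ∈ N := N.starProjection_apply_mem g
    have hbmem : b ∈ jacClosure Ω := sub_mem (jacMap_mem ψ) hPN.1
    have hSb : compJac Ω rotLin₃ b = compJac Ω rotLin₃ g := by
      have : compJac Ω rotLin₃ (N.starProjection g) = 0 := hPN.2
      rw [hb, map_sub, this, sub_zero]
    obtain ⟨w, hw⟩ := hH.exists_hasH10Jacobian h hbmem
    have horth : OrthKerRotH10 Ω w (fun j => b j) := by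
      refine ⟨hw, fun k K hk hrot => ?_⟩
      rw [← hw.inner_toJac hk, hw.toJac_coe]
      have hkN : hk.toJac ∈ N := by
        refine ⟨hk.toJac_mem, ?_⟩
        change compJac Ω rotLin₃ hk.toJac = 0
        refine Lp.ext ?_
        filter_upwards [compJac_toLp rotLin₃ hk.memLp, hrot,
          Lp.coeFn_zero (Vec 3) 2 (volume.restrict Ω)] with x h1 h2 h3
        rw [h3]
        exact h1.trans h2
      exact N.inner_left_of_mem_orthogonal hkN (N.sub_starProjection_mem_orthogonal g)
    have h1 := hC w _ horth
    rw [sqSeminorm_coe, hw.sqNorm_rot, hw.toJac_coe, ofReal_sq_le_iff] at h1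
    have h2 : ‖b‖ ≤ √C * ‖compJac Ω rotLin₃ b‖ := by
      refine le_of_sq_le_sq ?_ (by positivity)
      rwa [mul_pow, Real.sq_sqrt C.coe_nonneg]
    rw [← hSb, huv.isConjugate.inner_jac hu hv hbmem, abs_neg]
    calc _ ≤ ‖hu.toLp u‖ * ‖compJac Ω (divLin 3) b‖ := abs_real_inner_le_norm _ _
      _ ≤ ‖hu.toLp u‖ * ‖b‖ := by
          gcongr
          exact norm_compJac_div_le isRotSymbol_rotLin₃ hbmem
      _ ≤ _ := by gcongr
  rw [real_inner_self_eq_norm_sq, abs_of_nonneg (by positivity)] at key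
  rw [sqNorm_eq_ofReal hu, sqNorm_eq_ofReal hv, ofReal_sq_le_iff]
  -- Here `C` takes the place of the Hardy constant, and the preimage is `v` itself, with constant
  -- `1`.
  simpa using sq_le_of_right_inverse C.coe_nonneg zero_le_one key (by simp)

/-- With `rot k = v`, `‖v‖² = ⟨v, rot k⟩` is a limit of pairings `⟨d rot v, ψ / d⟩`. No truncation
is needed, since `v` is in `L₂` by hypothesis. -/
theorem RotRightInverse.improvedPoincareRot (h : IsBoundedDomain Ω) {H C : ℝ≥0} (hH : Hardy Ω H)
    (hC : RotRightInverse Ω C) : ImprovedPoincareRot Ω (H * C) := by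
  intro v r ho hvr hdr
  have hv : MemLp v 2 (volume.restrict Ω) := ho.1
  have hdr' : MemLp (fun x => bdryDist Ω x • r x) 2 (volume.restrict Ω) := hdr
  obtain ⟨k, hk, hkv, hle⟩ := hC _ ((orthKerRotL2_iff h hv).1 ho)
  have key : ‖hv.toLp v‖ ^ 2 ≤ ‖hdr'.toLp _‖ * (√H * ‖k‖) := by
    have h1 : ‖hv.toLp v‖ ^ 2 = inner ℝ (hv.toLp v) (compJac Ω rotLin₃ k) := by
      rw [hkv, real_inner_self_eq_norm_sq]
    rw [h1]
    refine (le_abs_self _).trans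
      (hH.abs_inner_le h rotLin₃ _ (norm_nonneg _) (fun ψ => ?_) hk)
    have h2 := hvr.2.2 ψ.1 (isTest_coe ψ)
    rw [integral_inner_eq_weighted h hdr'] at h2
    have h3 : inner ℝ (hv.toLp v) (compJac Ω rotLin₃ (jacMap Ω ψ)) =
        inner ℝ (hdr'.toLp _) (weightedVal h ψ) := (inner_toLp_compJac hv rotLin₃ ψ).trans h2
    rw [h3]
    exact abs_real_inner_le_norm _ _
  rw [sqNorm_eq_ofReal hv, sqNorm_eq_ofReal hdr', ofReal_sq_le_iff]
  exact sq_le_of_right_inverse H.coe_nonneg C.coe_nonneg key hle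

/-- Testing conjugacy with gradients shows that `u` is harmonic, since `rot ∇φ = 0`. As `rot v =
∇u`, one gets `‖v‖² ≤ P ‖d ∇u‖² ≤ 4P ‖u‖²`. -/
theorem ImprovedPoincareRot.friedrichsVelteRot (h : IsBoundedDomain Ω) {P : ℝ≥0}
    (hP : ImprovedPoincareRot Ω P) : FriedrichsVelteRot Ω (4 * P) := by
  intro u v huv ho
  have hu : MemLp u 2 (volume.restrict Ω) := huv.1
  have hharm (φ : Vec 3 → ℝ) (hφ : IsTestFun Ω φ) :
      ∫ x in Ω, u x * divField (gradient φ) x = 0 := by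
    have h1 := huv.isConjugate _ hφ.grad
    simp only [rotLin₃_gradient hφ.1, inner_zero_right, integral_zero] at h1
    linarith
  obtain ⟨g, hug, hdg, hle⟩ :=
    (interiorGradientBound_harmonic h hu hharm).exists_hasWeakGradient h hu (norm_nonneg _)
  have hrot : HasWeakRot Ω v g := by
    refine ⟨MemLp.locallyIntegrableOn h huv.2.1, hug.2.1, fun ψ hψ => ?_⟩
    rw [huv.2.2.1 ψ hψ, hug.integral_mul_div hψ, neg_neg]
  have h1 := hP v g ho hrot hdg
  rw [← sqNorm_eq_ofReal hu] at hle
  refine h1.trans ((mul_le_mul_right hle _).trans (le_of_eq ?_))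
  push_cast
  ring

/-- The equivalences and the bounds of the constants for the rotation. -/
theorem rot_equivalences (h : IsBoundedDomain Ω) (hS : Supports Hardy Ω) :
    (Supports FriedrichsVelteRot Ω ↔ Supports BabuskaAzizRot Ω) ∧
      (Supports FriedrichsVelteRot Ω ↔ Supports ImprovedPoincareRot Ω) ∧
      bestConst FriedrichsVelteRot Ω / 4 ≤ bestConst ImprovedPoincareRot Ω ∧
      bestConst ImprovedPoincareRot Ω ≤
        bestConst Hardy Ω * (1 + bestConst FriedrichsVelteRot Ω) := by
  obtain ⟨H, hH, hHardy⟩ := id hS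
  refine ⟨⟨?_, ?_⟩, ⟨?_, ?_⟩, ?_, ?_⟩
  · rintro ⟨Γ, hΓ, hΓ'⟩
    exact ⟨1 + Γ, by positivity, (hΓ'.rotRightInverse h).babuskaAzizRot h hHardy⟩
  · rintro ⟨C, hC, hC'⟩
    exact ⟨C, hC, hC'.friedrichsVelteRot h hHardy⟩
  · rintro ⟨Γ, hΓ, hΓ'⟩
    exact ⟨H * (1 + Γ), by positivity, (hΓ'.rotRightInverse h).improvedPoincareRot h hHardy⟩
  · rintro ⟨P, hP, hP'⟩
    exact ⟨4 * P, by positivity, hP'.friedrichsVelteRot h⟩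
  · exact bestConst_div_four_le fun P hP => hP.friedrichsVelteRot h
  · exact bestConst_le_hardy_mul hS (bestConst_hardy_ne_zero h hS) fun H Γ hH hΓ =>
      (hΓ.rotRightInverse h).improvedPoincareRot h hH

end Spatial

theorem mainTheorem1 :
    (∀ Ω : Set (Vec 2), IsBoundedDomain Ω → Supports Hardy Ω →
      (Supports FriedrichsVelte2 Ω ↔ Supports BabuskaAzizDiv Ω) ∧
      (Supports FriedrichsVelte2 Ω ↔ Supports ImprovedPoincare Ω) ∧
      bestConst FriedrichsVelte2 Ω / 4 ≤ bestConst ImprovedPoincare Ω ∧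
      bestConst ImprovedPoincare Ω ≤ bestConst Hardy Ω * (1 + bestConst FriedrichsVelte2 Ω)) ∧
    (∀ Ω : Set (Vec 3), IsBoundedDomain Ω → Supports Hardy Ω →
      ((Supports FriedrichsVelte3 Ω ↔ Supports BabuskaAzizDiv Ω) ∧
        (Supports FriedrichsVelte3 Ω ↔ Supports ImprovedPoincare Ω) ∧
        bestConst FriedrichsVelte3 Ω / 4 ≤ bestConst ImprovedPoincare Ω ∧
        bestConst ImprovedPoincare Ω ≤ bestConst Hardy Ω * (1 + bestConst FriedrichsVelte3 Ω)) ∧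
      ((Supports FriedrichsVelteRot Ω ↔ Supports BabuskaAzizRot Ω) ∧
        (Supports FriedrichsVelteRot Ω ↔ Supports ImprovedPoincareRot Ω) ∧
        bestConst FriedrichsVelteRot Ω / 4 ≤ bestConst ImprovedPoincareRot Ω ∧
        bestConst ImprovedPoincareRot Ω ≤
          bestConst Hardy Ω * (1 + bestConst FriedrichsVelteRot Ω))) := by
  refine ⟨fun Ω h hS => ?_, fun Ω h hS => ⟨?_, rot_equivalences h hS⟩⟩
  · exact div_equivalences (CH := IsConjHarmonic2 Ω) h hS isRotSymbol_rotLin₂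
      (fun _ => Iff.rfl) (fun u v huv => (isConjHarmonic2_iff h).1 huv)
      (fun u g _ hc => (isConjHarmonic2_iff h).2 ⟨Lp.memLp u, Lp.memLp _, hc⟩)
  · exact div_equivalences (CH := IsConjHarmonic3 Ω) h hS isRotSymbol_rotLin₃
      (fun _ => Iff.rfl) (fun u v huv => ⟨huv.1, huv.2.1, huv.isConjugate⟩)
      -- In space a conjugate pair must also satisfy `div v = 0`; this holds because `v` is a limit
      -- of rotations.
      (fun u g hg hc => isConjHarmonic3_of_mem_rotClosure (compJac_mem_rotClosure _ hg) hc)
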